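/- Fix an integer $d\ge 2$. A circle endomorphism $f$ of degree $d$ with $f(1)=1$ is identified with its lift $F:\mathbb R\to\mathbb R$ (through $x\mapsto e^{2\pi i x}$), an increasing homeomorphism with $F(0)=0$ and $F(x+1)=F(x)+d$. Let $\mathcal C^{1+}$ be the set of those $f$ for which $F$ is $C^1$ with $F'$ $\alpha$-Hölder for some $0<\alpha\le 1$ (depending on $f$), and which are expanding: there are $C>0$, $\lambda>1$ with $(F^n)'(x)\ge C\lambda^n$ for all $x\in\mathbb R$, $n\ge1$. Let $q_d(z)=z^d$. For $f\in\mathcal C^{1+}$ let $h_f$ be the orientation-preserving homeomorphism of the unit circle $T$ with $h_f(1)=1$ and $f\circ h_f=h_f\circ q_d$. Write $(f,h_f)\sim_T(g,h_g)$ if $h_f\circ h_g^{-1}$ is a $C^1$-diffeomorphism, and let $\mathcal T\mathcal C^{1+}$ be the set of equivalence classes $[(f,h_f)]$, $f\in\mathcal C^{1+}$. For a word $w=i_0\cdots i_{n-1}$ in the digits $0,\dots,d-1$ let $I_w\subset[0,1]$ be the interval defined by $I_\emptyset=[0,1]$ and $I_{iw}=\{x: F(x)-i\in I_w\}$. Let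 $\Sigma^*$ be the set of left-infinite sequences $w^*=\cdots j_2j_1j_0$ of such digits. The dual derivative of $f$ is $$D^*(f)(w^*)=\lim_{n\to\infty}\frac{|I_{j_{n-1}\cdots j_1}|}{|I_{j_{n-1}\cdots j_1j_0}|}.$$ A function $\phi$ on $\Sigma^*$ is Hölder continuous if there are $C>0$, $0<\tau<1$ with $|\phi(w^*)-\phi(\tilde w^*)|\le C\tau^n$ whenever the last $n$ digits $j_{n-1}\cdots j_0$ of $w^*$ and $\tilde w^*$ agree. For an orientation-preserving homeomorphism $h$ of $T$ let $B_h\in[1,\infty]$ be its boundary dilatation: the infimum of $(1+k)/(1-k)$ over all quasiconformal extensions $\tilde h:U\to\mathbb C$ of $h$ to open neighborhoods $U$ of $T$ in $\mathbb C$, where $k=\|\tilde h_{\bar z}/\tilde h_z\|_{\infty,U}<1$. For $\Pi=[(f,h_f)]$ and $\Pi'=[(g,h_g)]$ put $d_{\mathcal T}(\Pi,\Pi')=\frac12\log B_{h_f\circ h_g^{-1}}$. **Theorem.** 1. For every $f\in\mathcal C^{1+}$ the homeomorphism $h_f$ exists and is unique, and $D^*(f)$ exists at every point of $\Sigma^*$,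 is positive and Hölder continuous. 2. For $f,g\in\mathcal C^{1+}$: $(f,h_f)\sim_T(g,h_g)$ if and only if $D^*(f)=D^*(g)$. 3. For $\Pi,\Pi'\in\mathcal T\mathcal C^{1+}$, and for any choice of the representatives $(f,h_f)\in\Pi$, $(g,h_g)\in\Pi'$ that are used to compute $d_{\mathcal T}(\Pi,\Pi')$: $d_{\mathcal T}(\Pi,\Pi')=0$ if and only if $\Pi=\Pi'$. 4. Hence $[(f,h_f)]\mapsto D^*(f)$ is a well-defined bijection from $\mathcal T\mathcal C^{1+}$ onto the space $\{D^*(f) : f\in\mathcal C^{1+}\}$ of Hölder continuous dual derivatives. -/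

import Mathlib

open MeasureTheory Filter Topology Set
open scoped ENNReal NNReal ContDiff

noncomputable section

namespace CircleDynamics

/-- A degree `d` circle endomorphism fixing the point `1` of the unit circle, given by its lift
`F` to the universal cover `ℝ` (the circle map is `e^{2πix} ↦ e^{2πiF(x)}`): an
orientation-preserving homeomorphism of `ℝ` (an order isomorphism of `ℝ` is the same thing as an
increasing homeomorphism) with `F 0 = 0` and `F (x + 1) = F x + d`. -/
structure CircleEndo (d : ℕ) where
  lift : ℝ ≃o ℝ
  map_zero : lift 0 = 0
  map_add_one : ∀ x, lift (x + 1) = lift x + d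

/-- The circle endomorphism is `C^{1+α}` for some `0 < α ≤ 1`. -/
def CircleEndo.IsC1Holder {d : ℕ} (F : CircleEndo d) : Prop :=
  ContDiff ℝ 1 F.lift ∧
    ∃ C α : ℝ≥0, 0 < α ∧ α ≤ 1 ∧ HolderWith C α (deriv F.lift)

/-- The circle endomorphism is expanding: `(F^n)' ≥ C λ^n` with `C > 0`, `λ > 1`. -/
def CircleEndo.IsExpanding {d : ℕ} (F : CircleEndo d) : Prop :=
  ∃ C l : ℝ, 0 < C ∧ 1 < l ∧ ∀ n : ℕ, 1 ≤ n → ∀ x : ℝ, C * l ^ n ≤ deriv (F.lift^[n]) x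

/-- The space `𝒞^{1+}` of all `C^{1+α}`, `0 < α ≤ 1`, expanding circle endomorphisms
of degree `d`. -/
def C1Plus (d : ℕ) : Type := {F : CircleEndo d // F.IsC1Holder ∧ F.IsExpanding}

/-- `H` is the lift, with `H 0 = 0`, of an orientation-preserving circle homeomorphism `h` with
`h(1) = 1` and `f ∘ h = h ∘ q_d`, where `q_d(z) = z^d` has the lift `x ↦ d x`. -/
structure IsMarking {d : ℕ} (F : CircleEndo d) (H : ℝ ≃o ℝ) : Prop where
  map_zero : H 0 = 0
  map_add_one : ∀ x, H (x + 1) = H x + 1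
  conj : ∀ x, F.lift (H x) = H (d * x)

/-- A marked `C^{1+}` circle endomorphism `(f, h_f)` by `q_d`. -/
structure MarkedMap (d : ℕ) where
  map : C1Plus d
  marking : ℝ ≃o ℝ
  isMarking : IsMarking map.1 marking

/-- The lift of the conjugacy `h_f ∘ h_g⁻¹`. -/
def MarkedMap.conjugacy {d : ℕ} (f g : MarkedMap d) : ℝ ≃o ℝ :=
  g.marking.symm.trans f.marking

/-- The lift `H` (and hence the circle homeomorphism) is a `C^1`-diffeomorphism. -/
def IsC1Diffeo (H : ℝ ≃o ℝ) : Prop := ContDiff ℝ 1 H ∧ ContDiff ℝ 1 H.symm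

/-- The Teichmüller equivalence relation: `h_f ∘ h_g⁻¹` is a `C^1`-diffeomorphism. -/
def TeichEquiv {d : ℕ} (f g : MarkedMap d) : Prop := IsC1Diffeo (f.conjugacy g)

theorem teichEquiv_equivalence (d : ℕ) : Equivalence (TeichEquiv (d := d)) where
  refl f := by
    have h : f.conjugacy f = OrderIso.refl ℝ := by
      ext x; simp [MarkedMap.conjugacy]
    have h' : (⇑(OrderIso.refl ℝ) : ℝ → ℝ) = fun x => x := rfl
    have h'' : (⇑(OrderIso.refl ℝ).symm : ℝ → ℝ) = fun x => x := rfl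
    unfold TeichEquiv IsC1Diffeo
    rw [h, h', h'']
    exact ⟨contDiff_id, contDiff_id⟩
  symm {f g} h := by
    have e : g.conjugacy f = (f.conjugacy g).symm := rfl
    unfold TeichEquiv IsC1Diffeo at *
    rw [e]
    exact ⟨h.2, h.1⟩
  trans {f g k} h₁ h₂ := by
    have e : (⇑(f.conjugacy k) : ℝ → ℝ) = f.conjugacy g ∘ g.conjugacy k := by
      ext x; simp [MarkedMap.conjugacy]
    have e' : (⇑(f.conjugacy k).symm : ℝ → ℝ)
        = (g.conjugacy k).symm ∘ (f.conjugacy g).symm := by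
      ext x; simp [MarkedMap.conjugacy]
    unfold TeichEquiv IsC1Diffeo at *
    rw [e, e']
    exact ⟨h₁.1.comp h₂.1, h₂.2.comp h₁.2⟩

/-- Marked `C^{1+}` maps with the Teichmüller equivalence relation. -/
instance teichSetoid (d : ℕ) : Setoid (MarkedMap d) := ⟨TeichEquiv, teichEquiv_equivalence d⟩

/-- The Teichmüller space `𝒯𝒞^{1+}` of smooth expanding circle endomorphisms of degree `d`. -/
def TeichSpace (d : ℕ) : Type := Quotient (teichSetoid d)

/-! ### Dual derivatives -/

/-- The dual symbolic space; the point `⋯ j₂ j₁ j₀` is the sequence `k ↦ j_k`. -/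
abbrev DualSpace (d : ℕ) : Type := ℕ → Fin d

/-- The right shift `⋯ j₂ j₁ j₀ ↦ ⋯ j₂ j₁`. -/
def dualShift {d : ℕ} (j : DualSpace d) : DualSpace d := fun k => j (k + 1)

/-- The Markov interval `I_w ⊆ [0,1]` of the word `w = i₀ i₁ ⋯ i_{n-1}`. The empty word gives
`[0,1]`, and `I_{iw}` is the part of `I_i = F⁻¹[i,i+1]` that `F`, modulo `1`, maps onto `I_w`. -/
def markovInterval {d : ℕ} (F : CircleEndo d) : List (Fin d) → Set ℝ
  | [] => Icc 0 1
  | i :: w => {x | F.lift x - ((i : ℕ) : ℝ) ∈ markovInterval F w}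

/-- The word `j_{n-1} ⋯ j₁ j₀` (so `i₀ = j_{n-1}`, …, `i_{n-1} = j₀`). -/
def dualWord {d : ℕ} (j : DualSpace d) : ℕ → List (Fin d)
  | 0 => []
  | n + 1 => j n :: dualWord j n

/-- The length of the interval of the word `j_{n-1} ⋯ j₁ j₀`. -/
def dualLength {d : ℕ} (F : CircleEndo d) (j : DualSpace d) (n : ℕ) : ℝ :=
  volume.real (markovInterval F (dualWord j n))

/-- The quotient `|I_{v_n}| / |I_{w_{n+1}}|`, where `w_{n+1} = j_n ⋯ j₁ j₀` and
`v_n = j_n ⋯ j₁` is `w_{n+1}` without its last digit. -/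
def preDualDerivative {d : ℕ} (F : CircleEndo d) (j : DualSpace d) (n : ℕ) : ℝ :=
  dualLength F (dualShift j) n / dualLength F j (n + 1)

/-- The limit which defines the dual derivative exists, and is positive, at every point of the
dual symbolic space. -/
def HasDualDerivative {d : ℕ} (F : CircleEndo d) : Prop :=
  ∀ j : DualSpace d, ∃ L : ℝ, 0 < L ∧ Tendsto (preDualDerivative F j) atTop (𝓝 L)

/-- The dual derivative `D^*(f)`. -/
def dualDerivative {d : ℕ} (F : CircleEndo d) : DualSpace d → ℝ :=
  fun j => limUnder atTop (preDualDerivative F j)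

/-- Hölder continuity of a function on the dual symbolic space. -/
def IsHolderDual {d : ℕ} (φ : DualSpace d → ℝ) : Prop :=
  ∃ C τ : ℝ, 0 < C ∧ 0 < τ ∧ τ < 1 ∧ ∀ (n : ℕ) (j j' : DualSpace d),
    (∀ k < n, j k = j' k) → |φ j - φ j'| ≤ C * τ ^ n

/-- The space of Hölder continuous dual derivatives of maps in `𝒞^{1+}`. -/
def HolderDualDerivatives (d : ℕ) : Set (DualSpace d → ℝ) :=
  {D | IsHolderDual D ∧ ∃ F : C1Plus d, HasDualDerivative F.1 ∧ D = dualDerivative F.1}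

/-! ### Quasiconformal extensions, boundary dilatation and the Teichmüller distance -/

/-- `g` is the weak derivative of `φ` on the open set `U ⊆ ℂ` in the direction `v`. -/
def HasWeakDeriv (φ : ℂ → ℂ) (U : Set ℂ) (v : ℂ) (g : ℂ → ℂ) : Prop :=
  ∀ ψ : ℂ → ℝ, ContDiff ℝ ∞ ψ → HasCompactSupport ψ → tsupport ψ ⊆ U →
    ∫ z, (fderiv ℝ ψ z v) • φ z = - ∫ z, ψ z • g z

/-- `φ` is quasiconformal on the open set `U` (a homeomorphism of `U` onto an open subset of `ℂ`
with weak partial derivatives `φ_x`, `φ_y` in `L²_loc(U)`) and its complex dilatation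
`μ = φ_{z̄} / φ_z` satisfies `‖μ‖_{∞,U} ≤ k < 1`, where `φ_z = (φ_x - i φ_y) / 2` and
`φ_{z̄} = (φ_x + i φ_y) / 2`. -/
structure IsQuasiconformalOn (φ : ℂ → ℂ) (U : Set ℂ) (k : ℝ) : Prop where
  isOpen : IsOpen U
  embedding : IsOpenEmbedding (U.domRestrict φ)
  nonneg : 0 ≤ k
  lt_one : k < 1
  dilatation : ∃ φx φy : ℂ → ℂ,
    (∀ A ⊆ U, IsCompact A →
      MemLp φx 2 (volume.restrict A) ∧ MemLp φy 2 (volume.restrict A)) ∧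
    HasWeakDeriv φ U 1 φx ∧ HasWeakDeriv φ U Complex.I φy ∧
    ∀ᵐ z ∂(volume.restrict U),
      ‖(φx z + Complex.I * φy z) / 2‖ ≤ k * ‖(φx z - Complex.I * φy z) / 2‖

/-- The covering map `x ↦ e^{2πix}` of the unit circle. -/
def circleCover (x : ℝ) : ℂ := Complex.exp (2 * Real.pi * Complex.I * x)

/-- `φ`, on the neighborhood `U` of the unit circle, is a quasiconformal extension, with
`‖μ‖_{∞,U} ≤ k`, of the circle homeomorphism with lift `H`. -/
structure IsQCExtension (H : ℝ ≃o ℝ) (U : Set ℂ) (φ : ℂ → ℂ) (k : ℝ) : Prop where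
  quasiconformal : IsQuasiconformalOn φ U k
  circle_subset : Metric.sphere (0 : ℂ) 1 ⊆ U
  extends_map : ∀ x : ℝ, φ (circleCover x) = circleCover (H x)

/-- The boundary dilatation `B_h` of the circle homeomorphism with lift `H`: the infimum of
`(1 + k) / (1 - k)` over all quasiconformal extensions to neighborhoods of the circle
(`∞` if there is none). -/
def boundaryDilatation (H : ℝ ≃o ℝ) : ℝ≥0∞ :=
  ⨅ (U : Set ℂ) (φ : ℂ → ℂ) (k : ℝ) (_ : IsQCExtension H U φ k),
    ENNReal.ofReal ((1 + k) / (1 - k))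

/-- The Teichmüller distance `½ log B_h`, `h = h_f ∘ h_g⁻¹`, of the points of the Teichmüller
space that are represented by `(f, h_f)` and `(g, h_g)`. -/
def teichDist {d : ℕ} (f g : MarkedMap d) : EReal :=
  ((1 / 2 : ℝ) : EReal) * ENNReal.log (boundaryDilatation (f.conjugacy g))

end CircleDynamics

end

open CircleDynamics

/-!
If a conjugacy between expanding maps has a nonzero derivative at one point, then, by bounded
distortion, zooming in on that point with inverse iterates shows that it is a `C^1`-diffeomorphism.
A Lipschitz conjugacy has such a point, and a conjugacy is Lipschitz as soon as it expands the
lengths of Markov intervals by at most a bounded factor. So it suffices that equal dual derivatives,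
or a boundary dilatation equal to `1`, bound these factors.

The dual derivative is the limit of the length ratios `|I_v| / |I_{vi}|`, with an error which is
exponentially small in the length of the word, so its values determine the length of a Markov
interval up to a bounded factor.

If the boundary dilatation is `1`, there are quasiconformal extensions with arbitrarily small
dilatation. The isoperimetric inequality for the images of small circles turns this into a weighted
energy estimate, and by Morrey's argument the conjugacy is Hölder with every exponent `b < 1`.
Lengths of Markov intervals are multiplicative up to bounded factors, so comparing them for the
`m`-fold repetition of a word removes the Hölder constant as `m → ∞`, and `b → 1` leaves a bounded
factor. Conversely, a `C^1`-diffeomorphism has an explicit extension by averages and differences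
whose dilatation is arbitrarily small near the circle.
-/

noncomputable section

namespace CircleDynamics

/-! ### Iterates and bounded distortion -/

theorem map_add_int_of_map_add_one {K : ℝ → ℝ} {D : ℝ} (h : ∀ x, K (x + 1) = K x + D) (x : ℝ)
    (m : ℤ) : K (x + m) = K x + D * m := by
  simpa [mul_comm] using AddConstMapClass.map_add_int' (⟨K, h⟩ : AddConstMap ℝ ℝ 1 D) x m

theorem abs_sub_mul_le_of_map_int {K : ℝ → ℝ} (hK : Monotone K) {D : ℝ} (hD : 0 ≤ D)
    (h : ∀ m : ℤ, K m = D * m) (x : ℝ) : |K x - D * x| ≤ D := by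
  have hfloor : D * ⌊x⌋ ≤ K x := h ⌊x⌋ ▸ hK (Int.floor_le x)
  have hceil : K x ≤ D * (⌊x⌋ + 1) := by
    simpa using (hK (Int.lt_floor_add_one x).le).trans_eq (by simpa using h (⌊x⌋ + 1))
  have hx : D * ⌊x⌋ ≤ D * x := by gcongr; exact Int.floor_le x
  have hx' : D * x ≤ D * (⌊x⌋ + 1) := by gcongr; exact (Int.lt_floor_add_one x).le
  rw [abs_le]
  constructor <;> linarith

theorem sum_range_pow_sub_le {ρ : ℝ} (hρ0 : 0 ≤ ρ) (hρ1 : ρ < 1) (n : ℕ) :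
    ∑ k ∈ Finset.range n, ρ ^ (n - k) ≤ (1 - ρ)⁻¹ := by
  calc ∑ k ∈ Finset.range n, ρ ^ (n - k)
      ≤ ∑ k ∈ Finset.range n, ρ ^ (n - 1 - k) :=
        Finset.sum_le_sum fun k _ => pow_le_pow_of_le_one hρ0 hρ1.le (by omega)
    _ = ∑ k ∈ Finset.range n, ρ ^ k := Finset.sum_range_reflect (fun k => ρ ^ k) n
    _ ≤ ∑' k, ρ ^ k := (summable_geometric_of_lt_one hρ0 hρ1).sum_le_tsum _ fun _ _ => by positivity
    _ = (1 - ρ)⁻¹ := tsum_geometric_of_lt_one hρ0 hρ1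

namespace CircleEndo

variable {d : ℕ} {F : CircleEndo d}

/-- The `n`-th iterate of the lift, as an order isomorphism, so that its inverse is available. -/
def iter (F : CircleEndo d) : ℕ → ℝ ≃o ℝ
  | 0 => OrderIso.refl ℝ
  | n + 1 => (F.iter n).trans F.lift

@[simp] theorem iter_zero (x : ℝ) : F.iter 0 x = x := rfl

theorem iter_succ (n : ℕ) (x : ℝ) : F.iter (n + 1) x = F.lift (F.iter n x) := rfl

theorem coe_iter (F : CircleEndo d) (n : ℕ) : ⇑(F.iter n) = F.lift^[n] := by
  induction n with
  | zero => rfl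
  | succ n ih => ext x; rw [iter_succ, ih, Function.iterate_succ_apply']

theorem iter_add (m n : ℕ) (x : ℝ) : F.iter (m + n) x = F.iter m (F.iter n x) := by
  simp only [coe_iter, Function.iterate_add_apply]

theorem iter_succ' (n : ℕ) (x : ℝ) : F.iter (n + 1) x = F.iter n (F.lift x) := iter_add n 1 x

@[simp] theorem iter_map_zero (n : ℕ) : F.iter n 0 = 0 := by
  induction n with
  | zero => rfl
  | succ n ih => rw [iter_succ, ih, F.map_zero]

theorem iter_add_int (n : ℕ) (x : ℝ) (m : ℤ) : F.iter n (x + m) = F.iter n x + d ^ n * m := by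
  induction n with
  | zero => simp
  | succ n ih =>
    have h := map_add_int_of_map_add_one F.map_add_one (F.iter n x) ((d : ℤ) ^ n * m)
    push_cast at h
    rw [iter_succ, ih, h, iter_succ]; ring

theorem iter_int (n : ℕ) (m : ℤ) : F.iter n m = d ^ n * m := by
  simpa using iter_add_int (F := F) n 0 m

theorem iter_symm_add_int (n : ℕ) (x : ℝ) (m : ℤ) :
    (F.iter n).symm (x + d ^ n * m) = (F.iter n).symm x + m := by
  rw [OrderIso.symm_apply_eq, iter_add_int, OrderIso.apply_symm_apply]

theorem abs_iter_sub_le (n : ℕ) (x : ℝ) : |F.iter n x - d ^ n * x| ≤ d ^ n :=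
  abs_sub_mul_le_of_map_int (F.iter n).monotone (by positivity) (iter_int n) x

theorem IsC1Holder.differentiable (h : F.IsC1Holder) : Differentiable ℝ F.lift :=
  h.1.differentiable one_ne_zero

theorem hasDerivAt_iter (h : Differentiable ℝ F.lift) (n : ℕ) (x : ℝ) :
    HasDerivAt (F.iter n) (∏ k ∈ Finset.range n, deriv F.lift (F.iter k x)) x := by
  induction n with
  | zero =>
    rw [Finset.range_zero, Finset.prod_empty]
    exact hasDerivAt_id x
  | succ n ih =>
    rw [Finset.prod_range_succ, mul_comm]
    exact (h (F.iter n x)).hasDerivAt.comp x ih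

theorem IsExpanding.exists_le_deriv (hexp : F.IsExpanding) :
    ∃ m : ℝ, 0 < m ∧ ∀ x, m ≤ deriv F.lift x := by
  obtain ⟨C, l, hC, hl, h⟩ := hexp
  exact ⟨C * l ^ 1, by positivity, fun x => by simpa using h 1 le_rfl x⟩

theorem IsExpanding.deriv_pos (hexp : F.IsExpanding) (x : ℝ) : 0 < deriv F.lift x :=
  let ⟨_, hm, hle⟩ := hexp.exists_le_deriv
  hm.trans_le (hle x)

theorem IsExpanding.deriv_iter_pos (hexp : F.IsExpanding) (hdiff : Differentiable ℝ F.lift) (n : ℕ)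
    (x : ℝ) : 0 < deriv (F.iter n) x :=
  (hasDerivAt_iter hdiff n x).deriv ▸ Finset.prod_pos fun _ _ => hexp.deriv_pos _

theorem IsExpanding.exists_le_iter_sub (hexp : F.IsExpanding) (hdiff : Differentiable ℝ F.lift) :
    ∃ C l : ℝ, 0 < C ∧ 1 < l ∧ ∀ (n : ℕ) (x y : ℝ), x ≤ y →
      C * l ^ n * (y - x) ≤ F.iter n y - F.iter n x := by
  obtain ⟨C, l, hC, hl, h⟩ := hexp
  refine ⟨min C 1, l, by positivity, hl, fun n x y hxy => ?_⟩
  have hderiv := hasDerivAt_iter hdiff n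
  refine Convex.mul_sub_le_image_sub_of_le_deriv convex_univ (f := F.iter n)
    (fun z _ => (hderiv z).continuousAt.continuousWithinAt)
    (fun z _ => (hderiv z).differentiableAt.differentiableWithinAt) (fun z _ => ?_)
    x (mem_univ _) y (mem_univ _) hxy
  rcases Nat.eq_zero_or_pos n with rfl | hn
  · rw [(hderiv z).deriv]; simp
  · rw [coe_iter]
    exact (mul_le_mul_of_nonneg_right (min_le_left _ _) (by positivity)).trans (h n hn z)

theorem IsExpanding.exists_abs_sub_le (hexp : F.IsExpanding) (hdiff : Differentiable ℝ F.lift) :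
    ∃ B l : ℝ, 0 < B ∧ 1 < l ∧ ∀ (n : ℕ) (x y : ℝ),
      |x - y| ≤ B * (l ^ n)⁻¹ * |F.iter n x - F.iter n y| := by
  obtain ⟨C, l, hC, hl, h⟩ := hexp.exists_le_iter_sub hdiff
  refine ⟨C⁻¹, l, by positivity, hl, fun n x y => ?_⟩
  rw [← mul_inv, inv_mul_eq_div, le_div_iff₀ (by positivity), mul_comm]
  rcases le_total x y with hxy | hxy
  · rw [abs_sub_comm x, abs_of_nonneg (sub_nonneg.2 hxy), abs_sub_comm]
    exact (h n x y hxy).trans (le_abs_self _)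
  · rw [abs_of_nonneg (sub_nonneg.2 hxy)]
    exact (h n y x hxy).trans (le_abs_self _)

theorem IsExpanding.exists_sum_rpow_abs_iter_sub_le (hexp : F.IsExpanding)
    (hdiff : Differentiable ℝ F.lift) {α : ℝ} (hα : 0 < α) :
    ∃ B : ℝ, 0 ≤ B ∧ ∀ (n : ℕ) (x y : ℝ),
      ∑ k ∈ Finset.range n, |F.iter k x - F.iter k y| ^ α ≤
        B * |F.iter n x - F.iter n y| ^ α := by
  obtain ⟨B, l, hB, hl, h⟩ := hexp.exists_abs_sub_le hdiff
  have hl0 : 0 < l := one_pos.trans hl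
  set ρ : ℝ := (l ^ α)⁻¹ with hρ
  have hρ0 : 0 < ρ := by positivity
  have hρ1 : ρ < 1 := inv_lt_one_of_one_lt₀ (Real.one_lt_rpow hl hα)
  have hpow (m : ℕ) : ((l ^ m)⁻¹) ^ α = ρ ^ m := by
    rw [hρ, Real.inv_rpow (by positivity), inv_pow, Real.rpow_pow_comm hl0.le]
  refine ⟨B ^ α * (1 - ρ)⁻¹, mul_nonneg (by positivity) (inv_nonneg.2 (by linarith)),
    fun n x y => ?_⟩
  have hterm : ∀ k ∈ Finset.range n, |F.iter k x - F.iter k y| ^ α ≤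
      B ^ α * |F.iter n x - F.iter n y| ^ α * ρ ^ (n - k) := by
    intro k hk
    have hcontr := h (n - k) (F.iter k x) (F.iter k y)
    rw [← iter_add, ← iter_add, Nat.sub_add_cancel (Finset.mem_range.1 hk).le] at hcontr
    refine (Real.rpow_le_rpow (abs_nonneg _) hcontr hα.le).trans_eq ?_
    rw [Real.mul_rpow (by positivity) (abs_nonneg _), Real.mul_rpow hB.le (by positivity), hpow]
    ring
  calc _ ≤ ∑ k ∈ Finset.range n, B ^ α * |F.iter n x - F.iter n y| ^ α * ρ ^ (n - k) :=
        Finset.sum_le_sum hterm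
    _ = B ^ α * |F.iter n x - F.iter n y| ^ α * ∑ k ∈ Finset.range n, ρ ^ (n - k) :=
        (Finset.mul_sum _ _ _).symm
    _ ≤ B ^ α * |F.iter n x - F.iter n y| ^ α * (1 - ρ)⁻¹ := by
        gcongr; exact sum_range_pow_sub_le hρ0.le hρ1 n
    _ = _ := by ring

theorem exists_log_deriv_sub_le (hC1 : F.IsC1Holder) (hexp : F.IsExpanding) :
    ∃ K α : ℝ, 0 ≤ K ∧ 0 < α ∧ ∀ u v : ℝ,
      Real.log (deriv F.lift u) - Real.log (deriv F.lift v) ≤ K * |u - v| ^ α := by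
  obtain ⟨m, hm, hle⟩ := hexp.exists_le_deriv
  obtain ⟨-, C, α, hα, -, hH⟩ := hC1
  refine ⟨C / m, α, by positivity, by exact_mod_cast hα, fun u v => ?_⟩
  have hu := hexp.deriv_pos u
  have hv := hexp.deriv_pos v
  have hdist : |deriv F.lift u - deriv F.lift v| ≤ C * |u - v| ^ (α : ℝ) := by
    simpa only [Real.dist_eq] using hH.dist_le u v
  calc Real.log (deriv F.lift u) - Real.log (deriv F.lift v)
      = Real.log (deriv F.lift u / deriv F.lift v) := (Real.log_div hu.ne' hv.ne').symm
    _ ≤ deriv F.lift u / deriv F.lift v - 1 := Real.log_le_sub_one_of_pos (div_pos hu hv)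
    _ = (deriv F.lift u - deriv F.lift v) / deriv F.lift v := by rw [sub_div, div_self hv.ne']
    _ ≤ C * |u - v| ^ (α : ℝ) / m :=
        div_le_div₀ (by positivity) ((le_abs_self _).trans hdist) hm (hle v)
    _ = _ := by ring

theorem exists_deriv_iter_le (hC1 : F.IsC1Holder) (hexp : F.IsExpanding) :
    ∃ A α : ℝ, 0 ≤ A ∧ 0 < α ∧ ∀ (n : ℕ) (x y : ℝ),
      deriv (F.iter n) x ≤
        Real.exp (A * |F.iter n x - F.iter n y| ^ α) * deriv (F.iter n) y := by
  obtain ⟨K, α, hK, hα, hlog⟩ := exists_log_deriv_sub_le hC1 hexp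
  obtain ⟨B, hB, hsum⟩ := hexp.exists_sum_rpow_abs_iter_sub_le hC1.differentiable hα
  refine ⟨K * B, α, by positivity, hα, fun n x y => ?_⟩
  have log_deriv (z : ℝ) : Real.log (deriv (F.iter n) z) =
      ∑ k ∈ Finset.range n, Real.log (deriv F.lift (F.iter k z)) := by
    rw [(hasDerivAt_iter hC1.differentiable n z).deriv,
      Real.log_prod fun _ _ => (hexp.deriv_pos _).ne']
  have hpos := hexp.deriv_iter_pos hC1.differentiable n
  rw [← Real.log_le_log_iff (hpos x) (mul_pos (Real.exp_pos _) (hpos y)),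
    Real.log_mul (Real.exp_ne_zero _) (hpos y).ne', Real.log_exp, ← sub_le_iff_le_add, log_deriv,
    log_deriv, ← Finset.sum_sub_distrib]
  calc _ ≤ ∑ k ∈ Finset.range n, K * |F.iter k x - F.iter k y| ^ α :=
        Finset.sum_le_sum fun _ _ => hlog _ _
    _ = K * ∑ k ∈ Finset.range n, |F.iter k x - F.iter k y| ^ α := (Finset.mul_sum _ _ _).symm
    _ ≤ K * (B * |F.iter n x - F.iter n y| ^ α) := by gcongr; exact hsum n x y
    _ = _ := by ring

theorem exists_sub_eq_deriv_iter_mul (hdiff : Differentiable ℝ F.lift) (n : ℕ) {u v : ℝ}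
    (huv : u < v) : ∃ ξ, F.iter n ξ ∈ Icc u v ∧
      v - u = deriv (F.iter n) ξ * ((F.iter n).symm v - (F.iter n).symm u) := by
  have hlt := (F.iter n).symm.strictMono huv
  obtain ⟨ξ, hξ, hslope⟩ := exists_hasDerivAt_eq_slope (F.iter n) _ hlt
    (F.iter n).continuous.continuousOn fun z _ => hasDerivAt_iter hdiff n z
  refine ⟨ξ, ⟨?_, ?_⟩, ?_⟩
  · simpa using (F.iter n).monotone hξ.1.le
  · simpa using (F.iter n).monotone hξ.2.le
  · rw [(hasDerivAt_iter hdiff n ξ).deriv, hslope]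
    simp [(sub_pos.2 hlt).ne']

theorem exists_bounded_distortion (hC1 : F.IsC1Holder) (hexp : F.IsExpanding) :
    ∃ A α : ℝ, 0 ≤ A ∧ 0 < α ∧ ∀ (n : ℕ) (b c p q r s : ℝ), p < q → r < s →
      p ∈ Icc b c → q ∈ Icc b c → r ∈ Icc b c → s ∈ Icc b c →
      ((F.iter n).symm q - (F.iter n).symm p) * (s - r) ≤
        Real.exp (A * (c - b) ^ α) * ((F.iter n).symm s - (F.iter n).symm r) * (q - p) := by
  obtain ⟨A, α, hA, hα, hD⟩ := exists_deriv_iter_le hC1 hexp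
  refine ⟨A, α, hA, hα, fun n b c p q r s hpq hrs hp hq hr hs => ?_⟩
  obtain ⟨ξ, hξ, hqp⟩ := exists_sub_eq_deriv_iter_mul hC1.differentiable n hpq
  obtain ⟨η, hη, hsr⟩ := exists_sub_eq_deriv_iter_mul hC1.differentiable n hrs
  have hpos := hexp.deriv_iter_pos hC1.differentiable n
  have hdist : |F.iter n η - F.iter n ξ| ≤ c - b := by
    rw [abs_le]
    constructor <;> linarith [hξ.1, hξ.2, hη.1, hη.2, hp.1, hq.2, hr.1, hs.2]
  have hderiv : deriv (F.iter n) η ≤ Real.exp (A * (c - b) ^ α) * deriv (F.iter n) ξ :=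
    (hD n η ξ).trans (by gcongr; exact (hpos ξ).le)
  have hqp' := sub_pos.2 ((F.iter n).symm.strictMono hpq)
  have hsr' := sub_pos.2 ((F.iter n).symm.strictMono hrs)
  rw [hqp, hsr]
  calc _ = ((F.iter n).symm q - (F.iter n).symm p) * ((F.iter n).symm s - (F.iter n).symm r) *
        deriv (F.iter n) η := by ring
    _ ≤ ((F.iter n).symm q - (F.iter n).symm p) * ((F.iter n).symm s - (F.iter n).symm r) *
        (Real.exp (A * (c - b) ^ α) * deriv (F.iter n) ξ) := by gcongr
    _ = _ := by ring

/-! ### The marking -/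

theorem tendsto_inv_degree_pow (hd : 2 ≤ d) : Tendsto (fun n => ((d : ℝ) ^ n)⁻¹) atTop (𝓝 0) :=
  (tendsto_pow_atTop_atTop_of_one_lt (by exact_mod_cast hd)).inv_tendsto_atTop

/-- The function `x ↦ lim Fⁿ x / dⁿ`, which semiconjugates `F` to multiplication by `d`. It is the
inverse of the marking of `F` if `F` is expanding. -/
def linearizer (F : CircleEndo d) (x : ℝ) : ℝ := limUnder atTop fun n => F.iter n x / d ^ n

theorem abs_iter_div_pow_sub_le (hd : d ≠ 0) (n m : ℕ) (x : ℝ) :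
    |F.iter (m + n) x / d ^ (m + n) - F.iter n x / d ^ n| ≤ ((d : ℝ) ^ n)⁻¹ := by
  have : (0 : ℝ) < d := by positivity
  have hsub : F.iter (m + n) x / d ^ (m + n) - F.iter n x / d ^ n =
      (F.iter m (F.iter n x) - d ^ m * F.iter n x) / (d ^ m * d ^ n) := by
    rw [iter_add, pow_add]; field_simp
  rw [hsub, abs_div, abs_of_pos (by positivity : (0 : ℝ) < d ^ m * d ^ n),
    div_le_iff₀ (by positivity)]
  refine (abs_iter_sub_le m (F.iter n x)).trans_eq ?_
  field_simp

theorem tendsto_linearizer (hd : 2 ≤ d) (x : ℝ) :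
    Tendsto (fun n => F.iter n x / d ^ n) atTop (𝓝 (F.linearizer x)) := by
  refine tendsto_nhds_limUnder (cauchySeq_tendsto_of_complete
    (cauchySeq_of_le_tendsto_0' _ (fun n m hnm => ?_) (tendsto_inv_degree_pow hd)))
  obtain ⟨k, rfl⟩ := Nat.exists_eq_add_of_le' hnm
  rw [dist_comm]
  exact abs_iter_div_pow_sub_le (by omega) n k x

theorem abs_linearizer_sub_le (hd : 2 ≤ d) (n : ℕ) (x : ℝ) :
    |F.linearizer x - F.iter n x / d ^ n| ≤ ((d : ℝ) ^ n)⁻¹ :=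
  le_of_tendsto (((tendsto_linearizer hd x).comp (tendsto_add_atTop_nat n)).sub_const _).abs
    (Eventually.of_forall fun m => abs_iter_div_pow_sub_le (by omega) n m x)

theorem monotone_linearizer (hd : 2 ≤ d) : Monotone F.linearizer := fun x y hxy =>
  le_of_tendsto_of_tendsto' (tendsto_linearizer hd x) (tendsto_linearizer hd y) fun n => by gcongr

theorem linearizer_zero (hd : 2 ≤ d) : F.linearizer 0 = 0 :=
  tendsto_nhds_unique (tendsto_linearizer hd 0) (by simp)

theorem linearizer_add_one (hd : 2 ≤ d) (x : ℝ) : F.linearizer (x + 1) = F.linearizer x + 1 := by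
  refine tendsto_nhds_unique (tendsto_linearizer hd _)
    (((tendsto_linearizer hd x).add_const 1).congr fun n => ?_)
  have h := iter_add_int (F := F) n x 1
  rw [Int.cast_one] at h
  rw [h]; field_simp

theorem linearizer_iter (hd : 2 ≤ d) (m : ℕ) (x : ℝ) :
    F.linearizer (F.iter m x) = d ^ m * F.linearizer x := by
  refine tendsto_nhds_unique (tendsto_linearizer hd _)
    ((((tendsto_linearizer hd x).comp (tendsto_add_atTop_nat m)).const_mul ((d : ℝ) ^ m)).congr
      fun n => ?_)
  simp only [Function.comp, iter_add, pow_add]; field_simp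

theorem continuous_linearizer (hd : 2 ≤ d) : Continuous F.linearizer := by
  have hunif : TendstoUniformly (fun n x => F.iter n x / d ^ n) F.linearizer atTop := by
    rw [Metric.tendstoUniformly_iff]
    intro ε hε
    filter_upwards [(tendsto_inv_degree_pow hd).eventually (gt_mem_nhds hε)] with n hn x
    exact (abs_linearizer_sub_le hd n x).trans_lt hn
  exact hunif.continuous
    (Eventually.of_forall fun n => (F.iter n).continuous.div_const _).frequently

theorem surjective_linearizer (hd : 2 ≤ d) : Function.Surjective F.linearizer := by
  have hbound (x : ℝ) : |F.linearizer x - x| ≤ 1 := by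
    simpa using abs_linearizer_sub_le (F := F) hd 0 x
  refine (continuous_linearizer hd).surjective ?_ ?_
  · exact tendsto_atTop_mono (fun x => by have := (abs_le.1 (hbound x)).1; simp only [id]; linarith)
      (tendsto_atTop_add_const_right _ (-1 : ℝ) tendsto_id)
  · exact tendsto_atBot_mono (fun x => by have := (abs_le.1 (hbound x)).2; simp only [id]; linarith)
      (tendsto_atBot_add_const_right _ (1 : ℝ) tendsto_id)

theorem IsExpanding.strictMono_linearizer (hd : 2 ≤ d) (hexp : F.IsExpanding)
    (hdiff : Differentiable ℝ F.lift) : StrictMono F.linearizer := by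
  intro x y hxy
  refine (monotone_linearizer hd hxy.le).lt_of_ne fun heq => ?_
  obtain ⟨C, l, hC, hl, h⟩ := hexp.exists_le_iter_sub hdiff
  have hpos : 0 < C * (y - x) := mul_pos hC (sub_pos.2 hxy)
  obtain ⟨n, hn⟩ := pow_unbounded_of_one_lt ((C * (y - x))⁻¹) hl
  have hgap : 1 < C * l ^ n * (y - x) := by
    rw [inv_lt_iff_one_lt_mul₀ hpos] at hn; linarith
  have hmono := monotone_linearizer (F := F) hd
    (show F.iter n x + 1 ≤ F.iter n y by linarith [h n x y hxy.le])
  rw [linearizer_add_one hd, linearizer_iter hd, linearizer_iter hd, heq] at hmono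
  linarith

theorem IsExpanding.exists_isMarking (hd : 2 ≤ d) (hexp : F.IsExpanding)
    (hdiff : Differentiable ℝ F.lift) : ∃ H : ℝ ≃o ℝ, IsMarking F H := by
  set K : ℝ ≃o ℝ := (hexp.strictMono_linearizer hd hdiff).orderIsoOfSurjective F.linearizer
    (surjective_linearizer hd)
  have hK (x : ℝ) : K x = F.linearizer x := rfl
  refine ⟨K.symm, ?_, fun x => ?_, fun x => ?_⟩
  · rw [OrderIso.symm_apply_eq, hK, linearizer_zero hd]
  · rw [OrderIso.symm_apply_eq, hK, linearizer_add_one hd, ← hK, OrderIso.apply_symm_apply]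
  · have hiter := linearizer_iter (F := F) hd 1 (K.symm x)
    rw [pow_one, ← hK (K.symm x), OrderIso.apply_symm_apply] at hiter
    rw [eq_comm, OrderIso.symm_apply_eq]
    exact hiter.symm

end CircleEndo

namespace IsMarking

variable {d : ℕ} {F : CircleEndo d} {H H' : ℝ ≃o ℝ}

theorem abs_symm_sub_le (hH : IsMarking F H) (x : ℝ) : |H.symm x - x| ≤ 1 := by
  have hint (m : ℤ) : H.symm m = 1 * m := by
    rw [OrderIso.symm_apply_eq]
    simpa [hH.map_zero] using (map_add_int_of_map_add_one hH.map_add_one 0 m).symm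
  simpa using abs_sub_mul_le_of_map_int H.symm.monotone zero_le_one hint x

theorem symm_iter (hH : IsMarking F H) (n : ℕ) (x : ℝ) :
    H.symm (F.iter n x) = d ^ n * H.symm x := by
  induction n with
  | zero => simp
  | succ n ih =>
    have hconj := hH.conj (H.symm (F.iter n x))
    rw [OrderIso.apply_symm_apply] at hconj
    rw [CircleEndo.iter_succ, hconj, OrderIso.symm_apply_apply, ih]; ring

theorem symm_eq_linearizer (hd : 2 ≤ d) (hH : IsMarking F H) : ⇑H.symm = F.linearizer := by
  funext x
  have hd0 : (0 : ℝ) < d := by positivity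
  refine tendsto_nhds_unique ?_ (CircleEndo.tendsto_linearizer hd x)
  rw [tendsto_iff_dist_tendsto_zero]
  refine squeeze_zero (fun _ => dist_nonneg) (fun n => ?_) (CircleEndo.tendsto_inv_degree_pow hd)
  have hbound := hH.abs_symm_sub_le (F.iter n x)
  rw [hH.symm_iter, abs_sub_comm] at hbound
  rw [Real.dist_eq, div_sub' (by positivity), abs_div, abs_of_pos (pow_pos hd0 n),
    div_le_iff₀ (by positivity), inv_mul_cancel₀ (by positivity)]
  exact hbound

theorem unique (hd : 2 ≤ d) (hH : IsMarking F H) (hH' : IsMarking F H') : H = H' := by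
  have hsymm : H.symm = H'.symm :=
    DFunLike.coe_injective ((hH.symm_eq_linearizer hd).trans (hH'.symm_eq_linearizer hd).symm)
  rw [← H.symm_symm, hsymm, H'.symm_symm]

end IsMarking

/-! ### Regularity from control of secant slopes -/

theorem tendsto_slope_of_hasDerivAt {ι : Type*} {l : Filter ι} {H : ℝ → ℝ} {a z M : ℝ}
    (hz : HasDerivAt H a z) {p q : ι → ℝ} (hpq : ∀ i, p i < q i) (hp : Tendsto p l (𝓝 z))
    (hq : Tendsto q l (𝓝 z)) (hpM : ∀ i, |p i - z| ≤ M * (q i - p i))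
    (hqM : ∀ i, |q i - z| ≤ M * (q i - p i)) :
    Tendsto (fun i => slope H (p i) (q i)) l (𝓝 a) := by
  have bigO_secant {u : ι → ℝ} (hu : ∀ i, |u i - z| ≤ M * (q i - p i)) :
      (fun i => u i - z) =O[l] fun i => q i - p i :=
    Asymptotics.IsBigO.of_bound M <| Eventually.of_forall fun i => by
      simpa only [Real.norm_eq_abs, abs_of_pos (sub_pos.2 (hpq i))] using hu i
  have hp' := (hz.isLittleO.comp_tendsto hp).trans_isBigO (bigO_secant hpM)
  have hq' := (hz.isLittleO.comp_tendsto hq).trans_isBigO (bigO_secant hqM)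
  have hdiff := (hq'.sub hp').tendsto_div_nhds_zero.add_const a
  rw [zero_add] at hdiff
  refine hdiff.congr fun i => ?_
  have : q i - p i ≠ 0 := (sub_pos.2 (hpq i)).ne'
  simp only [Function.comp, smul_eq_mul, slope_def_field]
  field_simp
  ring

theorem exists_pos_tendsto_of_eventually_le_mul {α : Type*} {l : Filter α} [l.NeBot] {f : α → ℝ}
    (hpos : ∀ᶠ u in l, 0 < f u)
    (h : ∀ ε > 0, ∀ᶠ w in l ×ˢ l, f w.1 ≤ (1 + ε) * f w.2) :
    ∃ D > 0, Tendsto f l (𝓝 D) := by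
  have log_sub_le : ∀ ε > 0, ∀ᶠ w in l ×ˢ l, Real.log (f w.1) - Real.log (f w.2) ≤ ε := by
    intro ε hε
    filter_upwards [h ε hε, hpos.prod_mk hpos] with w hw ⟨hw₁, hw₂⟩
    rw [← Real.log_div hw₁.ne' hw₂.ne', Real.log_le_iff_le_exp (div_pos hw₁ hw₂),
      div_le_iff₀ hw₂]
    refine hw.trans ?_
    gcongr
    linarith [Real.add_one_le_exp ε]
  obtain ⟨L, hL⟩ : ∃ L, Tendsto (fun u => Real.log (f u)) l (𝓝 L) := by
    refine cauchy_map_iff_exists_tendsto.1 (cauchy_map_iff.2 ⟨‹_›, ?_⟩)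
    rw [Metric.uniformity_basis_dist_le.tendsto_right_iff]
    intro ε hε
    filter_upwards [log_sub_le ε hε, eventually_swap_iff.1 (log_sub_le ε hε)] with w hw hw'
    exact abs_sub_le_iff.2 ⟨hw, hw'⟩
  exact ⟨Real.exp L, Real.exp_pos L, ((Real.continuous_exp.tendsto L).comp hL).congr'
    (hpos.mono fun u hu => Real.exp_log hu)⟩

/-- The filter of pairs `(u, v)`, `u < v`, which converge to `(x, x)`. A limit of the secant slopes
of a function along it is a derivative in the strict sense. -/
def secantFilter (x : ℝ) : Filter (ℝ × ℝ) := 𝓝[{w | w.1 < w.2}] (x, x)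

theorem tendsto_prodMk_secantFilter_right (x : ℝ) :
    Tendsto (fun y => (x, y)) (𝓝[>] x) (secantFilter x) :=
  tendsto_nhdsWithin_iff.2 ⟨(Continuous.prodMk_right x).continuousWithinAt, self_mem_nhdsWithin⟩

theorem tendsto_prodMk_secantFilter_left (x : ℝ) :
    Tendsto (fun y => (y, x)) (𝓝[<] x) (secantFilter x) :=
  tendsto_nhdsWithin_iff.2 ⟨(Continuous.prodMk_left x).continuousWithinAt, self_mem_nhdsWithin⟩

instance neBot_secantFilter (x : ℝ) : (secantFilter x).NeBot :=
  (tendsto_prodMk_secantFilter_right x).neBot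

theorem hasDerivAt_of_tendsto_secantFilter {H : ℝ → ℝ} {a x : ℝ}
    (h : Tendsto (fun w => slope H w.1 w.2) (secantFilter x) (𝓝 a)) : HasDerivAt H a x := by
  refine hasDerivAt_iff_tendsto_slope_left_right.2
    ⟨?_, h.comp (tendsto_prodMk_secantFilter_right x)⟩
  exact (h.comp (tendsto_prodMk_secantFilter_left x)).congr fun y => slope_comm H y x

theorem continuous_of_tendsto_secantFilter {s : ℝ × ℝ → ℝ} {D : ℝ → ℝ}
    (h : ∀ x, Tendsto s (secantFilter x) (𝓝 (D x))) : Continuous D := by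
  set A : Set (ℝ × ℝ) := {w | w.1 < w.2}
  have mem_closure (x : ℝ) : (x, x) ∈ closure A :=
    mem_closure_iff_nhdsWithin_neBot.2 (neBot_secantFilter x)
  have hD : D = fun x => extendFrom A s (x, x) :=
    funext fun x => (extendFrom_eq (mem_closure x) (h x)).symm
  rw [hD]
  refine (continuousOn_extendFrom (B := diagonal ℝ) ?_ ?_).comp_continuous
    (continuous_id.prodMk continuous_id) fun x => rfl
  · rintro ⟨x, y⟩ (rfl : x = y)
    exact mem_closure x
  · rintro ⟨x, y⟩ (rfl : x = y)
    exact ⟨D x, h x⟩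

theorem exists_hasDerivAt_of_eventually_slope_le {H : ℝ → ℝ} (hH : StrictMono H)
    (hslope : ∀ x, ∀ ε > 0, ∀ᶠ w in secantFilter x ×ˢ secantFilter x,
      slope H w.1.1 w.1.2 ≤ (1 + ε) * slope H w.2.1 w.2.2) :
    ∃ D : ℝ → ℝ, Continuous D ∧ (∀ x, 0 < D x) ∧ ∀ x, HasDerivAt H (D x) x := by
  have slope_pos (x : ℝ) : ∀ᶠ w in secantFilter x, 0 < slope H w.1 w.2 := by
    filter_upwards [self_mem_nhdsWithin] with w hw
    rw [slope_def_field]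
    exact div_pos (sub_pos.2 (hH hw)) (sub_pos.2 hw)
  choose D hpos hD using fun x =>
    exists_pos_tendsto_of_eventually_le_mul (slope_pos x) (hslope x)
  exact ⟨D, continuous_of_tendsto_secantFilter hD, hpos,
    fun x => hasDerivAt_of_tendsto_secantFilter (hD x)⟩

theorem isC1Diffeo_of_hasDerivAt (H : ℝ ≃o ℝ) {D : ℝ → ℝ} (hD : Continuous D)
    (hpos : ∀ x, 0 < D x) (hH : ∀ x, HasDerivAt H (D x) x) : IsC1Diffeo H := by
  have hsymm (y : ℝ) : HasDerivAt H.symm (D (H.symm y))⁻¹ y :=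
    HasDerivAt.of_local_left_inverse H.symm.continuous.continuousAt (hH _) (hpos _).ne'
      (Eventually.of_forall H.apply_symm_apply)
  constructor
  · rw [contDiff_one_iff_deriv, show deriv H = D from funext fun x => (hH x).deriv]
    exact ⟨fun x => (hH x).differentiableAt, hD⟩
  · rw [contDiff_one_iff_deriv,
      show deriv H.symm = fun y => (D (H.symm y))⁻¹ from funext fun y => (hsymm y).deriv]
    exact ⟨fun y => (hsymm y).differentiableAt,
      (hD.comp H.symm.continuous).inv₀ fun y => (hpos _).ne'⟩

/-! ### Zooming in on a point -/

namespace CircleEndo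

variable {d : ℕ} {G : CircleEndo d} {z : ℝ}

theorem exists_bounded_distortion_add (hC1 : G.IsC1Holder) (hexp : G.IsExpanding) :
    ∃ A α : ℝ, 0 ≤ A ∧ 0 < α ∧ ∀ (n : ℕ) (t b c p q r s : ℝ), p < q → r < s →
      p ∈ Icc b c → q ∈ Icc b c → r ∈ Icc b c → s ∈ Icc b c →
      ((G.iter n).symm (q + t) - (G.iter n).symm (p + t)) * (s - r) ≤
        Real.exp (A * (c - b) ^ α) *
          ((G.iter n).symm (s + t) - (G.iter n).symm (r + t)) * (q - p) := by
  obtain ⟨A, α, hA, hα, h⟩ := exists_bounded_distortion hC1 hexp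
  refine ⟨A, α, hA, hα, fun n t b c p q r s hpq hrs hp hq hr hs => ?_⟩
  have add_mem {x : ℝ} (hx : x ∈ Icc b c) : x + t ∈ Icc (b + t) (c + t) :=
    ⟨add_le_add_left hx.1 t, add_le_add_left hx.2 t⟩
  simpa only [add_sub_add_right_eq_sub] using
    h n (b + t) (c + t) _ _ _ _ (add_lt_add_left hpq t) (add_lt_add_left hrs t)
      (add_mem hp) (add_mem hq) (add_mem hr) (add_mem hs)

/-- The inverse of `Gⁿ`, precomposed with the integer translation for which it maps `[0, 1]` to an
interval that contains `z`. -/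
def zoom (G : CircleEndo d) (z : ℝ) (n : ℕ) (x : ℝ) : ℝ := (G.iter n).symm (x + ⌊G.iter n z⌋)

theorem strictMono_zoom (n : ℕ) : StrictMono (G.zoom z n) := fun _ _ hxy =>
  (G.iter n).symm.strictMono (add_lt_add_left hxy _)

theorem zoom_zero_le (n : ℕ) : G.zoom z n 0 ≤ z := by
  rw [zoom, zero_add, ← OrderIso.le_symm_apply, OrderIso.symm_symm]
  exact Int.floor_le _

theorem le_zoom_one (n : ℕ) : z ≤ G.zoom z n 1 := by
  rw [zoom, add_comm, ← OrderIso.symm_apply_le, OrderIso.symm_symm]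
  exact (Int.lt_floor_add_one _).le

theorem abs_zoom_sub_le {b c x : ℝ} (hb : b ≤ 0) (hc : 1 ≤ c) (hx : x ∈ Icc b c) (n : ℕ) :
    |G.zoom z n x - z| ≤ G.zoom z n c - G.zoom z n b := by
  have hmono := (G.strictMono_zoom (z := z) n).monotone
  have hbz := (hmono hb).trans (G.zoom_zero_le n)
  have hzc := (G.le_zoom_one n).trans (hmono hc)
  rw [abs_le]
  constructor <;> linarith [hmono hx.1, hmono hx.2]

theorem IsExpanding.tendsto_zoom_sub (hexp : G.IsExpanding) (hdiff : Differentiable ℝ G.lift)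
    (x y : ℝ) : Tendsto (fun n => G.zoom z n y - G.zoom z n x) atTop (𝓝 0) := by
  obtain ⟨B, l, -, hl, h⟩ := hexp.exists_abs_sub_le hdiff
  have hpow : Tendsto (fun n => B * (l ^ n)⁻¹ * |y - x|) atTop (𝓝 0) := by
    simpa using ((tendsto_pow_atTop_atTop_of_one_lt hl).inv_tendsto_atTop.const_mul B).mul_const
      |y - x|
  refine squeeze_zero_norm (fun n => ?_) hpow
  simpa [zoom] using h n (G.zoom z n y) (G.zoom z n x)

theorem IsExpanding.tendsto_zoom (hexp : G.IsExpanding) (hdiff : Differentiable ℝ G.lift) (x : ℝ) :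
    Tendsto (fun n => G.zoom z n x) atTop (𝓝 z) := by
  rw [tendsto_iff_norm_sub_tendsto_zero]
  exact squeeze_zero (fun n => norm_nonneg _)
    (fun n => abs_zoom_sub_le (min_le_right x 0) (le_max_right x 1)
      ⟨min_le_left x 0, le_max_left x 1⟩ n)
    (hexp.tendsto_zoom_sub hdiff _ _)

theorem exists_zoom_sub_le (hC1 : G.IsC1Holder) (hexp : G.IsExpanding) {b c u v : ℝ}
    (hbu : b ≤ u) (huv : u < v) (hvc : v ≤ c) :
    ∃ M : ℝ, ∀ n, G.zoom z n c - G.zoom z n b ≤ M * (G.zoom z n v - G.zoom z n u) := by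
  obtain ⟨B, β, -, -, h⟩ := exists_bounded_distortion_add hC1 hexp
  refine ⟨Real.exp (B * (c - b) ^ β) * (c - b) / (v - u), fun n => ?_⟩
  have hbc : b < c := hbu.trans_lt (huv.trans_le hvc)
  have hdist := h n ⌊G.iter n z⌋ b c b c u v hbc huv (left_mem_Icc.2 hbc.le)
    (right_mem_Icc.2 hbc.le) ⟨hbu, huv.le.trans hvc⟩ ⟨hbu.trans huv.le, hvc⟩
  rw [div_mul_eq_mul_div, le_div_iff₀ (sub_pos.2 huv)]
  simp only [zoom]
  linarith

theorem tendsto_slope_zoom (hC1 : G.IsC1Holder) (hexp : G.IsExpanding) {H : ℝ → ℝ} {a : ℝ}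
    (hz : HasDerivAt H a z) {u v : ℝ} (huv : u < v) :
    Tendsto (fun n => slope H (G.zoom z n u) (G.zoom z n v)) atTop (𝓝 a) := by
  have hbu := min_le_left u 0
  have hvc := le_max_left v 1
  obtain ⟨M, hM⟩ := exists_zoom_sub_le (z := z) hC1 hexp hbu huv hvc
  have hle {x : ℝ} (hx : x ∈ Icc (min u 0) (max v 1)) (n : ℕ) :
      |G.zoom z n x - z| ≤ M * (G.zoom z n v - G.zoom z n u) :=
    (abs_zoom_sub_le (min_le_right _ _) (le_max_right _ _) hx n).trans (hM n)
  exact tendsto_slope_of_hasDerivAt hz (fun n => strictMono_zoom n huv)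
    (hexp.tendsto_zoom hC1.differentiable u) (hexp.tendsto_zoom hC1.differentiable v)
    (hle ⟨hbu, huv.le.trans hvc⟩) (hle ⟨hbu.trans huv.le, hvc⟩)

end CircleEndo

/-! ### Conjugacies -/

/-- `H` is the lift of a circle homeomorphism that fixes `1` and conjugates `G` to `F`. -/
structure IsConj {d : ℕ} (F G : CircleEndo d) (H : ℝ ≃o ℝ) : Prop where
  map_zero : H 0 = 0
  map_add_one : ∀ x, H (x + 1) = H x + 1
  conj : ∀ x, F.lift (H x) = H (G.lift x)

theorem MarkedMap.isConj {d : ℕ} (f g : MarkedMap d) :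
    IsConj f.map.1 g.map.1 (f.conjugacy g) := by
  have hf := f.isMarking
  have hg := g.isMarking
  refine ⟨?_, fun x => ?_, fun x => ?_⟩
  · have hsymm : g.marking.symm 0 = 0 := by rw [OrderIso.symm_apply_eq, hg.map_zero]
    rw [MarkedMap.conjugacy, OrderIso.trans_apply, hsymm, hf.map_zero]
  · have hsymm : g.marking.symm (x + 1) = g.marking.symm x + 1 := by
      rw [OrderIso.symm_apply_eq, hg.map_add_one, OrderIso.apply_symm_apply]
    rw [MarkedMap.conjugacy, OrderIso.trans_apply, hsymm, hf.map_add_one, OrderIso.trans_apply]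
  · have hsymm : g.marking.symm (g.map.1.lift x) = d * g.marking.symm x := by
      rw [OrderIso.symm_apply_eq, ← hg.conj, OrderIso.apply_symm_apply]
    rw [MarkedMap.conjugacy, OrderIso.trans_apply, OrderIso.trans_apply, hf.conj, hsymm]

namespace IsConj

variable {d : ℕ} {F G : CircleEndo d} {H : ℝ ≃o ℝ}

theorem iter (h : IsConj F G H) (n : ℕ) (x : ℝ) : F.iter n (H x) = H (G.iter n x) := by
  induction n with
  | zero => rfl
  | succ n ih => rw [CircleEndo.iter_succ, ih, h.conj, CircleEndo.iter_succ]

theorem iter_symm (h : IsConj F G H) (n : ℕ) (x : ℝ) :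
    (F.iter n).symm (H x) = H ((G.iter n).symm x) := by
  rw [OrderIso.symm_apply_eq, h.iter, OrderIso.apply_symm_apply]

theorem map_add_int (h : IsConj F G H) (x : ℝ) (m : ℤ) : H (x + m) = H x + m := by
  rw [map_add_int_of_map_add_one h.map_add_one, one_mul]

theorem apply_zoom (h : IsConj F G H) (z : ℝ) (n : ℕ) (x : ℝ) :
    H (G.zoom z n x) = (F.iter n).symm (H x + ⌊G.iter n z⌋) := by
  rw [CircleEndo.zoom, ← h.iter_symm, h.map_add_int]

theorem exists_slope_zoom_le (h : IsConj F G H) (hF1 : F.IsC1Holder) (hF2 : F.IsExpanding)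
    (hG1 : G.IsC1Holder) (hG2 : G.IsExpanding) (z : ℝ) :
    ∃ A α B β : ℝ, 0 < α ∧ 0 < β ∧ ∀ (n : ℕ) (b c p q r s : ℝ), p < q → r < s →
      p ∈ Icc b c → q ∈ Icc b c → r ∈ Icc b c → s ∈ Icc b c →
      slope H (G.zoom z n r) (G.zoom z n s) * slope H p q ≤
        slope H (G.zoom z n p) (G.zoom z n q) *
          (Real.exp (A * (H c - H b) ^ α + B * (c - b) ^ β) * slope H r s) := by
  obtain ⟨A, α, -, hα, hF⟩ := CircleEndo.exists_bounded_distortion_add hF1 hF2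
  obtain ⟨B, β, -, hβ, hG⟩ := CircleEndo.exists_bounded_distortion_add hG1 hG2
  refine ⟨A, α, B, β, hα, hβ, fun n b c p q r s hpq hrs hp hq hr hs => ?_⟩
  have hmem {x : ℝ} (hx : x ∈ Icc b c) : H x ∈ Icc (H b) (H c) :=
    ⟨H.monotone hx.1, H.monotone hx.2⟩
  have hFn := hF n ⌊G.iter n z⌋ _ _ _ _ _ _ (H.strictMono hrs) (H.strictMono hpq)
    (hmem hr) (hmem hs) (hmem hp) (hmem hq)
  have hGn : (G.zoom z n q - G.zoom z n p) * (s - r) ≤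
      Real.exp (B * (c - b) ^ β) * (G.zoom z n s - G.zoom z n r) * (q - p) :=
    hG n ⌊G.iter n z⌋ b c p q r s hpq hrs hp hq hr hs
  simp only [← h.apply_zoom] at hFn
  set T := G.zoom z n
  have hTpq : 0 < T q - T p := sub_pos.2 (CircleEndo.strictMono_zoom n hpq)
  have hTrs : 0 < T s - T r := sub_pos.2 (CircleEndo.strictMono_zoom n hrs)
  have hHT : 0 < H (T q) - H (T p) := sub_pos.2 (H.strictMono (sub_pos.1 hTpq))
  have := sub_pos.2 hpq
  have := sub_pos.2 hrs
  have hHrs := sub_pos.2 (H.strictMono hrs)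
  simp only [slope_def_field, Real.exp_add]
  rw [div_mul_div_comm, ← mul_div_assoc, div_mul_div_comm,
    div_le_div_iff₀ (by positivity) (by positivity)]
  linarith [mul_le_mul hFn hGn (by positivity) (by positivity)]

/-- The dynamics turns every secant slope into a slope at arbitrarily small scale near `z`, up to
bounded distortion; those slopes all converge to the derivative at `z`, which cancels. -/
theorem exists_slope_le (h : IsConj F G H) (hF1 : F.IsC1Holder) (hF2 : F.IsExpanding)
    (hG1 : G.IsC1Holder) (hG2 : G.IsExpanding) {z a : ℝ} (hz : HasDerivAt H a z) (ha : a ≠ 0) :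
    ∃ A α B β : ℝ, 0 < α ∧ 0 < β ∧ ∀ b c p q r s : ℝ, p < q → r < s →
      p ∈ Icc b c → q ∈ Icc b c → r ∈ Icc b c → s ∈ Icc b c →
      slope H p q ≤ Real.exp (A * (H c - H b) ^ α + B * (c - b) ^ β) * slope H r s := by
  obtain ⟨A, α, B, β, hα, hβ, hzoom⟩ := h.exists_slope_zoom_le hF1 hF2 hG1 hG2 z
  refine ⟨A, α, B, β, hα, hβ, fun b c p q r s hpq hrs hp hq hr hs => ?_⟩
  have ha0 : 0 < a := (hz.deriv ▸ H.monotone.deriv_nonneg).lt_of_ne' ha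
  have hslope {u v : ℝ} (huv : u < v) := CircleEndo.tendsto_slope_zoom hG1 hG2 hz huv
  exact le_of_mul_le_mul_left (le_of_tendsto_of_tendsto' ((hslope hrs).mul_const _)
    ((hslope hpq).mul_const _) fun n => hzoom n b c p q r s hpq hrs hp hq hr hs) ha0

theorem eventually_slope_le (h : IsConj F G H) (hF1 : F.IsC1Holder) (hF2 : F.IsExpanding)
    (hG1 : G.IsC1Holder) (hG2 : G.IsExpanding) {z a : ℝ} (hz : HasDerivAt H a z) (ha : a ≠ 0)
    (x : ℝ) {ε : ℝ} (hε : 0 < ε) : ∀ᶠ w in secantFilter x ×ˢ secantFilter x,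
      slope H w.1.1 w.1.2 ≤ (1 + ε) * slope H w.2.1 w.2.2 := by
  obtain ⟨A, α, B, β, hα, hβ, hslope⟩ := h.exists_slope_le hF1 hF2 hG1 hG2 hz ha
  have hcont : Continuous fun δ : ℝ =>
      Real.exp (A * (H (x + δ) - H (x - δ)) ^ α + B * (x + δ - (x - δ)) ^ β) := by
    have := H.continuous
    exact Real.continuous_exp.comp
      (((Continuous.rpow_const (by fun_prop) fun _ => Or.inr hα.le).const_mul _).add
        ((Continuous.rpow_const (by fun_prop) fun _ => Or.inr hβ.le).const_mul _))
  have hlt : ∀ᶠ δ in 𝓝[>] (0 : ℝ),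
      Real.exp (A * (H (x + δ) - H (x - δ)) ^ α + B * (x + δ - (x - δ)) ^ β) < 1 + ε := by
    refine (hcont.continuousWithinAt.tendsto).eventually (gt_mem_nhds ?_)
    simpa [Real.zero_rpow hα.ne', Real.zero_rpow hβ.ne'] using hε
  obtain ⟨δ, hδ, hδ0 : 0 < δ⟩ := (hlt.and self_mem_nhdsWithin).exists
  have hnhds : Icc (x - δ) (x + δ) ∈ 𝓝 x := Icc_mem_nhds (by linarith) (by linarith)
  have hmem : ∀ᶠ w in secantFilter x,
      w.1 < w.2 ∧ w.1 ∈ Icc (x - δ) (x + δ) ∧ w.2 ∈ Icc (x - δ) (x + δ) := by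
    filter_upwards [self_mem_nhdsWithin,
      mem_nhdsWithin_of_mem_nhds (prod_mem_nhds hnhds hnhds)] with w hw hw' using ⟨hw, hw'⟩
  filter_upwards [hmem.prod_mk hmem] with w ⟨⟨hpq, hp, hq⟩, hrs, hr, hs⟩
  refine (hslope _ _ _ _ _ _ hpq hrs hp hq hr hs).trans ?_
  gcongr
  rw [slope_def_field]
  exact div_nonneg (sub_nonneg.2 (H.monotone hrs.le)) (sub_nonneg.2 hrs.le)

theorem isC1Diffeo_of_hasDerivAt_ne_zero (h : IsConj F G H) (hF1 : F.IsC1Holder)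
    (hF2 : F.IsExpanding) (hG1 : G.IsC1Holder) (hG2 : G.IsExpanding) {z a : ℝ}
    (hz : HasDerivAt H a z) (ha : a ≠ 0) : IsC1Diffeo H := by
  obtain ⟨D, hcont, hpos, hderiv⟩ := exists_hasDerivAt_of_eventually_slope_le H.strictMono
    fun x _ hε => h.eventually_slope_le hF1 hF2 hG1 hG2 hz ha x hε
  exact isC1Diffeo_of_hasDerivAt H hcont hpos hderiv

end IsConj

/-! ### Markov intervals -/

/-- The integer with the given `d`-adic digits. -/
def wordNum {d : ℕ} : List (Fin d) → ℕ
  | [] => 0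
  | i :: w => d ^ w.length * i + wordNum w

/-- The inverse branch of the iterate `F^{|w|}` modulo `1` onto the Markov interval of `w`. -/
def branch {d : ℕ} (F : CircleEndo d) (w : List (Fin d)) (y : ℝ) : ℝ :=
  (F.iter w.length).symm (y + wordNum w)

/-- The length of the Markov interval of `w`. -/
def markovLength {d : ℕ} (F : CircleEndo d) (w : List (Fin d)) : ℝ := branch F w 1 - branch F w 0

section Words

variable {d : ℕ} {F : CircleEndo d}

theorem wordNum_append (u w : List (Fin d)) :
    wordNum (u ++ w) = d ^ w.length * wordNum u + wordNum w := by
  induction u with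
  | nil => simp [wordNum]
  | cons i u ih =>
    rw [List.cons_append, wordNum, wordNum, ih, List.length_append, pow_add]; ring

theorem wordNum_lt (w : List (Fin d)) : wordNum w < d ^ w.length := by
  induction w with
  | nil => simp [wordNum]
  | cons i w ih =>
    have hi := i.2
    rw [wordNum, List.length_cons, pow_succ]
    calc _ < d ^ w.length * i + d ^ w.length := by omega
      _ = d ^ w.length * (i + 1) := by ring
      _ ≤ _ := Nat.mul_le_mul_left _ hi

theorem exists_wordNum_eq (hd : 2 ≤ d) (n N : ℕ) (hN : N < d ^ n) :
    ∃ w : List (Fin d), w.length = n ∧ wordNum w = N := by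
  induction n generalizing N with
  | zero => exact ⟨[], rfl, (Nat.lt_one_iff.1 hN).symm⟩
  | succ n ih =>
    have hpos : 0 < d ^ n := by positivity
    obtain ⟨w, rfl, hwN⟩ := ih (N % d ^ n) (Nat.mod_lt _ hpos)
    refine ⟨⟨N / d ^ w.length, ?_⟩ :: w, rfl, ?_⟩
    · rw [Nat.div_lt_iff_lt_mul hpos, ← pow_succ']; exact hN
    · rw [wordNum, hwN]; exact Nat.div_add_mod _ _

theorem exists_int_eq_wordNum_add (hd : 2 ≤ d) (n : ℕ) (N : ℤ) :
    ∃ (w : List (Fin d)) (m : ℤ), w.length = n ∧ (N : ℝ) = wordNum w + d ^ n * m := by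
  have hpos : (0 : ℤ) < d ^ n := by positivity
  obtain ⟨r, hr⟩ := Int.eq_ofNat_of_zero_le (Int.emod_nonneg N hpos.ne')
  have hlt : r < d ^ n := by exact_mod_cast hr ▸ Int.emod_lt_of_pos N hpos
  obtain ⟨w, hw, rfl⟩ := exists_wordNum_eq hd n r hlt
  refine ⟨w, N / d ^ n, hw, ?_⟩
  exact_mod_cast hr ▸ (Int.emod_add_mul_ediv N (d ^ n)).symm

theorem strictMono_branch (w : List (Fin d)) : StrictMono (branch F w) := fun _ _ h =>
  (F.iter w.length).symm.strictMono (by linarith)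

theorem markovLength_pos (w : List (Fin d)) : 0 < markovLength F w :=
  sub_pos.2 (strictMono_branch w one_pos)

theorem mem_markovInterval_iff (w : List (Fin d)) (x : ℝ) :
    x ∈ markovInterval F w ↔ F.iter w.length x - wordNum w ∈ Icc (0 : ℝ) 1 := by
  induction w generalizing x with
  | nil => simp [markovInterval, wordNum]
  | cons i w ih =>
    have hiter : F.iter w.length (F.lift x - (i : ℕ)) =
        F.iter (w.length + 1) x - d ^ w.length * (i : ℕ) := by
      have h := CircleEndo.iter_add_int (F := F) w.length (F.lift x) (-(i : ℕ))
      push_cast at h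
      rw [sub_eq_add_neg, h, CircleEndo.iter_succ']
      ring
    rw [markovInterval, mem_ofPred_eq, ih, hiter, wordNum, sub_sub]
    push_cast
    rfl

theorem markovInterval_eq (w : List (Fin d)) :
    markovInterval F w = Icc (branch F w 0) (branch F w 1) := by
  ext x
  rw [mem_markovInterval_iff, branch, branch, mem_Icc, mem_Icc, OrderIso.symm_apply_le,
    OrderIso.le_symm_apply, zero_add, sub_nonneg, sub_le_iff_le_add]

theorem volume_markovInterval (w : List (Fin d)) :
    volume.real (markovInterval F w) = markovLength F w := by
  rw [markovInterval_eq, Real.volume_real_Icc_of_le (strictMono_branch w one_pos).le, markovLength]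

theorem branch_append (u w : List (Fin d)) (y : ℝ) :
    branch F (u ++ w) y = branch F u (branch F w y) := by
  have h := CircleEndo.iter_symm_add_int (F := F) w.length (y + wordNum w) (wordNum u)
  push_cast at h
  simp only [branch]
  rw [← h, OrderIso.symm_apply_eq, List.length_append, add_comm u.length, CircleEndo.iter_add,
    OrderIso.apply_symm_apply, OrderIso.apply_symm_apply, wordNum_append]
  push_cast
  ring

theorem markovLength_append (u w : List (Fin d)) :
    markovLength F (u ++ w) = branch F u (branch F w 1) - branch F u (branch F w 0) := by
  rw [markovLength, branch_append, branch_append]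

theorem branch_nil (y : ℝ) : branch F [] y = y := by simp [branch, wordNum, OrderIso.symm_apply_eq]

theorem markovLength_nil : markovLength F [] = 1 := by simp [markovLength, branch_nil]

theorem branch_zero_nonneg (w : List (Fin d)) : 0 ≤ branch F w 0 := by
  rw [branch, OrderIso.le_symm_apply, CircleEndo.iter_map_zero]
  positivity

theorem branch_one_le (w : List (Fin d)) : branch F w 1 ≤ 1 := by
  have hiter := CircleEndo.iter_int (F := F) w.length 1
  push_cast at hiter
  have hnum : (1 : ℝ) + wordNum w ≤ d ^ w.length := by
    exact_mod_cast Nat.one_add_le_iff.2 (wordNum_lt w)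
  rw [branch, OrderIso.symm_apply_le, hiter, mul_one]
  exact hnum

theorem branch_append_mem (v w : List (Fin d)) {y : ℝ} (hy : y ∈ Icc (0 : ℝ) 1) :
    branch F (v ++ w) y ∈ Icc (branch F v 0) (branch F v 1) := by
  have hv := (strictMono_branch (F := F) v).monotone
  have hw := (strictMono_branch (F := F) w).monotone
  rw [branch_append]
  exact ⟨hv ((branch_zero_nonneg w).trans (hw hy.1)), hv ((hw hy.2).trans (branch_one_le w))⟩

theorem dualWord_succ (j : DualSpace d) (n : ℕ) :
    dualWord j (n + 1) = dualWord (dualShift j) n ++ [j 0] := by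
  induction n with
  | zero => rfl
  | succ n ih => rw [dualWord, ih]; rfl

theorem length_dualWord (j : DualSpace d) (n : ℕ) : (dualWord j n).length = n := by
  induction n with
  | zero => rfl
  | succ n ih => rw [dualWord, List.length_cons, ih]

theorem exists_dualWord_add (j : DualSpace d) (m n : ℕ) :
    ∃ u, dualWord j (m + n) = u ++ dualWord j n := by
  induction m with
  | zero => exact ⟨[], by simp⟩
  | succ m ih =>
    obtain ⟨u, hu⟩ := ih
    exact ⟨j (m + n) :: u, by rw [Nat.add_right_comm, dualWord, hu]; rfl⟩

theorem dualWord_congr {j j' : DualSpace d} {n : ℕ} (h : ∀ k < n, j k = j' k) :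
    dualWord j n = dualWord j' n := by
  induction n with
  | zero => rfl
  | succ n ih => rw [dualWord, dualWord, h n n.lt_succ_self, ih fun k hk => h k (by omega)]

theorem exists_dualWord_eq (hd : 2 ≤ d) (w : List (Fin d)) :
    ∃ j : DualSpace d, dualWord j w.length = w := by
  induction w with
  | nil => exact ⟨fun _ => ⟨0, by omega⟩, rfl⟩
  | cons i w ih =>
    obtain ⟨j, hj⟩ := ih
    refine ⟨fun k => if k = w.length then i else j k, ?_⟩
    rw [List.length_cons, dualWord, dualWord_congr (j' := j) fun k hk => by simp [hk.ne], hj]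
    simp

/-- The quotient of the lengths of the Markov intervals of `v` and of `vi`. -/
def lengthRatio (F : CircleEndo d) (v : List (Fin d)) (i : Fin d) : ℝ :=
  markovLength F v / markovLength F (v ++ [i])

theorem lengthRatio_pos (v : List (Fin d)) (i : Fin d) : 0 < lengthRatio F v i :=
  div_pos (markovLength_pos _) (markovLength_pos _)

theorem preDualDerivative_eq (j : DualSpace d) (n : ℕ) :
    preDualDerivative F j n = lengthRatio F (dualWord (dualShift j) n) (j 0) := by
  rw [preDualDerivative, dualLength, dualLength, volume_markovInterval, volume_markovInterval,
    dualWord_succ, lengthRatio]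

/-! ### Lengths of Markov intervals -/

theorem exists_markovLength_le_mul_pow (hexp : F.IsExpanding)
    (hdiff : Differentiable ℝ F.lift) :
    ∃ C τ : ℝ, 0 < C ∧ 0 < τ ∧ τ < 1 ∧ ∀ w : List (Fin d),
      markovLength F w ≤ C * τ ^ w.length := by
  obtain ⟨B, l, hB, hl, h⟩ := hexp.exists_abs_sub_le hdiff
  refine ⟨B, l⁻¹, hB, by positivity, inv_lt_one_of_one_lt₀ hl, fun w => ?_⟩
  have hw := (le_abs_self _).trans (h w.length (branch F w 1) (branch F w 0))
  simpa only [branch, OrderIso.apply_symm_apply, add_sub_add_right_eq_sub, sub_zero, abs_one,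
    mul_one, markovLength, inv_pow, div_eq_mul_inv] using hw

theorem tendsto_markovLength_dualWord (hexp : F.IsExpanding) (hdiff : Differentiable ℝ F.lift)
    (j : DualSpace d) : Tendsto (fun n => markovLength F (dualWord j n)) atTop (𝓝 0) := by
  obtain ⟨C, τ, -, hτ, hτ1, hlen⟩ := exists_markovLength_le_mul_pow hexp hdiff
  have hpow : Tendsto (fun n => C * τ ^ n) atTop (𝓝 0) := by
    simpa using (tendsto_pow_atTop_nhds_zero_of_lt_one hτ.le hτ1).const_mul C
  refine squeeze_zero (fun n => (markovLength_pos _).le) (fun n => ?_) hpow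
  simpa only [length_dualWord] using hlen (dualWord j n)

/-- For `v = []` this says that the length is multiplicative up to a constant factor. -/
theorem exists_abs_log_markovLength_le (hC1 : F.IsC1Holder) (hexp : F.IsExpanding) :
    ∃ A α : ℝ, 0 ≤ A ∧ 0 < α ∧ ∀ u v w : List (Fin d),
      |Real.log (markovLength F (u ++ v)) + Real.log (markovLength F (v ++ w)) -
        (Real.log (markovLength F (u ++ (v ++ w))) + Real.log (markovLength F v))| ≤
          A * markovLength F v ^ α := by
  obtain ⟨A, α, hA, hα, hdist⟩ := CircleEndo.exists_bounded_distortion_add hC1 hexp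
  refine ⟨A, α, hA, hα, fun u v w => ?_⟩
  have hv := strictMono_branch (F := F) v one_pos
  have hvw := strictMono_branch (F := F) (v ++ w) one_pos
  have hv0 := left_mem_Icc.2 hv.le
  have hv1 := right_mem_Icc.2 hv.le
  have hvw0 := branch_append_mem (F := F) v w (left_mem_Icc.2 zero_le_one)
  have hvw1 := branch_append_mem (F := F) v w (right_mem_Icc.2 zero_le_one)
  have hle : markovLength F (u ++ v) * markovLength F (v ++ w) ≤
      Real.exp (A * markovLength F v ^ α) * markovLength F (u ++ (v ++ w)) * markovLength F v := by
    rw [markovLength_append u v, markovLength_append u (v ++ w)]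
    exact hdist u.length (wordNum u) _ _ _ _ _ _ hv hvw hv0 hv1 hvw0 hvw1
  have hge : markovLength F (u ++ (v ++ w)) * markovLength F v ≤
      Real.exp (A * markovLength F v ^ α) * markovLength F (u ++ v) * markovLength F (v ++ w) := by
    rw [markovLength_append u v, markovLength_append u (v ++ w)]
    exact hdist u.length (wordNum u) _ _ _ _ _ _ hvw hv hvw0 hvw1 hv0 hv1
  have hpos (w : List (Fin d)) := markovLength_pos (F := F) w
  have hlog_le := Real.log_le_log (mul_pos (hpos _) (hpos _)) hle
  have hlog_ge := Real.log_le_log (mul_pos (hpos _) (hpos _)) hge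
  simp only [Real.log_mul, Real.exp_ne_zero, (hpos _).ne', ne_eq, not_false_eq_true, mul_eq_zero,
    or_self, Real.log_exp] at hlog_le hlog_ge
  rw [abs_le]
  constructor <;> linarith

theorem log_lengthRatio (v : List (Fin d)) (i : Fin d) : Real.log (lengthRatio F v i) =
    Real.log (markovLength F v) - Real.log (markovLength F (v ++ [i])) :=
  Real.log_div (markovLength_pos _).ne' (markovLength_pos _).ne'

theorem exists_abs_log_lengthRatio_sub_le (hC1 : F.IsC1Holder) (hexp : F.IsExpanding) :
    ∃ A τ : ℝ, 0 ≤ A ∧ 0 < τ ∧ τ < 1 ∧ ∀ (u v : List (Fin d)) (i : Fin d),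
      |Real.log (lengthRatio F (u ++ v) i) - Real.log (lengthRatio F v i)| ≤ A * τ ^ v.length := by
  obtain ⟨A, α, hA, hα, hlog⟩ := exists_abs_log_markovLength_le hC1 hexp
  obtain ⟨C, τ, hC, hτ, hτ1, hlen⟩ := exists_markovLength_le_mul_pow hexp hC1.differentiable
  refine ⟨A * C ^ α, τ ^ α, by positivity, by positivity, Real.rpow_lt_one hτ.le hτ1 hα,
    fun u v i => ?_⟩
  calc |Real.log (lengthRatio F (u ++ v) i) - Real.log (lengthRatio F v i)|
      = |Real.log (markovLength F (u ++ v)) + Real.log (markovLength F (v ++ [i])) -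
          (Real.log (markovLength F (u ++ (v ++ [i]))) + Real.log (markovLength F v))| := by
        rw [log_lengthRatio, log_lengthRatio, List.append_assoc]; congr 1; ring
    _ ≤ A * markovLength F v ^ α := hlog u v [i]
    _ ≤ A * (C * τ ^ v.length) ^ α := by
        gcongr
        · exact (markovLength_pos v).le
        · exact hlen v
    _ = A * C ^ α * (τ ^ α) ^ v.length := by
        rw [Real.mul_rpow hC.le (by positivity), Real.rpow_pow_comm hτ.le, mul_assoc]

/-! ### Dual derivatives -/

theorem preDualDerivative_pos (j : DualSpace d) (n : ℕ) : 0 < preDualDerivative F j n :=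
  preDualDerivative_eq (F := F) j n ▸ lengthRatio_pos _ _

theorem exists_dualDerivative (hC1 : F.IsC1Holder) (hexp : F.IsExpanding) :
    ∃ A τ : ℝ, 0 ≤ A ∧ 0 < τ ∧ τ < 1 ∧ ∀ j : DualSpace d, 0 < dualDerivative F j ∧
      Tendsto (preDualDerivative F j) atTop (𝓝 (dualDerivative F j)) ∧
      ∀ n, |Real.log (preDualDerivative F j n) - Real.log (dualDerivative F j)| ≤ A * τ ^ n := by
  obtain ⟨A, τ, hA, hτ, hτ1, hratio⟩ := exists_abs_log_lengthRatio_sub_le hC1 hexp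
  refine ⟨A, τ, hA, hτ, hτ1, fun j => ?_⟩
  have hdist (n m : ℕ) (hnm : n ≤ m) : dist (Real.log (preDualDerivative F j n))
      (Real.log (preDualDerivative F j m)) ≤ A * τ ^ n := by
    obtain ⟨k, rfl⟩ := Nat.exists_eq_add_of_le' hnm
    obtain ⟨u, hu⟩ := exists_dualWord_add (dualShift j) k n
    rw [dist_comm, preDualDerivative_eq, preDualDerivative_eq, hu, Real.dist_eq]
    simpa only [length_dualWord] using hratio u (dualWord (dualShift j) n) (j 0)
  have hpow : Tendsto (fun n => A * τ ^ n) atTop (𝓝 0) := by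
    simpa using (tendsto_pow_atTop_nhds_zero_of_lt_one hτ.le hτ1).const_mul A
  obtain ⟨l, hl⟩ := cauchySeq_tendsto_of_complete (cauchySeq_of_le_tendsto_0' _ hdist hpow)
  have hlim : Tendsto (preDualDerivative F j) atTop (𝓝 (Real.exp l)) :=
    ((Real.continuous_exp.tendsto l).comp hl).congr fun n =>
      Real.exp_log (preDualDerivative_pos j n)
  rw [show dualDerivative F j = Real.exp l from hlim.limUnder_eq, Real.log_exp]
  exact ⟨Real.exp_pos _, hlim, fun n =>
    le_of_tendsto (hl.const_sub _).abs ((eventually_ge_atTop n).mono fun m hm => hdist n m hm)⟩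

theorem dualDerivative_pos (hC1 : F.IsC1Holder) (hexp : F.IsExpanding) (j : DualSpace d) :
    0 < dualDerivative F j :=
  let ⟨_, _, _, _, _, h⟩ := exists_dualDerivative hC1 hexp
  (h j).1

theorem tendsto_preDualDerivative (hC1 : F.IsC1Holder) (hexp : F.IsExpanding) (j : DualSpace d) :
    Tendsto (preDualDerivative F j) atTop (𝓝 (dualDerivative F j)) :=
  let ⟨_, _, _, _, _, h⟩ := exists_dualDerivative hC1 hexp
  (h j).2.1

theorem hasDualDerivative (hC1 : F.IsC1Holder) (hexp : F.IsExpanding) : HasDualDerivative F :=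
  fun j => ⟨_, dualDerivative_pos hC1 hexp j, tendsto_preDualDerivative hC1 hexp j⟩

theorem exists_abs_log_dualDerivative_le (hC1 : F.IsC1Holder) (hexp : F.IsExpanding) :
    ∃ M : ℝ, 0 ≤ M ∧ ∀ j : DualSpace d, |Real.log (dualDerivative F j)| ≤ M := by
  obtain ⟨A, τ, hA, _, _, h⟩ := exists_dualDerivative hC1 hexp
  obtain ⟨M, hM⟩ := (Set.finite_range fun i : Fin d => |Real.log (lengthRatio F [] i)|).bddAbove
  refine ⟨|M| + A, by positivity, fun j => ?_⟩
  have hlim := (h j).2.2 0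
  rw [preDualDerivative_eq, dualWord, pow_zero, mul_one, abs_sub_comm] at hlim
  have hfirst : |Real.log (lengthRatio F [] (j 0))| ≤ |M| := (hM ⟨j 0, rfl⟩).trans (le_abs_self M)
  linarith [abs_sub_abs_le_abs_sub (Real.log (dualDerivative F j))
    (Real.log (lengthRatio F [] (j 0))), hlim, hfirst]

theorem preDualDerivative_congr {j j' : DualSpace d} {n : ℕ} (h : ∀ k < n + 1, j k = j' k) :
    preDualDerivative F j n = preDualDerivative F j' n := by
  rw [preDualDerivative_eq, preDualDerivative_eq, h 0 n.succ_pos,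
    dualWord_congr (j := dualShift j) (j' := dualShift j') fun k hk => h (k + 1) (by omega)]

theorem exists_abs_log_dualDerivative_sub_le (hC1 : F.IsC1Holder) (hexp : F.IsExpanding) :
    ∃ C τ : ℝ, 0 ≤ C ∧ 0 < τ ∧ τ < 1 ∧ ∀ (n : ℕ) (j j' : DualSpace d), (∀ k < n, j k = j' k) →
      |Real.log (dualDerivative F j) - Real.log (dualDerivative F j')| ≤ C * τ ^ n := by
  obtain ⟨A, τ, hA, hτ, hτ1, h⟩ := exists_dualDerivative hC1 hexp
  obtain ⟨M, hM0, hM⟩ := exists_abs_log_dualDerivative_le hC1 hexp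
  refine ⟨2 * M + 2 * A / τ, τ, by positivity, hτ, hτ1, fun n j j' hj => ?_⟩
  rw [add_mul]
  obtain _ | n := n
  · have : 0 ≤ 2 * A / τ * τ ^ 0 := by positivity
    rw [pow_zero, mul_one] at *
    linarith [abs_sub (Real.log (dualDerivative F j)) (Real.log (dualDerivative F j')), hM j, hM j']
  · have : 0 ≤ 2 * M * τ ^ (n + 1) := by positivity
    have hpow : 2 * A / τ * τ ^ (n + 1) = A * τ ^ n + A * τ ^ n := by
      rw [pow_succ]; field_simp; ring
    have hlim := (h j).2.2 n
    rw [preDualDerivative_congr hj, abs_sub_comm] at hlim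
    linarith [abs_sub_le (Real.log (dualDerivative F j)) (Real.log (preDualDerivative F j' n))
      (Real.log (dualDerivative F j')), (h j').2.2 n]

theorem abs_sub_le_exp_mul_abs_log_sub {x y M : ℝ} (hx : 0 < x) (hy : 0 < y)
    (hxM : Real.log x ≤ M) (hyM : Real.log y ≤ M) :
    |x - y| ≤ Real.exp M * |Real.log x - Real.log y| := by
  wlog hxy : y ≤ x generalizing x y
  · rw [abs_sub_comm, abs_sub_comm (Real.log x)]
    exact this hy hx hyM hxM (le_of_not_ge hxy)
  have hlog : 0 ≤ Real.log x - Real.log y := sub_nonneg.2 (Real.log_le_log hy hxy)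
  rw [abs_of_nonneg (sub_nonneg.2 hxy), abs_of_nonneg hlog]
  calc x - y = x * (1 - Real.exp (Real.log y - Real.log x)) := by
        rw [Real.exp_sub, Real.exp_log hx, Real.exp_log hy]; field_simp
    _ ≤ x * (Real.log x - Real.log y) :=
        mul_le_mul_of_nonneg_left (by linarith [Real.add_one_le_exp (Real.log y - Real.log x)])
          hx.le
    _ ≤ Real.exp M * (Real.log x - Real.log y) :=
        mul_le_mul_of_nonneg_right ((Real.log_le_iff_le_exp hx).1 hxM) hlog

theorem isHolderDual_dualDerivative (hC1 : F.IsC1Holder) (hexp : F.IsExpanding) :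
    IsHolderDual (dualDerivative F) := by
  obtain ⟨M, -, hM⟩ := exists_abs_log_dualDerivative_le hC1 hexp
  obtain ⟨C, τ, hC, hτ, hτ1, hlog⟩ := exists_abs_log_dualDerivative_sub_le hC1 hexp
  refine ⟨Real.exp M * (C + 1), τ, by positivity, hτ, hτ1, fun n j j' hj => ?_⟩
  have hlogM (j : DualSpace d) : Real.log (dualDerivative F j) ≤ M := (le_abs_self _).trans (hM j)
  calc |dualDerivative F j - dualDerivative F j'|
      ≤ Real.exp M * |Real.log (dualDerivative F j) - Real.log (dualDerivative F j')| :=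
        abs_sub_le_exp_mul_abs_log_sub (dualDerivative_pos hC1 hexp j)
          (dualDerivative_pos hC1 hexp j') (hlogM j) (hlogM j')
    _ ≤ Real.exp M * ((C + 1) * τ ^ n) := by
        gcongr
        exact (hlog n j j' hj).trans (by gcongr; linarith)
    _ = Real.exp M * (C + 1) * τ ^ n := by ring

end Words

/-! ### Maps with equal dual derivatives -/

theorem IsC1Diffeo.deriv_pos {H : ℝ ≃o ℝ} (h : IsC1Diffeo H) (x : ℝ) : 0 < deriv H x := by
  refine H.monotone.deriv_nonneg.lt_of_ne' fun hzero => ?_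
  have hcomp := ((h.2.differentiable one_ne_zero) (H x)).hasDerivAt.comp x
    ((h.1.differentiable one_ne_zero) x).hasDerivAt
  rw [hzero, mul_zero, show ⇑H.symm ∘ ⇑H = id from funext H.symm_apply_apply] at hcomp
  exact zero_ne_one (hcomp.unique (hasDerivAt_id x))

theorem tendsto_log_slope_sub_log_slope {ι : Type*} {l : Filter ι} {H : ℝ → ℝ}
    (hH : ContDiff ℝ 1 H) (hpos : ∀ x, 0 < deriv H x) {K : Set ℝ} (hK : IsCompact K)
    {a b p q : ι → ℝ} (hap : ∀ i, a i ≤ p i) (hpq : ∀ i, p i < q i) (hqb : ∀ i, q i ≤ b i)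
    (habK : ∀ i, Icc (a i) (b i) ⊆ K) (hab : Tendsto (fun i => b i - a i) l (𝓝 0)) :
    Tendsto (fun i => Real.log (slope H (a i) (b i)) - Real.log (slope H (p i) (q i))) l
      (𝓝 0) := by
  have hcont : Continuous fun x => Real.log (deriv H x) :=
    (hH.continuous_deriv le_rfl).log fun x => (hpos x).ne'
  have exists_slope_eq {x y : ℝ} (hxy : x < y) : ∃ ξ ∈ Icc x y, slope H x y = deriv H ξ := by
    obtain ⟨ξ, hξ, hslope⟩ := exists_deriv_eq_slope' H hxy hH.continuous.continuousOn
      (hH.differentiable one_ne_zero).differentiableOn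
    exact ⟨ξ, Ioo_subset_Icc_self hξ, hslope.symm⟩
  rw [Metric.tendsto_nhds]
  intro ε hε
  obtain ⟨δ, hδ, hunif⟩ := Metric.uniformContinuousOn_iff.1
    (hK.uniformContinuousOn_of_continuous hcont.continuousOn) ε hε
  filter_upwards [hab.eventually (gt_mem_nhds hδ)] with i hi
  obtain ⟨ξ, hξ, hslope_ab⟩ := exists_slope_eq ((hap i).trans_lt ((hpq i).trans_le (hqb i)))
  obtain ⟨η, hη, hslope_pq⟩ := exists_slope_eq (hpq i)
  have hη' : η ∈ Icc (a i) (b i) := ⟨(hap i).trans hη.1, hη.2.trans (hqb i)⟩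
  rw [dist_zero_right, ← dist_eq_norm, hslope_ab, hslope_pq]
  exact hunif ξ (habK i hξ) η (habK i hη') ((Real.dist_le_of_mem_Icc hξ hη').trans_lt hi)

namespace IsConj

variable {d : ℕ} {F G : CircleEndo d} {H : ℝ ≃o ℝ}

theorem map_branch (h : IsConj F G H) (w : List (Fin d)) (y : ℝ) :
    branch F w (H y) = H (branch G w y) := by
  have hadd := h.map_add_int y (wordNum w)
  push_cast at hadd
  rw [branch, ← hadd, h.iter_symm, branch]

theorem map_one (h : IsConj F G H) : H 1 = 1 := by
  simpa [h.map_zero] using h.map_add_one 0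

theorem markovLength_eq (h : IsConj F G H) (w : List (Fin d)) :
    markovLength F w = H (branch G w 1) - H (branch G w 0) := by
  rw [markovLength, ← h.map_branch, ← h.map_branch, h.map_one, h.map_zero]

theorem log_slope_branch (h : IsConj F G H) (w : List (Fin d)) :
    Real.log (slope H (branch G w 0) (branch G w 1)) =
      Real.log (markovLength F w) - Real.log (markovLength G w) := by
  rw [slope_def_field, ← h.markovLength_eq, ← markovLength,
    Real.log_div (markovLength_pos _).ne' (markovLength_pos _).ne']

theorem dualDerivative_eq (h : IsConj F G H) (hF1 : F.IsC1Holder) (hF2 : F.IsExpanding)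
    (hG1 : G.IsC1Holder) (hG2 : G.IsExpanding) (hH : IsC1Diffeo H) :
    dualDerivative F = dualDerivative G := by
  funext j
  set v := dualWord (dualShift j)
  have hmem (n : ℕ) {y : ℝ} (hy : y ∈ Icc (0 : ℝ) 1) := branch_append_mem (F := G) (v n) [j 0] hy
  have hslope := tendsto_log_slope_sub_log_slope hH.1 hH.deriv_pos (isCompact_Icc (a := 0) (b := 1))
    (fun n => (hmem n (left_mem_Icc.2 zero_le_one)).1)
    (fun n => strictMono_branch (v n ++ [j 0]) one_pos)
    (fun n => (hmem n (right_mem_Icc.2 zero_le_one)).2)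
    (fun n => Icc_subset_Icc (branch_zero_nonneg (v n)) (branch_one_le (v n)))
    (tendsto_markovLength_dualWord hG2 hG1.differentiable (dualShift j))
  have hlogF := (tendsto_preDualDerivative hF1 hF2 j).log (dualDerivative_pos hF1 hF2 j).ne'
  have hlogG := (tendsto_preDualDerivative hG1 hG2 j).log (dualDerivative_pos hG1 hG2 j).ne'
  refine Real.log_injOn_pos (dualDerivative_pos hF1 hF2 j) (dualDerivative_pos hG1 hG2 j)
    (sub_eq_zero.1 (tendsto_nhds_unique (hlogF.sub hlogG) (hslope.congr fun n => ?_)))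
  rw [h.log_slope_branch, h.log_slope_branch, preDualDerivative_eq, preDualDerivative_eq,
    log_lengthRatio, log_lengthRatio]
  ring

end IsConj

section Words

variable {d : ℕ} {F G : CircleEndo d}

theorem exists_abs_log_lengthRatio_sub_le_of_dualDerivative_eq (hd : 2 ≤ d) (hF1 : F.IsC1Holder)
    (hF2 : F.IsExpanding) (hG1 : G.IsC1Holder) (hG2 : G.IsExpanding)
    (hD : dualDerivative F = dualDerivative G) :
    ∃ A τ : ℝ, 0 ≤ A ∧ 0 < τ ∧ τ < 1 ∧ ∀ (w : List (Fin d)) (i : Fin d),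
      |Real.log (lengthRatio F w i) - Real.log (lengthRatio G w i)| ≤ A * τ ^ w.length := by
  obtain ⟨A, τ, hA, hτ, hτ1, hF⟩ := exists_dualDerivative hF1 hF2
  obtain ⟨B, σ, hB, hσ, hσ1, hG⟩ := exists_dualDerivative hG1 hG2
  refine ⟨A + B, max τ σ, by positivity, lt_max_of_lt_left hτ, max_lt hτ1 hσ1, fun w i => ?_⟩
  obtain ⟨j, hj⟩ := exists_dualWord_eq hd (w ++ [i])
  rw [List.length_append, List.length_singleton, dualWord_succ] at hj
  obtain ⟨hw, hi⟩ := List.append_inj' hj rfl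
  have hFj := (hF j).2.2 w.length
  have hGj := (hG j).2.2 w.length
  rw [preDualDerivative_eq, hw, List.singleton_injective hi] at hFj hGj
  rw [hD] at hFj
  rw [abs_sub_comm] at hGj
  calc |Real.log (lengthRatio F w i) - Real.log (lengthRatio G w i)|
      ≤ A * τ ^ w.length + B * σ ^ w.length := (abs_sub_le _ _ _).trans (add_le_add hFj hGj)
    _ ≤ A * max τ σ ^ w.length + B * max τ σ ^ w.length := by
        gcongr
        exacts [le_max_left τ σ, le_max_right τ σ]
    _ = (A + B) * max τ σ ^ w.length := by ring

theorem exists_markovLength_le_of_dualDerivative_eq (hd : 2 ≤ d) (hF1 : F.IsC1Holder)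
    (hF2 : F.IsExpanding) (hG1 : G.IsC1Holder) (hG2 : G.IsExpanding)
    (hD : dualDerivative F = dualDerivative G) :
    ∃ C : ℝ, ∀ w : List (Fin d), markovLength F w ≤ C * markovLength G w := by
  obtain ⟨A, τ, hA, hτ, hτ1, hratio⟩ :=
    exists_abs_log_lengthRatio_sub_le_of_dualDerivative_eq hd hF1 hF2 hG1 hG2 hD
  have htelescope (w : List (Fin d)) :
      |Real.log (markovLength F w) - Real.log (markovLength G w)| ≤
        ∑ k ∈ Finset.range w.length, A * τ ^ k := by
    induction w using List.reverseRecOn with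
    | nil => simp [markovLength_nil]
    | append_singleton w i ih =>
      have hwi := hratio w i
      rw [log_lengthRatio, log_lengthRatio, abs_le] at hwi
      rw [List.length_append, List.length_singleton, Finset.sum_range_succ]
      rw [abs_le] at ih ⊢
      constructor <;> linarith [hwi.1, hwi.2, ih.1, ih.2]
  have hsum (n : ℕ) : ∑ k ∈ Finset.range n, A * τ ^ k ≤ A * (1 - τ)⁻¹ := by
    rw [← Finset.mul_sum, ← tsum_geometric_of_lt_one hτ.le hτ1]
    gcongr
    exact (summable_geometric_of_lt_one hτ.le hτ1).sum_le_tsum _ fun _ _ => by positivity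
  refine ⟨Real.exp (A * (1 - τ)⁻¹), fun w => ?_⟩
  have hlog := (le_abs_self _).trans ((htelescope w).trans (hsum _))
  rwa [← Real.log_div (markovLength_pos _).ne' (markovLength_pos _).ne', Real.log_le_iff_le_exp
    (div_pos (markovLength_pos _) (markovLength_pos _)), div_le_iff₀ (markovLength_pos _)] at hlog

end Words

/-! ### Comparable Markov intervals -/

theorem lipschitzWith_of_monotone_mul_sub {f : ℝ → ℝ} {C : ℝ≥0} (hf : Monotone f)
    (h : Monotone fun x => C * x - f x) : LipschitzWith C f := by
  refine LipschitzWith.of_le_add_mul C fun x y => ?_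
  rcases le_total x y with hxy | hyx
  · exact (hf hxy).trans (le_add_of_nonneg_right (by positivity))
  · rw [Real.dist_eq, abs_of_nonneg (sub_nonneg.2 hyx)]
    linarith [h hyx]

theorem le_of_forall_nat_mul_le_add {x y c : ℝ} (h : ∀ m : ℕ, m * x ≤ c + m * y) : x ≤ y := by
  by_contra! hlt
  obtain ⟨m, hm⟩ := exists_nat_gt (c / (x - y))
  rw [div_lt_iff₀ (sub_pos.2 hlt)] at hm
  linarith [h m]

theorem apply_flatten_replicate_le {α : Type*} {φ : List α → ℝ} {B : ℝ} (hnil : φ [] = 0)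
    (happend : ∀ u w, φ (u ++ w) ≤ φ u + φ w + B) (w : List α) (m : ℕ) :
    φ (List.replicate m w).flatten ≤ m * (φ w + B) := by
  induction m with
  | zero => simp [hnil]
  | succ m ih =>
    rw [List.replicate_succ, List.flatten_cons]
    push_cast
    linarith [happend w (List.replicate m w).flatten]

theorem exists_abs_log_markovLength_append_sub_le {d : ℕ} {F : CircleEndo d} (hC1 : F.IsC1Holder)
    (hexp : F.IsExpanding) : ∃ A : ℝ, ∀ u w : List (Fin d),
      |Real.log (markovLength F (u ++ w)) -
        (Real.log (markovLength F u) + Real.log (markovLength F w))| ≤ A := by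
  obtain ⟨A, α, -, -, h⟩ := exists_abs_log_markovLength_le hC1 hexp
  refine ⟨A, fun u w => ?_⟩
  simpa [markovLength_nil, abs_sub_comm] using h u [] w

namespace IsConj

variable {d : ℕ} {F G : CircleEndo d} {H : ℝ ≃o ℝ}

theorem monotone_mul_sub_of_markovLength_le (hd : 2 ≤ d) (h : IsConj F G H)
    (hdiff : Differentiable ℝ G.lift) (hexp : G.IsExpanding) {C : ℝ}
    (hC : ∀ w : List (Fin d), markovLength F w ≤ C * markovLength G w) :
    Monotone fun x => C * x - H x := by
  have hstep (n : ℕ) : Monotone fun N : ℤ => C * (G.iter n).symm N - H ((G.iter n).symm N) := by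
    refine monotone_int_of_le_succ fun N => ?_
    obtain ⟨w, m, rfl, hN⟩ := exists_int_eq_wordNum_add hd n N
    have hw := hC w
    rw [h.markovLength_eq, markovLength, branch, branch, zero_add] at hw
    push_cast
    rw [hN, add_right_comm, CircleEndo.iter_symm_add_int, CircleEndo.iter_symm_add_int,
      h.map_add_int, h.map_add_int, add_comm _ (1 : ℝ)]
    linarith
  have hlim (x : ℝ) : Tendsto (fun n => C * G.zoom x n 0 - H (G.zoom x n 0)) atTop
      (𝓝 (C * x - H x)) :=
    (((continuous_const_mul C).sub H.continuous).tendsto x).comp (hexp.tendsto_zoom hdiff 0)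
  intro x y hxy
  refine le_of_tendsto_of_tendsto' (hlim x) (hlim y) fun n => ?_
  simpa only [CircleEndo.zoom, zero_add] using
    hstep n (Int.floor_mono ((G.iter n).monotone hxy))

/-- A Lipschitz `H` is absolutely continuous, so its derivative cannot vanish identically. -/
theorem isC1Diffeo_of_markovLength_le (hd : 2 ≤ d) (h : IsConj F G H) (hF1 : F.IsC1Holder)
    (hF2 : F.IsExpanding) (hG1 : G.IsC1Holder) (hG2 : G.IsExpanding) {C : ℝ}
    (hC : ∀ w : List (Fin d), markovLength F w ≤ C * markovLength G w) : IsC1Diffeo H := by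
  have hC1 : 1 ≤ C := by simpa [markovLength_nil] using hC []
  lift C to ℝ≥0 using zero_le_one.trans hC1
  have hLip : LipschitzWith C H := lipschitzWith_of_monotone_mul_sub H.monotone
    (h.monotone_mul_sub_of_markovLength_le hd hG1.differentiable hG2 hC)
  have hint := (hLip.lipschitzOnWith (s := uIcc 0 1)).absolutelyContinuousOnInterval
    |>.integral_deriv_eq_sub
  rw [h.map_one, h.map_zero, sub_zero] at hint
  obtain ⟨z, hz⟩ : ∃ z, deriv H z ≠ 0 := by
    by_contra! hzero
    simp [hzero] at hint
  exact h.isC1Diffeo_of_hasDerivAt_ne_zero hF1 hF2 hG1 hG2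
    (differentiableAt_of_deriv_ne_zero hz).hasDerivAt hz

theorem log_markovLength_le_of_holder (h : IsConj F G H) {b C : ℝ}
    (hH : ∀ x ∈ Icc (0 : ℝ) 1, ∀ y ∈ Icc (0 : ℝ) 1, |H x - H y| ≤ C * |x - y| ^ b)
    (w : List (Fin d)) :
    Real.log (markovLength F w) ≤ Real.log C + b * Real.log (markovLength G w) := by
  have hmem {y : ℝ} (hy : y ∈ Icc (0 : ℝ) 1) : branch G w y ∈ Icc 0 1 := by
    simpa only [List.nil_append, branch_nil] using branch_append_mem (F := G) [] w hy
  have hle := (le_abs_self _).trans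
    (hH _ (hmem (right_mem_Icc.2 zero_le_one)) _ (hmem (left_mem_Icc.2 zero_le_one)))
  rw [← h.markovLength_eq, ← markovLength, abs_of_pos (markovLength_pos _)] at hle
  have hpow := Real.rpow_pos_of_pos (markovLength_pos (F := G) w) b
  have hC : 0 < C := pos_of_mul_pos_left ((markovLength_pos w).trans_le hle) hpow.le
  calc Real.log (markovLength F w) ≤ Real.log (C * markovLength G w ^ b) :=
        Real.log_le_log (markovLength_pos w) hle
    _ = Real.log C + b * Real.log (markovLength G w) := by
        rw [Real.log_mul hC.ne' hpow.ne', Real.log_rpow (markovLength_pos w)]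

/-- Up to bounded factors, the lengths for the `m`-fold repetition of `w` are the `m`-th powers of
those for `w`; so the Hölder constant for an exponent `b` is lost when `m → ∞`, and then `b → 1`. -/
theorem exists_markovLength_le_of_holder (h : IsConj F G H) (hF1 : F.IsC1Holder)
    (hF2 : F.IsExpanding) (hG1 : G.IsC1Holder) (hG2 : G.IsExpanding)
    (hH : ∀ b ∈ Ioo (0 : ℝ) 1, ∃ C : ℝ, ∀ x ∈ Icc (0 : ℝ) 1, ∀ y ∈ Icc (0 : ℝ) 1,
      |H x - H y| ≤ C * |x - y| ^ b) :
    ∃ C : ℝ, ∀ w : List (Fin d), markovLength F w ≤ C * markovLength G w := by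
  obtain ⟨A, hF⟩ := exists_abs_log_markovLength_append_sub_le hF1 hF2
  obtain ⟨B, hG⟩ := exists_abs_log_markovLength_append_sub_le hG1 hG2
  refine ⟨Real.exp (A + B), fun w => ?_⟩
  set φ := fun w => -Real.log (markovLength F w)
  set ψ := fun w => Real.log (markovLength G w)
  have hφ := apply_flatten_replicate_le (φ := φ) (B := A) (by simp [φ, markovLength_nil])
    (fun u w => by linarith [neg_le_of_abs_le (hF u w)]) w
  have hψ := apply_flatten_replicate_le (φ := ψ) (B := B) (by simp [ψ, markovLength_nil])
    (fun u w => by linarith [le_of_abs_le (hG u w)]) w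
  have hle (b : ℝ) (hb : b ∈ Ioo (0 : ℝ) 1) : -(φ w + A) ≤ b * (ψ w + B) := by
    obtain ⟨C, hC⟩ := hH b hb
    refine le_of_forall_nat_mul_le_add (c := Real.log C) fun m => ?_
    have hlog := h.log_markovLength_le_of_holder hC (List.replicate m w).flatten
    have hbψ := mul_le_mul_of_nonneg_left (hψ m) hb.1.le
    linarith [hφ m]
  have hlim : Tendsto (fun b => b * (ψ w + B)) (𝓝[<] 1) (𝓝 (ψ w + B)) :=
    (continuous_mul_const _).tendsto' 1 _ (one_mul _) |>.mono_left nhdsWithin_le_nhds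
  have hone : -(φ w + A) ≤ ψ w + B :=
    ge_of_tendsto hlim (mem_of_superset (Ioo_mem_nhdsLT one_pos) hle)
  rw [← Real.log_le_log_iff (markovLength_pos w) (mul_pos (Real.exp_pos _) (markovLength_pos w)),
    Real.log_mul (Real.exp_ne_zero _) (markovLength_pos w).ne', Real.log_exp]
  linarith

end IsConj

/-! ### Weak derivatives of continuously differentiable functions -/

theorem integrable_smul_of_continuousOn {U : Set ℂ} {η : ℂ → ℝ} {g : ℂ → ℂ}
    (hη : Continuous η) (hc : HasCompactSupport η) (hs : tsupport η ⊆ U) (hg : ContinuousOn g U) :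
    Integrable fun z => η z • g z := by
  have hon : IntegrableOn (fun z => η z • g z) (tsupport η) :=
    (hη.continuousOn.smul (hg.mono hs)).integrableOn_compact hc
  have hsupp : (Function.support fun z => η z • g z) ⊆ tsupport η :=
    (Function.support_smul_subset_left η g).trans (subset_tsupport η)
  exact (integrableOn_iff_integrable_of_support_subset hsupp).1 hon

theorem hasWeakDeriv_of_contDiffOn {φ : ℂ → ℂ} {U : Set ℂ} (hU : IsOpen U)
    (hφ : ContDiffOn ℝ 1 φ U) (v : ℂ) : HasWeakDeriv φ U v fun z => fderiv ℝ φ z v := by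
  intro ψ hψ hc hs
  have hφ' : ContinuousOn (fun z => fderiv ℝ φ z v) U :=
    (hφ.continuousOn_fderiv_of_isOpen hU le_rfl).clm_apply continuousOn_const
  have hψd : Differentiable ℝ ψ := hψ.differentiable (by simp)
  have hψ' : Continuous fun z => fderiv ℝ ψ z v :=
    (hψ.continuous_fderiv (by simp)).clm_apply continuous_const
  have hc' : HasCompactSupport fun z => fderiv ℝ ψ z v :=
    hc.fderiv_apply (𝕜 := ℝ) v
  have hs' : tsupport (fun z => fderiv ℝ ψ z v) ⊆ U :=
    (tsupport_fderiv_apply_subset ℝ v).trans hs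
  refine integral_bilinear_hasFDerivAt_right_eq_neg_left_of_integrable (f := φ) (g := ψ)
    (f' := fderiv ℝ φ) (g' := fderiv ℝ ψ) (v := v) (μ := volume)
    (B := (ContinuousLinearMap.lsmul ℝ ℝ (E := ℂ)).flip) ?_ ?_ ?_ ?_ ?_
  · exact integrable_smul_of_continuousOn hψ.continuous hc hs hφ'
  · exact integrable_smul_of_continuousOn hψ' hc' hs' hφ.continuousOn
  · exact integrable_smul_of_continuousOn hψ.continuous hc hs hφ.continuousOn
  · intro z hz
    exact ((hφ.differentiableOn one_ne_zero).differentiableAt (hU.mem_nhds (hs hz))).hasFDerivAt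
  · intro z _
    exact (hψd z).hasFDerivAt

theorem memLp_fderiv_apply_of_contDiffOn {φ : ℂ → ℂ} {U A : Set ℂ} (hU : IsOpen U)
    (hφ : ContDiffOn ℝ 1 φ U) (hA : A ⊆ U) (hAc : IsCompact A) (v : ℂ) (p : ℝ≥0∞) :
    MemLp (fun z => fderiv ℝ φ z v) p (volume.restrict A) := by
  have hcont : ContinuousOn (fun z => fderiv ℝ φ z v) A :=
    ((hφ.continuousOn_fderiv_of_isOpen hU le_rfl).clm_apply continuousOn_const).mono hA
  obtain ⟨C, hC⟩ := hAc.exists_bound_of_continuousOn hcont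
  have : IsFiniteMeasure (volume.restrict A) :=
    ⟨by rw [Measure.restrict_apply_univ]; exact hAc.measure_lt_top⟩
  exact MemLp.of_bound (hcont.aestronglyMeasurable hAc.measurableSet) C
    ((ae_restrict_iff' hAc.measurableSet).2 (Eventually.of_forall hC))

/-! ### Complex dilatation of real linear maps -/

/-- The coefficient `P` of the complex linear part of the real linear map `v ↦ P v + Q v̄`; for a
derivative `L = Dφ` this is `φ_z`. -/
def linearCoeff (L : ℂ →L[ℝ] ℂ) : ℂ := (L 1 - Complex.I * L Complex.I) / 2

/-- The coefficient `Q` of the antilinear part of the real linear map `v ↦ P v + Q v̄`; for a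
derivative `L = Dφ` this is `φ_{z̄}`. -/
def antilinearCoeff (L : ℂ →L[ℝ] ℂ) : ℂ := (L 1 + Complex.I * L Complex.I) / 2

/-- Multiplication by a complex number, as a real linear map. -/
def mulCLM (c : ℂ) : ℂ →L[ℝ] ℂ := (ContinuousLinearMap.toSpanSingleton ℂ c).restrictScalars ℝ

theorem mulCLM_apply (c v : ℂ) : mulCLM c v = v * c := rfl

theorem linearCoeff_mulCLM_comp (c : ℂ) (L : ℂ →L[ℝ] ℂ) :
    linearCoeff (mulCLM c ∘L L) = linearCoeff L * c := by
  simp only [linearCoeff, ContinuousLinearMap.comp_apply, mulCLM_apply]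
  ring

theorem antilinearCoeff_mulCLM_comp (c : ℂ) (L : ℂ →L[ℝ] ℂ) :
    antilinearCoeff (mulCLM c ∘L L) = antilinearCoeff L * c := by
  simp only [antilinearCoeff, ContinuousLinearMap.comp_apply, mulCLM_apply]
  ring

theorem map_eq_linearCoeff_mul_add (L : ℂ →L[ℝ] ℂ) (v : ℂ) :
    L v = linearCoeff L * v + antilinearCoeff L * (starRingEnd ℂ) v := by
  have hL : L v = v.re * L 1 + v.im * L Complex.I := by
    have hv : v = v.re • (1 : ℂ) + v.im • Complex.I := by simp [Complex.re_add_im]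
    conv_lhs => rw [hv, map_add, map_smul, map_smul, Complex.real_smul, Complex.real_smul]
  rw [hL, linearCoeff, antilinearCoeff, Complex.re_eq_add_conj, Complex.im_eq_sub_conj]
  field_simp
  linear_combination (v - (starRingEnd ℂ) v) * L Complex.I * Complex.I_mul_I

theorem linearCoeff_comp_mulCLM (L : ℂ →L[ℝ] ℂ) (c : ℂ) :
    linearCoeff (L ∘L mulCLM c) = linearCoeff L * c := by
  rw [linearCoeff, ContinuousLinearMap.comp_apply, ContinuousLinearMap.comp_apply, mulCLM_apply,
    mulCLM_apply, map_eq_linearCoeff_mul_add L, map_eq_linearCoeff_mul_add L (Complex.I * c),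
    map_mul, map_mul, Complex.conj_I, map_one]
  linear_combination (antilinearCoeff L * (starRingEnd ℂ) c - linearCoeff L * c) / 2 *
    Complex.I_mul_I

theorem antilinearCoeff_comp_mulCLM (L : ℂ →L[ℝ] ℂ) (c : ℂ) :
    antilinearCoeff (L ∘L mulCLM c) = antilinearCoeff L * (starRingEnd ℂ) c := by
  rw [antilinearCoeff, ContinuousLinearMap.comp_apply, ContinuousLinearMap.comp_apply,
    mulCLM_apply, mulCLM_apply, map_eq_linearCoeff_mul_add L,
    map_eq_linearCoeff_mul_add L (Complex.I * c), map_mul, map_mul, Complex.conj_I, map_one]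
  linear_combination (linearCoeff L * c - antilinearCoeff L * (starRingEnd ℂ) c) / 2 *
    Complex.I_mul_I

theorem norm_antilinearCoeff_mulCLM_comp_comp_mulCLM_le {L : ℂ →L[ℝ] ℂ} {k : ℝ}
    (hL : ‖antilinearCoeff L‖ ≤ k * ‖linearCoeff L‖) (a c : ℂ) :
    ‖antilinearCoeff (mulCLM a ∘L L ∘L mulCLM c)‖ ≤
      k * ‖linearCoeff (mulCLM a ∘L L ∘L mulCLM c)‖ := by
  rw [antilinearCoeff_mulCLM_comp, antilinearCoeff_comp_mulCLM, linearCoeff_mulCLM_comp,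
    linearCoeff_comp_mulCLM, norm_mul, norm_mul, norm_mul, norm_mul, RCLike.norm_conj]
  calc ‖antilinearCoeff L‖ * ‖c‖ * ‖a‖ ≤ k * ‖linearCoeff L‖ * ‖c‖ * ‖a‖ := by gcongr
    _ = k * (‖linearCoeff L‖ * ‖c‖ * ‖a‖) := by ring

/-! ### Quasiconformal extension of a smooth circle diffeomorphism -/

/-- The extension `(x, y) ↦ ((H(x+y) + H(x-y)) / 2, (H(x+y) - H(x-y)) / 2)` of `H` to the plane. -/
def planeExtension (H : ℝ → ℝ) (z : ℂ) : ℂ :=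
  ⟨(H (z.re + z.im) + H (z.re - z.im)) / 2, (H (z.re + z.im) - H (z.re - z.im)) / 2⟩

theorem planeExtension_eq_comp (H : ℝ → ℝ) :
    planeExtension H = Complex.equivRealProdCLM.symm ∘ fun z =>
      ((H (z.re + z.im) + H (z.re - z.im)) / 2, (H (z.re + z.im) - H (z.re - z.im)) / 2) :=
  rfl

theorem planeExtension_ofReal (H : ℝ → ℝ) (x : ℝ) : planeExtension H x = H x := by
  apply Complex.ext <;> simp [planeExtension]

theorem planeExtension_add_int {H : ℝ → ℝ} (h : ∀ x (m : ℤ), H (x + m) = H x + m) (z : ℂ) (m : ℤ) :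
    planeExtension H (z + m) = planeExtension H z + m := by
  apply Complex.ext <;>
    simp only [planeExtension, Complex.add_re, Complex.add_im, Complex.intCast_re,
      Complex.intCast_im, add_zero, add_right_comm, add_sub_right_comm, h] <;>
    ring

theorem planeExtension_comp (H K : ℝ → ℝ) (z : ℂ) :
    planeExtension H (planeExtension K z) = planeExtension (H ∘ K) z := by
  simp only [planeExtension, Function.comp]
  congr 2 <;> ring_nf

theorem planeExtension_id (z : ℂ) : planeExtension id z = z := by
  apply Complex.ext <;> simp [planeExtension]

theorem continuous_planeExtension {H : ℝ → ℝ} (hH : Continuous H) :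
    Continuous (planeExtension H) := by
  rw [planeExtension_eq_comp]
  fun_prop

/-- The plane extension of `H`, as a homeomorphism of the plane. -/
def planeHomeomorph (H : ℝ ≃o ℝ) : ℂ ≃ₜ ℂ where
  toFun := planeExtension H
  invFun := planeExtension H.symm
  left_inv z := by
    rw [planeExtension_comp, show ⇑H.symm ∘ ⇑H = id from funext H.symm_apply_apply,
      planeExtension_id]
  right_inv z := by
    rw [planeExtension_comp, show ⇑H ∘ ⇑H.symm = id from funext H.apply_symm_apply,
      planeExtension_id]
  continuous_toFun := continuous_planeExtension H.continuous
  continuous_invFun := continuous_planeExtension H.symm.continuous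

theorem contDiff_planeExtension {H : ℝ → ℝ} (hH : ContDiff ℝ 1 H) :
    ContDiff ℝ 1 (planeExtension H) := by
  have hre : ContDiff ℝ 1 Complex.re := Complex.reCLM.contDiff
  have him : ContDiff ℝ 1 Complex.im := Complex.imCLM.contDiff
  have hadd : ContDiff ℝ 1 fun z : ℂ => H (z.re + z.im) := hH.comp (hre.add him)
  have hsub : ContDiff ℝ 1 fun z : ℂ => H (z.re - z.im) := hH.comp (hre.sub him)
  rw [planeExtension_eq_comp]
  exact Complex.equivRealProdCLM.symm.contDiff.comp
    (((hadd.add hsub).div_const 2).prodMk ((hadd.sub hsub).div_const 2))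

theorem exists_hasFDerivAt_planeExtension {H : ℝ → ℝ} (hH : Differentiable ℝ H) (z : ℂ) :
    ∃ L, HasFDerivAt (planeExtension H) L z ∧
      linearCoeff L = ((deriv H (z.re + z.im) + deriv H (z.re - z.im)) / 2 : ℝ) ∧
      antilinearCoeff L =
        Complex.I * ((deriv H (z.re + z.im) - deriv H (z.re - z.im)) / 2 : ℝ) := by
  have hre : HasFDerivAt Complex.re Complex.reCLM z := Complex.reCLM.hasFDerivAt
  have him : HasFDerivAt Complex.im Complex.imCLM z := Complex.imCLM.hasFDerivAt
  have hadd := (hH (z.re + z.im)).hasDerivAt.comp_hasFDerivAt z (hre.add him)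
  have hsub := (hH (z.re - z.im)).hasDerivAt.comp_hasFDerivAt z (hre.sub him)
  refine ⟨_, Complex.equivRealProdCLM.symm.hasFDerivAt.comp z
    (((hadd.add hsub).mul_const 2⁻¹).prodMk ((hadd.sub hsub).mul_const 2⁻¹)), ?_, ?_⟩
  · apply Complex.ext <;> simp [linearCoeff] <;> ring
  · apply Complex.ext <;> simp [antilinearCoeff] <;> ring

/-- The covering map `z ↦ e^{2πiz}` of the punctured plane. -/
def planeCover (z : ℂ) : ℂ := Complex.exp (2 * Real.pi * Complex.I * z)

/-- A branch of the inverse of the covering map near the image of `z`. -/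
def coverBranch (z w : ℂ) : ℂ := z + Complex.log (w / planeCover z) / (2 * Real.pi * Complex.I)

theorem planeCover_ne_zero (z : ℂ) : planeCover z ≠ 0 := Complex.exp_ne_zero _

theorem planeCover_coverBranch (z : ℂ) {w : ℂ} (hw : w ≠ 0) :
    planeCover (coverBranch z w) = w := by
  rw [planeCover, coverBranch, mul_add, mul_div_cancel₀ _ Complex.two_pi_I_ne_zero, Complex.exp_add,
    ← planeCover, Complex.exp_log (div_ne_zero hw (planeCover_ne_zero z)),
    mul_div_cancel₀ _ (planeCover_ne_zero z)]

theorem coverBranch_self (z : ℂ) : coverBranch z (planeCover z) = z := by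
  simp [coverBranch, planeCover_ne_zero]

theorem planeCover_eq_iff {z w : ℂ} : planeCover z = planeCover w ↔ ∃ n : ℤ, z = w + n := by
  rw [planeCover, planeCover, Complex.exp_eq_exp_iff_exists_int]
  refine exists_congr fun n => ?_
  rw [← mul_right_inj' Complex.two_pi_I_ne_zero (b := z)]
  constructor <;> intro h <;> rw [h] <;> ring

theorem sphere_subset_image_planeCover_strip {δ : ℝ} (hδ : 0 < δ) :
    Metric.sphere (0 : ℂ) 1 ⊆ planeCover '' {z | |z.im| < δ} := by
  intro w hw
  obtain ⟨θ, rfl⟩ := (Complex.norm_eq_one_iff w).1 (by simpa using hw)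
  refine ⟨(θ / (2 * Real.pi) : ℝ), by rwa [mem_ofPred_eq, Complex.ofReal_im, abs_zero], ?_⟩
  rw [planeCover]
  push_cast
  congr 1
  field_simp

theorem hasDerivAt_planeCover (z : ℂ) :
    HasDerivAt planeCover (planeCover z * (2 * Real.pi * Complex.I)) z := by
  have := ((hasDerivAt_id' z).const_mul (2 * Real.pi * Complex.I)).cexp
  rwa [mul_one] at this

theorem contDiff_planeCover : ContDiff ℂ 1 planeCover :=
  Complex.contDiff_exp.comp (contDiff_const.mul contDiff_id)

theorem contDiffAt_coverBranch (z : ℂ) : ContDiffAt ℂ 1 (coverBranch z) (planeCover z) := by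
  unfold coverBranch
  have hlog : ContDiffAt ℂ 1 Complex.log (planeCover z / planeCover z) :=
    Complex.contDiffAt_log (by simp [planeCover_ne_zero])
  exact contDiffAt_const.add
    ((ContDiffAt.comp (g := Complex.log) (f := fun w => w / planeCover z) _ hlog
      (contDiffAt_id.div_const (planeCover z))).div_const _)

theorem isOpenMap_planeCover : IsOpenMap planeCover :=
  Complex.isOpenMap_exp.comp (isOpenMap_smul₀ Complex.two_pi_I_ne_zero)

/-- The map of the punctured plane induced by the plane extension of `H`. -/
def annulusExtension (H : ℝ → ℝ) (w : ℂ) : ℂ := planeCover (planeExtension H (coverBranch 0 w))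

section Annulus

variable {H : ℝ → ℝ}

theorem annulusExtension_planeCover (hint : ∀ x (m : ℤ), H (x + m) = H x + m) (z : ℂ) :
    annulusExtension H (planeCover z) = planeCover (planeExtension H z) := by
  obtain ⟨n, hn⟩ := planeCover_eq_iff.1 (planeCover_coverBranch 0 (planeCover_ne_zero z))
  rw [annulusExtension, hn, planeExtension_add_int hint]
  exact planeCover_eq_iff.2 ⟨n, rfl⟩

theorem annulusExtension_eq (hint : ∀ x (m : ℤ), H (x + m) = H x + m) (z : ℂ) {w : ℂ}
    (hw : w ≠ 0) :
    annulusExtension H w = planeCover (planeExtension H (coverBranch z w)) := by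
  rw [← annulusExtension_planeCover hint, planeCover_coverBranch z hw]

theorem annulusExtension_eventuallyEq (hint : ∀ x (m : ℤ), H (x + m) = H x + m) (z : ℂ) :
    annulusExtension H =ᶠ[𝓝 (planeCover z)] planeCover ∘ planeExtension H ∘ coverBranch z := by
  filter_upwards [isOpen_ne.mem_nhds (planeCover_ne_zero z)] with w hw
  exact annulusExtension_eq hint z hw

theorem contDiffOn_annulusExtension (hint : ∀ x (m : ℤ), H (x + m) = H x + m)
    (hH : ContDiff ℝ 1 H) : ContDiffOn ℝ 1 (annulusExtension H) {0}ᶜ := by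
  intro w hw
  have hlocal := (((contDiff_planeCover.restrict_scalars ℝ).comp
    (contDiff_planeExtension hH)).contDiffAt.comp _ ((contDiffAt_coverBranch
      (coverBranch 0 w)).restrict_scalars ℝ)).congr_of_eventuallyEq
        (annulusExtension_eventuallyEq hint (coverBranch 0 w))
  rw [planeCover_coverBranch 0 hw] at hlocal
  exact hlocal.contDiffWithinAt

theorem norm_antilinearCoeff_fderiv_annulusExtension_le
    (hint : ∀ x (m : ℤ), H (x + m) = H x + m) (hH : Differentiable ℝ H) {k : ℝ} {z : ℂ}
    (hpos : ∀ x, 0 < deriv H x)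
    (hosc : |deriv H (z.re + z.im) - deriv H (z.re - z.im)| ≤
      k * (deriv H (z.re + z.im) + deriv H (z.re - z.im))) :
    ‖antilinearCoeff (fderiv ℝ (annulusExtension H) (planeCover z))‖ ≤
      k * ‖linearCoeff (fderiv ℝ (annulusExtension H) (planeCover z))‖ := by
  obtain ⟨L, hL, hlin, hanti⟩ := exists_hasFDerivAt_planeExtension hH z
  have hbranch : HasFDerivAt (coverBranch z) (mulCLM (deriv (coverBranch z) (planeCover z)))
      (planeCover z) :=
    ((contDiffAt_coverBranch z).differentiableAt
      one_ne_zero).hasDerivAt.hasFDerivAt.restrictScalars ℝ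
  have hcover : HasFDerivAt planeCover
      (mulCLM (planeCover (planeExtension H z) * (2 * Real.pi * Complex.I)))
      (planeExtension H z) :=
    (hasDerivAt_planeCover _).hasFDerivAt.restrictScalars ℝ
  rw [← coverBranch_self z] at hL hcover
  rw [((hcover.comp (planeCover z) (hL.comp (planeCover z) hbranch)).congr_of_eventuallyEq
    (annulusExtension_eventuallyEq hint z)).fderiv]
  apply norm_antilinearCoeff_mulCLM_comp_comp_mulCLM_le
  have hsum := add_pos (hpos (z.re + z.im)) (hpos (z.re - z.im))
  rw [hlin, hanti, norm_mul, Complex.norm_I, one_mul, Complex.norm_real, Complex.norm_real,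
    Real.norm_eq_abs, Real.norm_eq_abs, abs_div, abs_div, abs_two, abs_of_pos hsum]
  linarith

end Annulus

section AnnulusHomeomorph

variable {H : ℝ ≃o ℝ}

theorem injOn_annulusExtension (hint : ∀ x (m : ℤ), H (x + m) = H x + m) :
    InjOn (annulusExtension H) {0}ᶜ := by
  intro w hw w' hw' heq
  obtain ⟨n, hn⟩ := planeCover_eq_iff.1 heq
  rw [← planeExtension_add_int hint] at hn
  rw [← planeCover_coverBranch 0 hw, ← planeCover_coverBranch 0 hw', planeCover_eq_iff]
  exact ⟨n, (planeHomeomorph H).injective hn⟩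

theorem image_annulusExtension (hint : ∀ x (m : ℤ), H (x + m) = H x + m) {V : Set ℂ}
    (hV : V ⊆ {0}ᶜ) :
    annulusExtension H '' V = planeCover '' (planeHomeomorph H '' (planeCover ⁻¹' V)) := by
  ext u
  constructor
  · rintro ⟨w, hw, rfl⟩
    exact ⟨_, ⟨coverBranch 0 w, by rwa [mem_preimage, planeCover_coverBranch 0 (hV hw)], rfl⟩, rfl⟩
  · rintro ⟨_, ⟨z, hz, rfl⟩, rfl⟩
    exact ⟨planeCover z, hz, annulusExtension_planeCover hint z⟩

theorem isOpen_image_annulusExtension (hint : ∀ x (m : ℤ), H (x + m) = H x + m) {V : Set ℂ}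
    (hVo : IsOpen V) (hV : V ⊆ {0}ᶜ) : IsOpen (annulusExtension H '' V) := by
  rw [image_annulusExtension hint hV]
  exact isOpenMap_planeCover _
    ((planeHomeomorph H).isOpenMap _ (hVo.preimage contDiff_planeCover.continuous))

theorem isOpenEmbedding_annulusExtension (hint : ∀ x (m : ℤ), H (x + m) = H x + m)
    (hH : ContDiff ℝ 1 H) {U : Set ℂ} (hUo : IsOpen U) (hU : U ⊆ {0}ᶜ) :
    IsOpenEmbedding (U.domRestrict (annulusExtension H)) := by
  refine .of_continuous_injective_isOpenMap
    ((contDiffOn_annulusExtension hint hH).mono hU).continuousOn.domRestrict ?_ fun V hV => ?_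
  · exact ((injOn_annulusExtension hint).mono hU).injective
  · have himage : U.domRestrict (annulusExtension H) '' V =
        annulusExtension H '' (Subtype.val '' V) := by
      rw [image_image]; rfl
    rw [himage]
    exact isOpen_image_annulusExtension hint (hUo.isOpenMap_subtype_val V hV)
      ((Subtype.coe_image_subset U V).trans hU)

end AnnulusHomeomorph

theorem uniformContinuous_of_periodic {D : ℝ → ℝ} {p : ℝ} (hp : 0 < p) (hD : Continuous D)
    (hper : Function.Periodic D p) : UniformContinuous D := by
  have : Fact (0 < p) := ⟨hp⟩
  have hlift : Continuous (hper.lift : AddCircle p → ℝ) := hD.quotient_liftOn' _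
  have hcoe : UniformContinuous ((↑) : ℝ → AddCircle p) :=
    uniformContinuous_of_continuousAt_zero (QuotientAddGroup.mk' (AddSubgroup.zmultiples p))
      (AddCircle.continuous_mk' p).continuousAt
  exact (CompactSpace.uniformContinuous_of_continuous hlift).comp hcoe

theorem exists_abs_sub_le_mul_add_of_periodic {D : ℝ → ℝ} {p : ℝ} (hp : 0 < p) (hD : Continuous D)
    (hper : Function.Periodic D p) (hpos : ∀ x, 0 < D x) {ε : ℝ} (hε : 0 < ε) :
    ∃ δ > 0, ∀ x y, |x - y| < δ → |D x - D y| ≤ ε * (D x + D y) := by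
  obtain ⟨m, ⟨x₀, rfl⟩, hmin⟩ :=
    (hper.compact_of_continuous hp.ne' hD).exists_isLeast (range_nonempty D)
  have hmin' : ∀ x, D x₀ ≤ D x := fun x => hmin (mem_range_self x)
  obtain ⟨δ, hδ, hosc⟩ := Metric.uniformContinuous_iff.1 (uniformContinuous_of_periodic hp hD hper)
    (ε * (D x₀ + D x₀)) (by have := hpos x₀; positivity)
  refine ⟨δ, hδ, fun x y hxy => (hosc hxy).le.trans ?_⟩
  gcongr <;> exact hmin' _

theorem periodic_deriv_of_map_add {H : ℝ → ℝ} {p c : ℝ} (h : ∀ x, H (x + p) = H x + c) :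
    Function.Periodic (deriv H) p := fun x => by
  rw [← deriv_comp_add_const, funext h, deriv_add_const]

theorem exists_isQCExtension {H : ℝ ≃o ℝ} (hone : ∀ x, H (x + 1) = H x + 1) (hH : IsC1Diffeo H)
    {k : ℝ} (hk0 : 0 < k) (hk1 : k < 1) : ∃ U φ, IsQCExtension H U φ k := by
  have hint : ∀ x (m : ℤ), H (x + m) = H x + m := fun x m => by
    rw [map_add_int_of_map_add_one hone, one_mul]
  obtain ⟨δ, hδ, hosc⟩ := exists_abs_sub_le_mul_add_of_periodic one_pos
    (hH.1.continuous_deriv le_rfl) (periodic_deriv_of_map_add hone) hH.deriv_pos hk0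
  set U : Set ℂ := planeCover '' {z | |z.im| < δ / 2}
  have hUo : IsOpen U :=
    isOpenMap_planeCover _ (isOpen_lt (continuous_abs.comp Complex.continuous_im) continuous_const)
  have hU : U ⊆ {0}ᶜ := image_subset_iff.2 fun z _ => planeCover_ne_zero z
  have hcd := (contDiffOn_annulusExtension hint hH.1).mono hU
  have hdil : ∀ w ∈ U, ‖antilinearCoeff (fderiv ℝ (annulusExtension H) w)‖ ≤
      k * ‖linearCoeff (fderiv ℝ (annulusExtension H) w)‖ := by
    rintro _ ⟨z, hz, rfl⟩
    refine norm_antilinearCoeff_fderiv_annulusExtension_le hint (hH.1.differentiable one_ne_zero)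
      hH.deriv_pos (hosc _ _ ?_)
    rw [add_sub_sub_cancel, ← two_mul, abs_mul, abs_two]
    linarith [show |z.im| < δ / 2 from hz]
  refine ⟨U, annulusExtension H, ⟨hUo, isOpenEmbedding_annulusExtension hint hH.1 hUo hU, hk0.le,
    hk1, fun w => fderiv ℝ (annulusExtension H) w 1,
    fun w => fderiv ℝ (annulusExtension H) w Complex.I,
    fun A hA hAc => ⟨memLp_fderiv_apply_of_contDiffOn hUo hcd hA hAc _ _,
      memLp_fderiv_apply_of_contDiffOn hUo hcd hA hAc _ _⟩,
    hasWeakDeriv_of_contDiffOn hUo hcd _, hasWeakDeriv_of_contDiffOn hUo hcd _,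
    (ae_restrict_iff' hUo.measurableSet).2 (Eventually.of_forall hdil)⟩,
    sphere_subset_image_planeCover_strip (half_pos hδ), fun x => ?_⟩
  have hx := annulusExtension_planeCover hint (x : ℂ)
  rwa [planeExtension_ofReal] at hx

theorem one_le_boundaryDilatation (H : ℝ ≃o ℝ) : 1 ≤ boundaryDilatation H := by
  refine le_iInf fun U => le_iInf fun φ => le_iInf fun k => le_iInf fun h => ?_
  have hk0 := h.quasiconformal.nonneg
  have hk1 := h.quasiconformal.lt_one
  rw [ENNReal.one_le_ofReal, le_div_iff₀ (by linarith)]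
  linarith

theorem boundaryDilatation_eq_one {H : ℝ ≃o ℝ} (hone : ∀ x, H (x + 1) = H x + 1)
    (hH : IsC1Diffeo H) : boundaryDilatation H = 1 := by
  refine le_antisymm ?_ (one_le_boundaryDilatation H)
  have hle : ∀ k ∈ Ioo (0 : ℝ) 1, boundaryDilatation H ≤ ENNReal.ofReal ((1 + k) / (1 - k)) := by
    intro k hk
    obtain ⟨U, φ, h⟩ := exists_isQCExtension hone hH hk.1 hk.2
    exact iInf_le_of_le U (iInf_le_of_le φ (iInf_le_of_le k (iInf_le_of_le h le_rfl)))
  have hlim : Tendsto (fun k : ℝ => ENNReal.ofReal ((1 + k) / (1 - k))) (𝓝[>] 0) (𝓝 1) := by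
    have hc : ContinuousAt (fun k : ℝ => (1 + k) / (1 - k)) 0 :=
      ContinuousAt.div (by fun_prop) (by fun_prop) (by norm_num)
    have := ENNReal.tendsto_ofReal (hc.tendsto.mono_left (nhdsWithin_le_nhds (s := Ioi 0)))
    simpa using this
  refine ge_of_tendsto hlim ?_
  filter_upwards [Ioo_mem_nhdsGT (zero_lt_one' ℝ)] with k hk
  exact hle k hk

theorem exists_isQCExtension_of_boundaryDilatation_eq_one {H : ℝ ≃o ℝ}
    (h : boundaryDilatation H = 1) {K : ℝ} (hK0 : 0 < K) (hK1 : K < 1) :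
    ∃ U φ k, k < K ∧ IsQCExtension H U φ k := by
  have hlt : boundaryDilatation H < ENNReal.ofReal ((1 + K) / (1 - K)) := by
    rw [h, ENNReal.one_lt_ofReal, lt_div_iff₀ (by linarith)]
    linarith
  simp only [boundaryDilatation, iInf_lt_iff] at hlt
  obtain ⟨U, φ, k, hq, hlt⟩ := hlt
  refine ⟨U, φ, k, ?_, hq⟩
  have hk1 := hq.quasiconformal.lt_one
  have hk0 := hq.quasiconformal.nonneg
  rw [ENNReal.ofReal_lt_ofReal_iff (by apply div_pos <;> linarith),
    div_lt_div_iff₀ (by linarith) (by linarith)] at hlt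
  nlinarith

/-! ### The isoperimetric inequality in Fourier form -/

theorem norm_fourierCoeffOn_le_of_hasDerivAt {γ γ' : ℝ → ℂ} {a b : ℝ} (hab : a < b)
    (hγ : ∀ θ, HasDerivAt γ (γ' θ) θ) (hγ' : Continuous γ') (hper : γ a = γ b) {n : ℤ}
    (hn : n ≠ 0) :
    ‖fourierCoeffOn hab γ n‖ ≤ (b - a) / (2 * Real.pi) * ‖fourierCoeffOn hab γ' n‖ := by
  have hn1 : (1 : ℝ) ≤ |(n : ℝ)| := by exact_mod_cast Int.one_le_abs hn
  have hpos : 0 ≤ (b - a) / (2 * Real.pi) * ‖fourierCoeffOn hab γ' n‖ := by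
    have := sub_pos.2 hab
    positivity
  have hcoeff : fourierCoeffOn hab γ n =
      (b - a : ℝ) / (2 * Real.pi * Complex.I * n) * fourierCoeffOn hab γ' n := by
    rw [fourierCoeffOn_of_hasDerivAt hab hn (fun x _ => hγ x) (hγ'.intervalIntegrable _ _), hper]
    push_cast
    ring
  calc ‖fourierCoeffOn hab γ n‖
      = (b - a) / (2 * Real.pi) * ‖fourierCoeffOn hab γ' n‖ / |(n : ℝ)| := by
        rw [hcoeff, norm_mul, norm_div, norm_mul, norm_mul, norm_mul, Complex.norm_I,
          Complex.norm_intCast, Complex.norm_real, Complex.norm_real, Complex.norm_two,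
          Real.norm_of_nonneg Real.pi_pos.le, Real.norm_of_nonneg (sub_pos.2 hab).le]
        ring
    _ ≤ (b - a) / (2 * Real.pi) * ‖fourierCoeffOn hab γ' n‖ := div_le_self hpos hn1

/-- **Wirtinger's inequality.** -/
theorem integral_norm_sq_le_of_integral_eq_zero {γ γ' : ℝ → ℂ} {a b : ℝ} (hab : a < b)
    (hγ : ∀ θ, HasDerivAt γ (γ' θ) θ) (hγ' : Continuous γ') (hper : γ a = γ b)
    (hmean : ∫ θ in a..b, γ θ = 0) :
    ∫ θ in a..b, ‖γ θ‖ ^ 2 ≤ ((b - a) / (2 * Real.pi)) ^ 2 * ∫ θ in a..b, ‖γ' θ‖ ^ 2 := by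
  have hγc : Continuous γ := continuous_iff_continuousAt.2 fun θ => (hγ θ).continuousAt
  have hmemLp : ∀ {f : ℝ → ℂ}, Continuous f → MemLp f 2 (volume.restrict (Ioc a b)) := by
    intro f hf
    obtain ⟨C, hC⟩ := (isCompact_Icc (a := a) (b := b)).exists_bound_of_continuousOn hf.continuousOn
    exact MemLp.of_bound hf.aestronglyMeasurable C ((ae_restrict_iff' measurableSet_Ioc).2
      (Eventually.of_forall fun x hx => hC x (Ioc_subset_Icc_self hx)))
  have hcoeff : ∀ n : ℤ, ‖fourierCoeffOn hab γ n‖ ^ 2 ≤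
      ((b - a) / (2 * Real.pi)) ^ 2 * ‖fourierCoeffOn hab γ' n‖ ^ 2 := by
    intro n
    rcases eq_or_ne n 0 with rfl | hn
    · have hzero : fourierCoeffOn hab γ 0 = 0 := by
        rw [fourierCoeffOn_eq_integral]
        simp [hmean]
      rw [hzero, norm_zero, zero_pow two_ne_zero]
      positivity
    · rw [← mul_pow]
      gcongr
      exact norm_fourierCoeffOn_le_of_hasDerivAt hab hγ hγ' hper hn
  have hparseval := hasSum_le hcoeff (hasSum_sq_fourierCoeffOn hab (hmemLp hγc))
    ((hasSum_sq_fourierCoeffOn hab (hmemLp hγ')).mul_left _)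
  rw [smul_eq_mul, smul_eq_mul, mul_left_comm] at hparseval
  exact le_of_mul_le_mul_left hparseval (inv_pos.2 (sub_pos.2 hab))

theorem integral_im_conj_sub_const_mul {γ γ' : ℝ → ℂ} {a b : ℝ}
    (hγ : ∀ θ, HasDerivAt γ (γ' θ) θ) (hγ' : Continuous γ') (hper : γ a = γ b) (m : ℂ) :
    ∫ θ in a..b, ((starRingEnd ℂ) (γ θ - m) * γ' θ).im =
      ∫ θ in a..b, ((starRingEnd ℂ) (γ θ) * γ' θ).im := by
  have hγc : Continuous γ := continuous_iff_continuousAt.2 fun θ => (hγ θ).continuousAt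
  have hclosed : ∫ θ in a..b, γ' θ = 0 := by
    rw [intervalIntegral.integral_eq_sub_of_hasDerivAt (fun θ _ => hγ θ)
      (hγ'.intervalIntegrable _ _), hper, sub_self]
  have hconst : ∫ θ in a..b, ((starRingEnd ℂ) m * γ' θ).im = 0 := by
    have him := Complex.imCLM.intervalIntegral_comp_comm
      ((hγ'.const_mul ((starRingEnd ℂ) m)).intervalIntegrable (μ := volume) a b)
    simp only [Complex.imCLM_apply] at him
    rw [him, intervalIntegral.integral_const_mul, hclosed, mul_zero, Complex.zero_im]
  simp only [map_sub, sub_mul, Complex.sub_im]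
  rw [intervalIntegral.integral_sub (Continuous.intervalIntegrable (by fun_prop) _ _)
    (Continuous.intervalIntegrable (by fun_prop) _ _), hconst, sub_zero]

/-- The **isoperimetric inequality**: the left side is twice the oriented area enclosed by `γ`. -/
theorem integral_im_conj_mul_le {γ γ' : ℝ → ℂ} {a b : ℝ} (hab : a < b)
    (hγ : ∀ θ, HasDerivAt γ (γ' θ) θ) (hγ' : Continuous γ') (hper : γ a = γ b) :
    ∫ θ in a..b, ((starRingEnd ℂ) (γ θ) * γ' θ).im ≤
      (b - a) / (2 * Real.pi) * ∫ θ in a..b, ‖γ' θ‖ ^ 2 := by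
  have hγc : Continuous γ := continuous_iff_continuousAt.2 fun θ => (hγ θ).continuousAt
  have hba : 0 < b - a := sub_pos.2 hab
  set c : ℝ := (b - a) / (2 * Real.pi)
  have hc : 0 < c := by positivity
  set m : ℂ := (b - a)⁻¹ • ∫ θ in a..b, γ θ with hm
  have hmean : ∫ θ in a..b, (γ θ - m) = 0 := by
    rw [intervalIntegral.integral_sub (hγc.intervalIntegrable _ _) (by simp),
      intervalIntegral.integral_const, hm, smul_inv_smul₀ hba.ne', sub_self]
  have hwirtinger := integral_norm_sq_le_of_integral_eq_zero hab (fun θ => (hγ θ).sub_const m) hγ'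
    (by rw [hper]) hmean
  have hamgm : ∀ θ, ((starRingEnd ℂ) (γ θ - m) * γ' θ).im ≤
      (c⁻¹ * ‖γ θ - m‖ ^ 2 + c * ‖γ' θ‖ ^ 2) / 2 := by
    intro θ
    have him := (le_abs_self _).trans (Complex.abs_im_le_norm ((starRingEnd ℂ) (γ θ - m) * γ' θ))
    rw [norm_mul, RCLike.norm_conj] at him
    have hsq : 0 ≤ c⁻¹ * (‖γ θ - m‖ - c * ‖γ' θ‖) ^ 2 := by positivity
    have hexpand : c⁻¹ * (‖γ θ - m‖ - c * ‖γ' θ‖) ^ 2 =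
        c⁻¹ * ‖γ θ - m‖ ^ 2 + c * ‖γ' θ‖ ^ 2 - 2 * (‖γ θ - m‖ * ‖γ' θ‖) := by
      field_simp
      ring
    linarith
  calc ∫ θ in a..b, ((starRingEnd ℂ) (γ θ) * γ' θ).im
      = ∫ θ in a..b, ((starRingEnd ℂ) (γ θ - m) * γ' θ).im :=
        (integral_im_conj_sub_const_mul hγ hγ' hper m).symm
    _ ≤ ∫ θ in a..b, (c⁻¹ * ‖γ θ - m‖ ^ 2 + c * ‖γ' θ‖ ^ 2) / 2 :=
        intervalIntegral.integral_mono_on hab.le (Continuous.intervalIntegrable (by fun_prop) _ _)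
          (Continuous.intervalIntegrable (by fun_prop) _ _) fun θ _ => hamgm θ
    _ = (c⁻¹ * (∫ θ in a..b, ‖γ θ - m‖ ^ 2) + c * ∫ θ in a..b, ‖γ' θ‖ ^ 2) / 2 := by
        rw [intervalIntegral.integral_div, intervalIntegral.integral_add
          (Continuous.intervalIntegrable (by fun_prop) _ _)
          (Continuous.intervalIntegrable (by fun_prop) _ _),
          intervalIntegral.integral_const_mul, intervalIntegral.integral_const_mul]
    _ ≤ (c⁻¹ * (c ^ 2 * ∫ θ in a..b, ‖γ' θ‖ ^ 2) + c * ∫ θ in a..b, ‖γ' θ‖ ^ 2) / 2 := by gcongr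
    _ = c * ∫ θ in a..b, ‖γ' θ‖ ^ 2 := by field_simp; ring

/-! ### Wirtinger derivatives and Green's formula in polar coordinates -/

/-- The derivative `ψ_z = (ψ_x - i ψ_y) / 2`. -/
def wirtingerDz (ψ : ℂ → ℂ) (z : ℂ) : ℂ := linearCoeff (fderiv ℝ ψ z)

/-- The derivative `ψ_{z̄} = (ψ_x + i ψ_y) / 2`. -/
def wirtingerDbar (ψ : ℂ → ℂ) (z : ℂ) : ℂ := antilinearCoeff (fderiv ℝ ψ z)

theorem norm_map_le_norm_linearCoeff_add (L : ℂ →L[ℝ] ℂ) (v : ℂ) :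
    ‖L v‖ ≤ (‖linearCoeff L‖ + ‖antilinearCoeff L‖) * ‖v‖ := by
  rw [map_eq_linearCoeff_mul_add L v, add_mul]
  refine (norm_add_le _ _).trans_eq ?_
  rw [norm_mul, norm_mul, RCLike.norm_conj]

/-- The Jacobian determinant of `L` is `|P|² - |Q|²`. -/
theorem im_conj_map_mul_map_mul_I (L : ℂ →L[ℝ] ℂ) (v : ℂ) :
    ((starRingEnd ℂ) (L v) * L (v * Complex.I)).im =
      ‖v‖ ^ 2 * (‖linearCoeff L‖ ^ 2 - ‖antilinearCoeff L‖ ^ 2) := by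
  rw [map_eq_linearCoeff_mul_add L v, map_eq_linearCoeff_mul_add L (v * Complex.I)]
  simp only [Complex.sq_norm, Complex.normSq_apply, map_add, map_mul, Complex.mul_im,
    Complex.mul_re, Complex.add_re, Complex.add_im, Complex.conj_re, Complex.conj_im, Complex.I_re,
    Complex.I_im]
  ring

theorem continuous_wirtingerDz {ψ : ℂ → ℂ} (h : ContDiff ℝ 1 ψ) : Continuous (wirtingerDz ψ) := by
  have := h.continuous_fderiv one_ne_zero
  unfold wirtingerDz linearCoeff
  fun_prop

theorem continuous_wirtingerDbar {ψ : ℂ → ℂ} (h : ContDiff ℝ 1 ψ) :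
    Continuous (wirtingerDbar ψ) := by
  have := h.continuous_fderiv one_ne_zero
  unfold wirtingerDbar antilinearCoeff
  fun_prop

/-- Polar coordinates centered at `a`. -/
def polarPoint (a : ℂ) (x : ℝ × ℝ) : ℂ := a + x.1 * Complex.exp (x.2 * Complex.I)

theorem contDiff_polarPoint (a : ℂ) {n : WithTop ℕ∞} : ContDiff ℝ n (polarPoint a) := by
  have hfst : ContDiff ℝ n fun x : ℝ × ℝ => (x.1 : ℂ) :=
    Complex.ofRealCLM.contDiff.comp contDiff_fst
  have hsnd : ContDiff ℝ n fun x : ℝ × ℝ => (x.2 : ℂ) :=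
    Complex.ofRealCLM.contDiff.comp contDiff_snd
  exact contDiff_const.add (hfst.mul (hsnd.mul contDiff_const).cexp)

theorem polarPoint_neg_pi (a : ℂ) (s : ℝ) :
    polarPoint a (s, -Real.pi) = polarPoint a (s, Real.pi) := by
  simp [polarPoint, Complex.exp_neg]

theorem fderiv_polarPoint_radial (a : ℂ) (x : ℝ × ℝ) :
    fderiv ℝ (polarPoint a) x (1, 0) = Complex.exp (x.2 * Complex.I) := by
  have hline : HasDerivAt (fun s : ℝ => (s, x.2)) ((1 : ℝ), (0 : ℝ)) x.1 :=
    (hasDerivAt_id x.1).prodMk (hasDerivAt_const _ _)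
  have hcomp := (((contDiff_polarPoint a).differentiable
    one_ne_zero x).hasFDerivAt).comp_hasDerivAt_of_eq x.1 hline rfl
  have hexplicit := (((hasDerivAt_id x.1).ofReal_comp).mul_const
    (Complex.exp (x.2 * Complex.I))).const_add a
  rw [Complex.ofReal_one, one_mul] at hexplicit
  exact hcomp.unique hexplicit

theorem fderiv_polarPoint_angular (a : ℂ) (x : ℝ × ℝ) :
    fderiv ℝ (polarPoint a) x (0, 1) = x.1 • (Complex.exp (x.2 * Complex.I) * Complex.I) := by
  have hline : HasDerivAt (fun s : ℝ => (x.1, s)) ((0 : ℝ), (1 : ℝ)) x.2 :=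
    (hasDerivAt_const _ _).prodMk (hasDerivAt_id x.2)
  have hcomp := (((contDiff_polarPoint a).differentiable
    one_ne_zero x).hasFDerivAt).comp_hasDerivAt_of_eq x.2 hline rfl
  have hexplicit := ((((hasDerivAt_id x.2).ofReal_comp.mul_const
    Complex.I).cexp).const_mul (x.1 : ℂ)).const_add a
  rw [Complex.ofReal_one, one_mul] at hexplicit
  exact hcomp.unique hexplicit

section Green

variable {u : ℝ × ℝ → ℂ}

theorem exists_hasFDerivAt_im_conj_mul_fderiv (hu : ContDiff ℝ 2 u) (v x : ℝ × ℝ) :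
    ∃ L : ℝ × ℝ →L[ℝ] ℝ, HasFDerivAt (fun x => ((starRingEnd ℂ) (u x) * fderiv ℝ u x v).im) L x ∧
      ∀ w, L w = ((starRingEnd ℂ) (fderiv ℝ u x w) * fderiv ℝ u x v +
        (starRingEnd ℂ) (u x) * fderiv ℝ (fderiv ℝ u) x w v).im := by
  have hfderiv : ContDiff ℝ 1 (fderiv ℝ u) := hu.fderiv_right (by norm_num)
  have hconj := (Complex.conjCLE : ℂ →L[ℝ] ℂ).hasFDerivAt.comp x
    (hu.differentiable two_ne_zero x).hasFDerivAt
  have happly := (hfderiv.differentiable one_ne_zero x).hasFDerivAt.clm_apply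
    (hasFDerivAt_const v x)
  refine ⟨_, Complex.imCLM.hasFDerivAt.comp x (hconj.mul happly), fun w => ?_⟩
  simp
  ring

theorem continuous_im_conj_mul_fderiv (hu : ContDiff ℝ 1 u) (v : ℝ × ℝ) :
    Continuous fun x => ((starRingEnd ℂ) (u x) * fderiv ℝ u x v).im := by
  have := hu.continuous
  have := hu.continuous_fderiv one_ne_zero
  fun_prop

/-- Green's formula on a rectangle for the form `Im (ū du)`, whose exterior derivative is twice the
Jacobian of `u`; the two sides `θ = a` and `θ = b` cancel. -/
theorem integral_im_conj_fderiv_mul_fderiv (hu : ContDiff ℝ 2 u) (a b r : ℝ)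
    (hper : ∀ s, (starRingEnd ℂ) (u (s, a)) * fderiv ℝ u (s, a) (1, 0) =
      (starRingEnd ℂ) (u (s, b)) * fderiv ℝ u (s, b) (1, 0)) :
    ∫ s in (0 : ℝ)..r, ∫ θ in a..b,
        2 * ((starRingEnd ℂ) (fderiv ℝ u (s, θ) (1, 0)) * fderiv ℝ u (s, θ) (0, 1)).im =
      (∫ θ in a..b, ((starRingEnd ℂ) (u (r, θ)) * fderiv ℝ u (r, θ) (0, 1)).im) -
        ∫ θ in a..b, ((starRingEnd ℂ) (u (0, θ)) * fderiv ℝ u (0, θ) (0, 1)).im := by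
  have hu1 : ContDiff ℝ 1 u := hu.of_le one_le_two
  choose Lθ hLθ hLθ' using exists_hasFDerivAt_im_conj_mul_fderiv hu (0, 1)
  choose Ls hLs hLs' using exists_hasFDerivAt_im_conj_mul_fderiv hu (1, 0)
  have hdiv : ∀ x, Lθ x (1, 0) + (-Ls x) (0, 1) =
      2 * ((starRingEnd ℂ) (fderiv ℝ u x (1, 0)) * fderiv ℝ u x (0, 1)).im := by
    intro x
    have hsymm : fderiv ℝ (fderiv ℝ u) x (1, 0) (0, 1) = fderiv ℝ (fderiv ℝ u) x (0, 1) (1, 0) :=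
      hu.contDiffAt.isSymmSndFDerivAt (by simp) _ _
    rw [neg_apply, hLθ', hLs', hsymm]
    simp only [Complex.add_im, Complex.mul_im, Complex.conj_re, Complex.conj_im]
    ring
  have hcont : Continuous fun x =>
      2 * ((starRingEnd ℂ) (fderiv ℝ u x (1, 0)) * fderiv ℝ u x (0, 1)).im := by
    have := hu1.continuous_fderiv one_ne_zero
    fun_prop
  have hgreen := integral2_divergence_prod_of_hasFDerivAt
    (fun x => ((starRingEnd ℂ) (u x) * fderiv ℝ u x (0, 1)).im)
    (fun x => -((starRingEnd ℂ) (u x) * fderiv ℝ u x (1, 0)).im) Lθ (fun x => -Ls x) 0 a r b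
    (continuous_im_conj_mul_fderiv hu1 _).continuousOn
    (continuous_im_conj_mul_fderiv hu1 _).neg.continuousOn
    (fun x _ => hLθ x) (fun x _ => (hLs x).neg) (by
      simp only [hdiv]
      exact hcont.continuousOn.integrableOn_compact (isCompact_uIcc.prod isCompact_uIcc))
  simpa only [hdiv, hper, sub_self, zero_add] using hgreen

end Green

section PolarJacobian

variable {ψ : ℂ → ℂ} (a : ℂ)

theorem fderiv_comp_polarPoint (hψ : Differentiable ℝ ψ) (x v : ℝ × ℝ) :
    fderiv ℝ (ψ ∘ polarPoint a) x v =
      fderiv ℝ ψ (polarPoint a x) (fderiv ℝ (polarPoint a) x v) := by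
  rw [fderiv_comp x (hψ _) ((contDiff_polarPoint a).differentiable one_ne_zero x)]
  rfl

theorem im_conj_fderiv_comp_polarPoint (hψ : Differentiable ℝ ψ) (x : ℝ × ℝ) :
    ((starRingEnd ℂ) (fderiv ℝ (ψ ∘ polarPoint a) x (1, 0)) *
      fderiv ℝ (ψ ∘ polarPoint a) x (0, 1)).im =
      x.1 * (‖wirtingerDz ψ (polarPoint a x)‖ ^ 2 - ‖wirtingerDbar ψ (polarPoint a x)‖ ^ 2) := by
  rw [fderiv_comp_polarPoint a hψ, fderiv_comp_polarPoint a hψ, fderiv_polarPoint_radial,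
    fderiv_polarPoint_angular, map_smul, Complex.real_smul, mul_left_comm, Complex.im_ofReal_mul,
    im_conj_map_mul_map_mul_I, Complex.norm_exp_ofReal_mul_I, one_pow, one_mul]
  rfl

theorem norm_fderiv_comp_polarPoint_angular_le (hψ : Differentiable ℝ ψ) {x : ℝ × ℝ}
    (hx : 0 ≤ x.1) :
    ‖fderiv ℝ (ψ ∘ polarPoint a) x (0, 1)‖ ≤
      x.1 * (‖wirtingerDz ψ (polarPoint a x)‖ + ‖wirtingerDbar ψ (polarPoint a x)‖) := by
  have hbound := norm_map_le_norm_linearCoeff_add (fderiv ℝ ψ (polarPoint a x))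
    (Complex.exp (x.2 * Complex.I) * Complex.I)
  rw [norm_mul, Complex.norm_exp_ofReal_mul_I, Complex.norm_I, mul_one, mul_one] at hbound
  rw [fderiv_comp_polarPoint a hψ, fderiv_polarPoint_angular, map_smul, norm_smul,
    Real.norm_of_nonneg hx]
  exact mul_le_mul_of_nonneg_left hbound hx

theorem integral_im_conj_mul_fderiv_comp_polarPoint_le (hψ : ContDiff ℝ 1 ψ) {r : ℝ} (hr : 0 ≤ r) :
    ∫ θ in (-Real.pi)..Real.pi, ((starRingEnd ℂ) ((ψ ∘ polarPoint a) (r, θ)) *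
        fderiv ℝ (ψ ∘ polarPoint a) (r, θ) (0, 1)).im ≤
      r ^ 2 * ∫ θ in (-Real.pi)..Real.pi, (‖wirtingerDz ψ (polarPoint a (r, θ))‖ +
        ‖wirtingerDbar ψ (polarPoint a (r, θ))‖) ^ 2 := by
  have hdiff : Differentiable ℝ ψ := hψ.differentiable one_ne_zero
  have hcomp : ContDiff ℝ 1 (ψ ∘ polarPoint a) := hψ.comp (contDiff_polarPoint a)
  have hderiv : ∀ θ, HasDerivAt (fun θ => (ψ ∘ polarPoint a) (r, θ))
      (fderiv ℝ (ψ ∘ polarPoint a) (r, θ) (0, 1)) θ := fun θ =>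
    (hcomp.differentiable one_ne_zero (r, θ)).hasFDerivAt.comp_hasDerivAt_of_eq θ
      ((hasDerivAt_const θ r).prodMk (hasDerivAt_id θ)) rfl
  have hcont : Continuous fun θ => fderiv ℝ (ψ ∘ polarPoint a) (r, θ) (0, 1) := by
    have := hcomp.continuous_fderiv one_ne_zero
    fun_prop
  have := continuous_wirtingerDz hψ
  have := continuous_wirtingerDbar hψ
  have := (contDiff_polarPoint (n := 1) a).continuous
  have hiso := integral_im_conj_mul_le (neg_lt_self Real.pi_pos) hderiv hcont
    (by simp only [Function.comp, polarPoint_neg_pi])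
  rw [sub_neg_eq_add, ← two_mul, div_self Real.two_pi_pos.ne', one_mul] at hiso
  refine hiso.trans ?_
  rw [← intervalIntegral.integral_const_mul]
  refine intervalIntegral.integral_mono_on (neg_lt_self Real.pi_pos).le
    (Continuous.intervalIntegrable (by fun_prop) _ _)
    (Continuous.intervalIntegrable (by fun_prop) _ _) fun θ _ => ?_
  rw [← mul_pow]
  exact pow_le_pow_left₀ (norm_nonneg _)
    (norm_fderiv_comp_polarPoint_angular_le a hdiff (x := (r, θ)) hr) 2

theorem integral_jacobian_le (hψ : ContDiff ℝ 2 ψ) {r : ℝ} (hr : 0 ≤ r) :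
    ∫ s in (0 : ℝ)..r, ∫ θ in (-Real.pi)..Real.pi,
        s * (‖wirtingerDz ψ (polarPoint a (s, θ))‖ ^ 2 -
          ‖wirtingerDbar ψ (polarPoint a (s, θ))‖ ^ 2) ≤
      r ^ 2 / 2 * ∫ θ in (-Real.pi)..Real.pi, (‖wirtingerDz ψ (polarPoint a (r, θ))‖ +
          ‖wirtingerDbar ψ (polarPoint a (r, θ))‖) ^ 2 := by
  have hdiff : Differentiable ℝ ψ := hψ.differentiable two_ne_zero
  have hgreen := integral_im_conj_fderiv_mul_fderiv (hψ.comp (contDiff_polarPoint a))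
    (-Real.pi) Real.pi r fun s => by
      rw [fderiv_comp_polarPoint a hdiff, fderiv_comp_polarPoint a hdiff, fderiv_polarPoint_radial,
        fderiv_polarPoint_radial]
      simp [polarPoint_neg_pi, Complex.exp_neg]
  have hcenter : ∀ θ, fderiv ℝ (ψ ∘ polarPoint a) (0, θ) (0, 1) = 0 := fun θ => by
    rw [fderiv_comp_polarPoint a hdiff, fderiv_polarPoint_angular, zero_smul, map_zero]
  simp only [im_conj_fderiv_comp_polarPoint a hdiff, hcenter, mul_zero, Complex.zero_im,
    intervalIntegral.integral_zero, sub_zero, intervalIntegral.integral_const_mul] at hgreen ⊢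
  have hboundary := integral_im_conj_mul_fderiv_comp_polarPoint_le a (hψ.of_le one_le_two) hr
  linarith

end PolarJacobian

/-! ### Weighted energy inequality for smooth functions -/

/-- The truncated power weight `max(s, δ)^{-2β}`, a regularization of `s^{-2β}` at the origin. -/
def radialWeight (β δ s : ℝ) : ℝ := (max s δ) ^ (-2 * β)

theorem radialWeight_of_le (β : ℝ) {δ s : ℝ} (h : δ ≤ s) : radialWeight β δ s = s ^ (-2 * β) := by
  rw [radialWeight, max_eq_left h]

theorem radialWeight_of_ge (β : ℝ) {δ s : ℝ} (h : s ≤ δ) : radialWeight β δ s = δ ^ (-2 * β) := by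
  rw [radialWeight, max_eq_right h]

theorem continuous_radialWeight (β : ℝ) {δ : ℝ} (hδ : 0 < δ) : Continuous (radialWeight β δ) := by
  unfold radialWeight
  exact (continuous_id.max continuous_const).rpow_const fun s =>
    Or.inl (lt_max_of_lt_right hδ).ne'

theorem radialWeight_nonneg (β : ℝ) {δ : ℝ} (hδ : 0 < δ) (s : ℝ) : 0 ≤ radialWeight β δ s :=
  Real.rpow_nonneg (hδ.le.trans (le_max_right _ _)) _

section HardyInequality

variable {p q : ℝ → ℝ} {A B β δ R : ℝ}

theorem integral_rpow_mul_deriv_add {G g : ℝ → ℝ} (hδ : 0 < δ) (hδR : δ ≤ R)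
    (hG : ∀ r, HasDerivAt G (g r) r) (hg : Continuous g) (a : ℝ) :
    ContinuousOn (fun r => a * r ^ (a - 1) * G r + r ^ a * g r) (uIcc δ R) ∧
      ∫ r in δ..R, (a * r ^ (a - 1) * G r + r ^ a * g r) = R ^ a * G R - δ ^ a * G δ := by
  have hne : ∀ r ∈ uIcc δ R, r ≠ 0 := fun r hr => by
    rw [uIcc_of_le hδR] at hr
    exact (hδ.trans_le hr.1).ne'
  have hrpow (b : ℝ) : ContinuousOn (fun r : ℝ => r ^ b) (uIcc δ R) :=
    continuousOn_id.rpow_const fun r hr => Or.inl (hne r hr)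
  have hGcont : Continuous G := continuous_iff_continuousAt.2 fun r => (hG r).continuousAt
  have hcont : ContinuousOn (fun r => a * r ^ (a - 1) * G r + r ^ a * g r) (uIcc δ R) :=
    ((continuousOn_const.mul (hrpow (a - 1))).mul hGcont.continuousOn).add
      ((hrpow a).mul hg.continuousOn)
  exact ⟨hcont, intervalIntegral.integral_eq_sub_of_hasDerivAt
    (fun r hr => (Real.hasDerivAt_rpow_const (Or.inl (hne r hr))).mul (hG r))
    hcont.intervalIntegrable⟩

theorem integral_rpow_mul_le_sub (hβ : 0 ≤ β) (hδ : 0 < δ) (hδR : δ ≤ R) (hp : Continuous p)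
    (hq : Continuous q)
    (h : ∀ r, 0 ≤ r → ∫ s in (0 : ℝ)..r, (p s - q s) ≤ r / 2 * (A * p r + B * q r)) :
    ∫ r in δ..R, r ^ (-2 * β) * ((1 - β * A) * p r - (1 + β * B) * q r) ≤
      R ^ (-2 * β) * (∫ s in (0 : ℝ)..R, (p s - q s)) -
        δ ^ (-2 * β) * ∫ s in (0 : ℝ)..δ, (p s - q s) := by
  have hpq : Continuous fun s => p s - q s := hp.sub hq
  have hrpow : ContinuousOn (fun r : ℝ => r ^ (-2 * β)) (uIcc δ R) := by
    refine continuousOn_id.rpow_const fun r hr => Or.inl ?_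
    rw [uIcc_of_le hδR] at hr
    exact (hδ.trans_le hr.1).ne'
  obtain ⟨hcont, hftc⟩ := integral_rpow_mul_deriv_add (R := R) hδ hδR
    (fun r => intervalIntegral.integral_hasDerivAt_right (hpq.intervalIntegrable 0 r)
      (hpq.stronglyMeasurableAtFilter _ _) hpq.continuousAt) hpq (-2 * β)
  rw [← hftc]
  refine intervalIntegral.integral_mono_on hδR
    (hrpow.mul (Continuous.continuousOn (by fun_prop))).intervalIntegrable
    hcont.intervalIntegrable fun r hr => ?_
  have hr0 : 0 < r := hδ.trans_le hr.1
  have hbound : 2 * β * r ^ (-2 * β - 1) * (∫ s in (0 : ℝ)..r, (p s - q s)) ≤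
      2 * β * r ^ (-2 * β - 1) * (r / 2 * (A * p r + B * q r)) := by
    gcongr
    exact h r hr0.le
  have hpow : r ^ (-2 * β) = r ^ (-2 * β - 1) * r := by
    rw [Real.rpow_sub_one hr0.ne', div_mul_cancel₀ _ hr0.ne']
  have hcollect : 2 * β * r ^ (-2 * β - 1) * (r / 2 * (A * p r + B * q r)) =
      r ^ (-2 * β) * (p r - q r) -
        r ^ (-2 * β) * ((1 - β * A) * p r - (1 + β * B) * q r) := by
    rw [hpow]
    ring
  linarith

theorem integral_radialWeight_mul_le (hβ : 0 ≤ β) (hA : 0 ≤ A) (hB : 0 ≤ B) (hδ : 0 < δ)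
    (hδR : δ ≤ R) (hp : Continuous p) (hq : Continuous q)
    (hp0 : ∀ s, 0 ≤ s → 0 ≤ p s) (hq0 : ∀ s, 0 ≤ s → 0 ≤ q s)
    (h : ∀ r, 0 ≤ r → ∫ s in (0 : ℝ)..r, (p s - q s) ≤ r / 2 * (A * p r + B * q r)) :
    ∫ r in (0 : ℝ)..R, radialWeight β δ r * ((1 - β * A) * p r - (1 + β * B) * q r) ≤
      R ^ (-2 * β) * ∫ s in (0 : ℝ)..R, (p s - q s) := by
  have hw := continuous_radialWeight β hδ
  have hint (a b : ℝ) : IntervalIntegrable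
      (fun r => radialWeight β δ r * ((1 - β * A) * p r - (1 + β * B) * q r)) volume a b :=
    Continuous.intervalIntegrable (by fun_prop) _ _
  have houter : ∫ r in δ..R, radialWeight β δ r * ((1 - β * A) * p r - (1 + β * B) * q r) ≤
      R ^ (-2 * β) * (∫ s in (0 : ℝ)..R, (p s - q s)) -
        δ ^ (-2 * β) * ∫ s in (0 : ℝ)..δ, (p s - q s) := by
    refine le_of_eq_of_le (intervalIntegral.integral_congr fun r hr => ?_)
      (integral_rpow_mul_le_sub hβ hδ hδR hp hq h)
    rw [uIcc_of_le hδR] at hr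
    simp only [radialWeight_of_le β hr.1]
  have hinner :
      ∫ r in (0 : ℝ)..δ, radialWeight β δ r * ((1 - β * A) * p r - (1 + β * B) * q r) ≤
      δ ^ (-2 * β) * ∫ s in (0 : ℝ)..δ, (p s - q s) := by
    rw [← intervalIntegral.integral_const_mul]
    refine intervalIntegral.integral_mono_on hδ.le (hint _ _)
      (Continuous.intervalIntegrable (by fun_prop) _ _) fun r hr => ?_
    rw [radialWeight_of_ge β hr.2]
    have hAp : 0 ≤ β * A * p r := mul_nonneg (mul_nonneg hβ hA) (hp0 r hr.1)
    have hBq : 0 ≤ β * B * q r := mul_nonneg (mul_nonneg hβ hB) (hq0 r hr.1)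
    exact mul_le_mul_of_nonneg_left (by linarith) (Real.rpow_nonneg hδ.le _)
  linarith [intervalIntegral.integral_add_adjacent_intervals (hint 0 δ) (hint δ R)]

theorem exists_weighted_integral_le (hβ0 : 0 < β) (hβ1 : β < 1) :
    ∃ c C : ℝ, 0 < c ∧ 0 < C ∧ ∀ (p q : ℝ → ℝ) (R : ℝ), Continuous p → Continuous q →
      (∀ s, 0 ≤ s → 0 ≤ p s) → (∀ s, 0 ≤ s → 0 ≤ q s) →
      (∀ r, 0 ≤ r → ∀ η > 0, ∫ s in (0 : ℝ)..r, (p s - q s) ≤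
        r / 2 * ((1 + η) * p r + (1 + η⁻¹) * q r)) →
      ∀ δ, 0 < δ → δ ≤ R → c * ∫ s in (0 : ℝ)..R, radialWeight β δ s * p s ≤
        R ^ (-2 * β) * (∫ s in (0 : ℝ)..R, p s) +
          C * ∫ s in (0 : ℝ)..R, radialWeight β δ s * q s := by
  -- This `η` makes `1 - β (1 + η)` equal to `(1 - β) / 2`.
  set η := (1 - β) / (2 * β) with hη
  have hη0 : 0 < η := div_pos (by linarith) (by linarith)
  have hcoeff : 1 - β * (1 + η) = (1 - β) / 2 := by rw [hη]; field_simp; ring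
  refine ⟨1 - β * (1 + η), 1 + β * (1 + η⁻¹), by linarith, by positivity,
    fun p q R hp hq hp0 hq0 h δ hδ hδR => ?_⟩
  have hR : 0 < R := hδ.trans_le hδR
  have hw := continuous_radialWeight β hδ
  have hii : ∀ {f : ℝ → ℝ} {a b : ℝ}, Continuous f → IntervalIntegrable f volume a b :=
    fun hf => hf.intervalIntegrable _ _
  have hweighted := integral_radialWeight_mul_le hβ0.le (by positivity) (by positivity) hδ hδR
    hp hq hp0 hq0 fun r hr => h r hr η hη0
  have hsplit : ∫ r in (0 : ℝ)..R,
        radialWeight β δ r * ((1 - β * (1 + η)) * p r - (1 + β * (1 + η⁻¹)) * q r) =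
      (1 - β * (1 + η)) * (∫ s in (0 : ℝ)..R, radialWeight β δ s * p s) -
        (1 + β * (1 + η⁻¹)) * ∫ s in (0 : ℝ)..R, radialWeight β δ s * q s := by
    rw [← intervalIntegral.integral_const_mul, ← intervalIntegral.integral_const_mul,
      ← intervalIntegral.integral_sub (hii (by fun_prop)) (hii (by fun_prop))]
    exact intervalIntegral.integral_congr fun r _ => by ring
  have hdrop : ∫ s in (0 : ℝ)..R, (p s - q s) ≤ ∫ s in (0 : ℝ)..R, p s :=
    intervalIntegral.integral_mono_on hR.le (hii (by fun_prop)) (hii hp) fun r hr => by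
      linarith [hq0 r hr.1]
  linarith [mul_le_mul_of_nonneg_left hdrop (Real.rpow_nonneg hR.le (-2 * β))]

end HardyInequality

theorem norm_polarPoint_sub (a : ℂ) (x : ℝ × ℝ) : ‖polarPoint a x - a‖ = |x.1| := by
  rw [polarPoint, add_sub_cancel_left, norm_mul, Complex.norm_exp_ofReal_mul_I, mul_one,
    Complex.norm_real, Real.norm_eq_abs]

theorem continuous_polarPoint (a : ℂ) : Continuous (polarPoint a) :=
  (contDiff_polarPoint a (n := 0)).continuous

theorem add_polarCoord_symm_eq_polarPoint (a : ℂ) (x : ℝ × ℝ) :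
    a + Complex.polarCoord.symm x = polarPoint a x := by
  rw [Complex.polarCoord_symm_apply, polarPoint, Complex.exp_mul_I, Complex.ofReal_cos,
    Complex.ofReal_sin]

theorem indicator_ball_polarPoint (F : ℂ → ℝ) (a : ℂ) (R : ℝ) {x : ℝ × ℝ}
    (hx : x ∈ polarCoord.target) :
    x.1 * (Metric.ball a R).indicator F (polarPoint a x) =
      (Ioo 0 R ×ˢ Ioo (-Real.pi) Real.pi).indicator (fun x => x.1 * F (polarPoint a x)) x := by
  obtain ⟨hx1, hx2⟩ : 0 < x.1 ∧ x.2 ∈ Ioo (-Real.pi) Real.pi := hx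
  have hball : polarPoint a x ∈ Metric.ball a R ↔ x.1 < R := by
    rw [mem_ball_iff_norm, norm_polarPoint_sub, abs_of_pos hx1]
  by_cases hxR : x.1 < R
  · rw [indicator_of_mem (hball.2 hxR),
      indicator_of_mem (show x ∈ Ioo 0 R ×ˢ Ioo (-Real.pi) Real.pi from ⟨⟨hx1, hxR⟩, hx2⟩)]
  · rw [indicator_of_notMem (hball.not.2 hxR), indicator_of_notMem fun h => hxR h.1.2, mul_zero]

theorem setIntegral_ball_eq_polar {F : ℂ → ℝ} (hF : Continuous F) (a : ℂ) {R : ℝ} (hR : 0 ≤ R) :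
    ∫ z in Metric.ball a R, F z =
      ∫ s in (0 : ℝ)..R, ∫ θ in (-Real.pi)..Real.pi, s * F (polarPoint a (s, θ)) := by
  set S := Ioo (0 : ℝ) R ×ˢ Ioo (-Real.pi) Real.pi
  have hcont : Continuous fun x : ℝ × ℝ => x.1 * F (polarPoint a x) := by
    have := continuous_polarPoint a
    fun_prop
  have hS : MeasurableSet S := measurableSet_Ioo.prod measurableSet_Ioo
  have hSsub : S ⊆ polarCoord.target := fun x hx => ⟨hx.1.1, hx.2⟩
  have hint : IntegrableOn (fun x : ℝ × ℝ => x.1 * F (polarPoint a x)) S :=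
    (hcont.continuousOn.integrableOn_compact (isCompact_Icc.prod isCompact_Icc)).mono_set
      (prod_mono Ioo_subset_Icc_self Ioo_subset_Icc_self)
  calc ∫ z in Metric.ball a R, F z
      = ∫ x in polarCoord.target, x.1 * (Metric.ball a R).indicator F (polarPoint a x) := by
        rw [← integral_indicator measurableSet_ball,
          ← integral_add_left_eq_self (fun z => (Metric.ball a R).indicator F z) a,
          ← Complex.integral_comp_polarCoord_symm]
        simp only [add_polarCoord_symm_eq_polarPoint, smul_eq_mul]
    _ = ∫ x in S, x.1 * F (polarPoint a x) := by
        rw [setIntegral_congr_fun polarCoord.open_target.measurableSet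
          fun x hx => indicator_ball_polarPoint F a R hx, setIntegral_indicator hS,
          inter_eq_right.2 hSsub]
    _ = ∫ s in (0 : ℝ)..R, ∫ θ in (-Real.pi)..Real.pi, s * F (polarPoint a (s, θ)) := by
        rw [Measure.volume_eq_prod, setIntegral_prod _ hint, intervalIntegral.integral_of_le hR,
          integral_Ioc_eq_integral_Ioo]
        refine setIntegral_congr_fun measurableSet_Ioo fun s _ => ?_
        simp only [intervalIntegral.integral_of_le (by linarith [Real.pi_pos] :
          -Real.pi ≤ Real.pi), integral_Ioc_eq_integral_Ioo]

theorem setIntegral_ball_radialWeight_mul_eq_polar {F : ℂ → ℝ} (hF : Continuous F) (a : ℂ)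
    (β : ℝ) {δ R : ℝ} (hδ : 0 < δ) (hR : 0 ≤ R) :
    ∫ z in Metric.ball a R, radialWeight β δ ‖z - a‖ * F z = ∫ s in (0 : ℝ)..R,
      radialWeight β δ s * ∫ θ in (-Real.pi)..Real.pi, s * F (polarPoint a (s, θ)) := by
  have hw := continuous_radialWeight β hδ
  rw [setIntegral_ball_eq_polar (by fun_prop) a hR]
  refine intervalIntegral.integral_congr fun s hs => ?_
  rw [uIcc_of_le hR] at hs
  simp only [norm_polarPoint_sub, abs_of_nonneg hs.1, mul_left_comm s,
    intervalIntegral.integral_const_mul]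

theorem continuous_integral_circle {F : ℂ → ℝ} (hF : Continuous F) (a : ℂ) :
    Continuous fun s : ℝ => ∫ θ in (-Real.pi)..Real.pi, s * F (polarPoint a (s, θ)) := by
  have := continuous_polarPoint a
  refine intervalIntegral.continuous_parametric_intervalIntegral_of_continuous' ?_ _ _
  fun_prop

theorem add_sq_le_one_add_mul_sq {η : ℝ} (hη : 0 < η) (x y : ℝ) :
    (x + y) ^ 2 ≤ (1 + η) * x ^ 2 + (1 + η⁻¹) * y ^ 2 := by
  have hsq : 0 ≤ η⁻¹ * (η * x - y) ^ 2 := by positivity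
  have hexpand : η⁻¹ * (η * x - y) ^ 2 = η * x ^ 2 - 2 * x * y + η⁻¹ * y ^ 2 := by
    field_simp
    ring
  linarith

theorem integral_circle_wirtinger_sub_le {ψ : ℂ → ℂ} (hψ : ContDiff ℝ 2 ψ) (a : ℂ) {r : ℝ}
    (hr : 0 ≤ r) {η : ℝ} (hη : 0 < η) :
    ∫ s in (0 : ℝ)..r,
        ((∫ θ in (-Real.pi)..Real.pi, s * ‖wirtingerDz ψ (polarPoint a (s, θ))‖ ^ 2) -
          ∫ θ in (-Real.pi)..Real.pi, s * ‖wirtingerDbar ψ (polarPoint a (s, θ))‖ ^ 2) ≤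
      r / 2 * ((1 + η) * (∫ θ in (-Real.pi)..Real.pi,
          r * ‖wirtingerDz ψ (polarPoint a (r, θ))‖ ^ 2) +
        (1 + η⁻¹) * ∫ θ in (-Real.pi)..Real.pi,
          r * ‖wirtingerDbar ψ (polarPoint a (r, θ))‖ ^ 2) := by
  have hdz := continuous_wirtingerDz (hψ.of_le one_le_two)
  have hdbar := continuous_wirtingerDbar (hψ.of_le one_le_two)
  have hpolar := continuous_polarPoint a
  have hii : ∀ {f : ℝ → ℝ}, Continuous f → IntervalIntegrable f volume (-Real.pi) Real.pi :=
    fun hf => hf.intervalIntegrable _ _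
  have hsub (s : ℝ) :
      (∫ θ in (-Real.pi)..Real.pi, s * ‖wirtingerDz ψ (polarPoint a (s, θ))‖ ^ 2) -
        (∫ θ in (-Real.pi)..Real.pi, s * ‖wirtingerDbar ψ (polarPoint a (s, θ))‖ ^ 2) =
      ∫ θ in (-Real.pi)..Real.pi, s * (‖wirtingerDz ψ (polarPoint a (s, θ))‖ ^ 2 -
        ‖wirtingerDbar ψ (polarPoint a (s, θ))‖ ^ 2) := by
    rw [← intervalIntegral.integral_sub (hii (by fun_prop)) (hii (by fun_prop))]
    exact intervalIntegral.integral_congr fun θ _ => (mul_sub _ _ _).symm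
  have hyoung := intervalIntegral.integral_mono_on (by linarith [Real.pi_pos])
    (hii (by fun_prop)) (hii (by fun_prop)) fun θ (_ : θ ∈ Icc (-Real.pi) Real.pi) =>
      add_sq_le_one_add_mul_sq hη ‖wirtingerDz ψ (polarPoint a (r, θ))‖
        ‖wirtingerDbar ψ (polarPoint a (r, θ))‖
  rw [intervalIntegral.integral_add (hii (by fun_prop)) (hii (by fun_prop)),
    intervalIntegral.integral_const_mul, intervalIntegral.integral_const_mul] at hyoung
  simp only [hsub]
  rw [intervalIntegral.integral_const_mul, intervalIntegral.integral_const_mul]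
  calc _ ≤ r ^ 2 / 2 * _ := integral_jacobian_le a hψ hr
    _ ≤ r ^ 2 / 2 * _ := mul_le_mul_of_nonneg_left hyoung (by positivity)
    _ = _ := by ring

theorem exists_weighted_energy_le {β : ℝ} (hβ0 : 0 < β) (hβ1 : β < 1) :
    ∃ c C : ℝ, 0 < c ∧ 0 < C ∧
      ∀ (ψ : ℂ → ℂ), ContDiff ℝ 2 ψ → ∀ (a : ℂ) (δ R : ℝ), 0 < δ → δ ≤ R →
        c * ∫ z in Metric.ball a R, radialWeight β δ ‖z - a‖ * ‖wirtingerDz ψ z‖ ^ 2 ≤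
          R ^ (-2 * β) * (∫ z in Metric.ball a R, ‖wirtingerDz ψ z‖ ^ 2) +
          C * ∫ z in Metric.ball a R, radialWeight β δ ‖z - a‖ * ‖wirtingerDbar ψ z‖ ^ 2 := by
  obtain ⟨c, C, hc, hC, h⟩ := exists_weighted_integral_le hβ0 hβ1
  refine ⟨c, C, hc, hC, fun ψ hψ a δ R hδ hδR => ?_⟩
  have hR : 0 ≤ R := hδ.le.trans hδR
  have hdz : Continuous fun z => ‖wirtingerDz ψ z‖ ^ 2 :=
    (continuous_wirtingerDz (hψ.of_le one_le_two)).norm.pow 2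
  have hdbar : Continuous fun z => ‖wirtingerDbar ψ z‖ ^ 2 :=
    (continuous_wirtingerDbar (hψ.of_le one_le_two)).norm.pow 2
  have hnonneg (f : ℂ → ℂ) (s : ℝ) (hs : 0 ≤ s) :
      0 ≤ ∫ θ in (-Real.pi)..Real.pi, s * ‖f (polarPoint a (s, θ))‖ ^ 2 :=
    intervalIntegral.integral_nonneg (by linarith [Real.pi_pos]) fun θ _ => by positivity
  rw [setIntegral_ball_radialWeight_mul_eq_polar hdz a β hδ hR,
    setIntegral_ball_radialWeight_mul_eq_polar hdbar a β hδ hR, setIntegral_ball_eq_polar hdz a hR]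
  exact h _ _ R (continuous_integral_circle hdz a) (continuous_integral_circle hdbar a)
    (hnonneg _) (hnonneg _) (fun r hr η hη => integral_circle_wirtinger_sub_le hψ a hr hη) δ hδ hδR

/-! ### Morrey's estimate for smooth functions -/

/-- The sum `‖∂ψ‖ + ‖∂̄ψ‖`, which is the operator norm of the real derivative of `ψ`. -/
def gradNorm (ψ : ℂ → ℂ) (z : ℂ) : ℝ := ‖wirtingerDz ψ z‖ + ‖wirtingerDbar ψ z‖

theorem continuous_gradNorm {ψ : ℂ → ℂ} (h : ContDiff ℝ 1 ψ) : Continuous (gradNorm ψ) :=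
  (continuous_wirtingerDz h).norm.add (continuous_wirtingerDbar h).norm

theorem gradNorm_nonneg (ψ : ℂ → ℂ) (z : ℂ) : 0 ≤ gradNorm ψ z := by unfold gradNorm; positivity

theorem norm_sub_le_integral_gradNorm {ψ : ℂ → ℂ} (h : ContDiff ℝ 1 ψ) (a : ℂ) {s : ℝ}
    (hs : 0 ≤ s) (θ : ℝ) : ‖ψ (polarPoint a (s, θ)) - ψ a‖ ≤
      ∫ t in (0 : ℝ)..s, gradNorm ψ (polarPoint a (t, θ)) := by
  set e := Complex.exp (θ * Complex.I)
  have hnorm : ‖e‖ = 1 := Complex.norm_exp_ofReal_mul_I _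
  have hderiv (t : ℝ) : HasDerivAt (fun t : ℝ => ψ (polarPoint a (t, θ)))
      (fderiv ℝ ψ (polarPoint a (t, θ)) e) t := by
    have hray : HasDerivAt (fun t : ℝ => polarPoint a (t, θ)) e t := by
      have := ((Complex.ofRealCLM.hasDerivAt (x := t)).mul_const e).const_add a
      rwa [Complex.ofRealCLM_apply, Complex.ofReal_one, one_mul] at this
    exact ((h.differentiable one_ne_zero _).hasFDerivAt).comp_hasDerivAt t hray
  have hcP := continuous_polarPoint a
  have := h.continuous_fderiv one_ne_zero
  have hcg := continuous_gradNorm h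
  have hftc := intervalIntegral.integral_eq_sub_of_hasDerivAt (a := 0) (b := s)
    (fun t _ => hderiv t) (Continuous.intervalIntegrable (by fun_prop) _ _)
  rw [show polarPoint a (0, θ) = a by simp [polarPoint]] at hftc
  rw [← hftc]
  refine intervalIntegral.norm_integral_le_of_norm_le hs (Eventually.of_forall fun t _ => ?_)
    (Continuous.intervalIntegrable (by fun_prop) _ _)
  simpa only [hnorm, mul_one, gradNorm, wirtingerDz, wirtingerDbar] using
    norm_map_le_norm_linearCoeff_add (fderiv ℝ ψ (polarPoint a (t, θ))) e

theorem integral_integral_swap_of_continuous {f : ℝ → ℝ → ℝ} (hf : Continuous (Function.uncurry f))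
    {a b c d : ℝ} (hab : a ≤ b) (hcd : c ≤ d) :
    ∫ x in a..b, ∫ y in c..d, f x y = ∫ y in c..d, ∫ x in a..b, f x y := by
  simp only [intervalIntegral.integral_of_le hab, intervalIntegral.integral_of_le hcd]
  refine integral_integral_swap ?_
  rw [Measure.prod_restrict, ← Measure.volume_eq_prod]
  exact (hf.continuousOn.integrableOn_compact (isCompact_Icc.prod isCompact_Icc)).mono_set
    (prod_mono Ioc_subset_Icc_self Ioc_subset_Icc_self)

theorem integral_ball_norm_sub_le {ψ : ℂ → ℂ} (h : ContDiff ℝ 1 ψ) (a : ℂ) {r : ℝ} (hr : 0 ≤ r) :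
    ∫ z in Metric.ball a r, ‖ψ z - ψ a‖ ≤ r ^ 2 / 2 *
      ∫ t in (0 : ℝ)..r, ∫ θ in (-Real.pi)..Real.pi, gradNorm ψ (polarPoint a (t, θ)) := by
  have hpi := Real.pi_pos
  have hcψ := h.continuous
  have hcP := continuous_polarPoint a
  have hcg := continuous_gradNorm h
  rw [setIntegral_ball_eq_polar (by fun_prop) a hr, integral_integral_swap_of_continuous
    (f := fun t θ => gradNorm ψ (polarPoint a (t, θ))) (by fun_prop) hr (by linarith)]
  set V : ℝ := ∫ θ in (-Real.pi)..Real.pi, ∫ t in (0 : ℝ)..r, gradNorm ψ (polarPoint a (t, θ))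
  have hcircle : ∀ s ∈ Icc (0 : ℝ) r, ∫ θ in (-Real.pi)..Real.pi,
      s * ‖ψ (polarPoint a (s, θ)) - ψ a‖ ≤ s * V := by
    intro s hs
    rw [intervalIntegral.integral_const_mul]
    refine mul_le_mul_of_nonneg_left ?_ hs.1
    refine intervalIntegral.integral_mono_on (by linarith)
      (Continuous.intervalIntegrable (by fun_prop) _ _) (Continuous.intervalIntegrable ?_ _ _)
      fun θ _ => (norm_sub_le_integral_gradNorm h a hs.1 θ).trans ?_
    · refine intervalIntegral.continuous_parametric_intervalIntegral_of_continuous' ?_ _ _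
      fun_prop
    · exact intervalIntegral.integral_mono_interval le_rfl hs.1 hs.2
        (Eventually.of_forall fun t => gradNorm_nonneg _ _)
        (Continuous.intervalIntegrable (by fun_prop) _ _)
  have hcont : Continuous fun s : ℝ => ∫ θ in (-Real.pi)..Real.pi,
      s * ‖ψ (polarPoint a (s, θ)) - ψ a‖ :=
    continuous_integral_circle (F := fun z => ‖ψ z - ψ a‖) (by fun_prop) a
  refine (intervalIntegral.integral_mono_on hr (hcont.intervalIntegrable _ _)
    (Continuous.intervalIntegrable (by fun_prop) _ _) hcircle).trans_eq ?_
  rw [intervalIntegral.integral_mul_const, integral_id]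
  ring

theorem ball_midpoint_subset_ball_left {E : Type*} [SeminormedAddCommGroup E] [NormedSpace ℝ E]
    (a b : E) : Metric.ball (midpoint ℝ a b) (dist a b / 2) ⊆ Metric.ball a (dist a b) := by
  refine Metric.ball_subset_ball' (le_of_eq ?_)
  rw [dist_midpoint_left, Real.norm_ofNat]
  ring

theorem ball_midpoint_subset_ball_right {E : Type*} [SeminormedAddCommGroup E] [NormedSpace ℝ E]
    (a b : E) : Metric.ball (midpoint ℝ a b) (dist a b / 2) ⊆ Metric.ball b (dist a b) := by
  rw [midpoint_comm, dist_comm]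
  exact ball_midpoint_subset_ball_left b a

theorem norm_sub_mul_le_integral_ball_add {ψ : ℂ → ℂ} (hψ : Continuous ψ) (a b : ℂ) :
    (dist a b / 2) ^ 2 * Real.pi * ‖ψ a - ψ b‖ ≤
      (∫ z in Metric.ball a (dist a b), ‖ψ z - ψ a‖) +
        ∫ z in Metric.ball b (dist a b), ‖ψ z - ψ b‖ := by
  set m := midpoint ℝ a b
  set r := dist a b
  have hint {f : ℂ → ℝ} (x : ℂ) (s : ℝ) (hf : Continuous f) :
      IntegrableOn f (Metric.ball x s) volume :=
    (hf.continuousOn.integrableOn_compact (isCompact_closedBall x s)).mono_set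
      Metric.ball_subset_closedBall
  have hmono {c : ℂ} (hc : Metric.ball m (r / 2) ⊆ Metric.ball c r) :
      ∫ z in Metric.ball m (r / 2), ‖ψ z - ψ c‖ ≤ ∫ z in Metric.ball c r, ‖ψ z - ψ c‖ :=
    setIntegral_mono_set (hint _ _ (by fun_prop)) (Eventually.of_forall fun _ => norm_nonneg _)
      (Eventually.of_forall hc)
  have hvolume : (dist a b / 2) ^ 2 * Real.pi * ‖ψ a - ψ b‖ =
      ∫ _ in Metric.ball m (r / 2), ‖ψ a - ψ b‖ := by
    rw [setIntegral_const, Measure.real, Complex.volume_ball, smul_eq_mul, ENNReal.toReal_mul,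
      ENNReal.toReal_pow, ENNReal.toReal_ofReal (by positivity)]
    rfl
  calc (dist a b / 2) ^ 2 * Real.pi * ‖ψ a - ψ b‖
      ≤ ∫ z in Metric.ball m (r / 2), (‖ψ z - ψ a‖ + ‖ψ z - ψ b‖) := by
        rw [hvolume]
        refine setIntegral_mono_on (hint _ _ continuous_const) (hint _ _ (by fun_prop))
          measurableSet_ball fun z _ => ?_
        rw [← norm_sub_rev (ψ a) (ψ z)]
        exact norm_sub_le_norm_sub_add_norm_sub _ _ _
    _ = (∫ z in Metric.ball m (r / 2), ‖ψ z - ψ a‖) +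
          ∫ z in Metric.ball m (r / 2), ‖ψ z - ψ b‖ :=
        integral_add (hint _ _ (by fun_prop)) (hint _ _ (by fun_prop))
    _ ≤ _ := add_le_add (hmono (ball_midpoint_subset_ball_left a b))
        (hmono (ball_midpoint_subset_ball_right a b))

theorem norm_sub_le_of_gradNorm {ψ : ℂ → ℂ} (h : ContDiff ℝ 1 ψ) {a b : ℂ} {r V : ℝ} (hr : 0 < r)
    (hab : ‖a - b‖ = r)
    (ha : ∫ t in (0 : ℝ)..r, ∫ θ in (-Real.pi)..Real.pi, gradNorm ψ (polarPoint a (t, θ)) ≤ V)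
    (hb : ∫ t in (0 : ℝ)..r, ∫ θ in (-Real.pi)..Real.pi, gradNorm ψ (polarPoint b (t, θ)) ≤ V) :
    ‖ψ a - ψ b‖ ≤ 4 / Real.pi * V := by
  have hmean := norm_sub_mul_le_integral_ball_add h.continuous a b
  rw [dist_eq_norm, hab] at hmean
  have hball {c : ℂ}
      (hc : ∫ t in (0 : ℝ)..r, ∫ θ in (-Real.pi)..Real.pi, gradNorm ψ (polarPoint c (t, θ)) ≤ V) :
      ∫ z in Metric.ball c r, ‖ψ z - ψ c‖ ≤ r ^ 2 / 2 * V :=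
    (integral_ball_norm_sub_le h c hr.le).trans (by gcongr)
  rw [div_mul_eq_mul_div, le_div_iff₀ Real.pi_pos]
  have hscaled : r ^ 2 * (‖ψ a - ψ b‖ * Real.pi) ≤ r ^ 2 * (4 * V) := by
    linarith [hball ha, hball hb]
  exact le_of_mul_le_mul_left hscaled (by positivity)

section WeightedCauchySchwarz

variable {g : ℂ → ℝ} {β δ r : ℝ}

theorem le_rpow_mul_sq_add (β : ℝ) {t : ℝ} (ht : 0 < t) (hr : 0 < r) (x : ℝ) :
    x ≤ r ^ β / 2 * (t ^ (-2 * β) * (t * x ^ 2)) + (r ^ β)⁻¹ / 2 * t ^ (2 * β - 1) := by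
  have : 0 < r ^ β := Real.rpow_pos_of_pos hr _
  set X := t * t ^ (-2 * β) with hX
  have hX0 : 0 < X := mul_pos ht (Real.rpow_pos_of_pos ht _)
  have hXinv : t ^ (2 * β - 1) = X⁻¹ := by
    rw [hX, mul_comm t, ← Real.rpow_add_one ht.ne', ← Real.rpow_neg ht.le]
    congr 1
    ring
  have hsq : 0 ≤ (r ^ β * X)⁻¹ / 2 * (r ^ β * X * x - 1) ^ 2 := by positivity
  have hexpand : (r ^ β * X)⁻¹ / 2 * (r ^ β * X * x - 1) ^ 2 =
      r ^ β / 2 * (X * x ^ 2) - x + (r ^ β)⁻¹ / 2 * X⁻¹ := by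
    field_simp
    ring
  have hcomm : t ^ (-2 * β) * (t * x ^ 2) = X * x ^ 2 := by rw [hX]; ring
  rw [hXinv, hcomm]
  linarith

theorem integral_circle_le_weighted_sq_add (hg : Continuous g) (a : ℂ) {t : ℝ} (ht : 0 < t)
    (hr : 0 < r) (β : ℝ) :
    ∫ θ in (-Real.pi)..Real.pi, g (polarPoint a (t, θ)) ≤
      r ^ β / 2 * (t ^ (-2 * β) * ∫ θ in (-Real.pi)..Real.pi, t * g (polarPoint a (t, θ)) ^ 2) +
        Real.pi * (r ^ β)⁻¹ * t ^ (2 * β - 1) := by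
  have hpolar := continuous_polarPoint a
  have hii {f : ℝ → ℝ} (hf : Continuous f) : IntervalIntegrable f volume (-Real.pi) Real.pi :=
    hf.intervalIntegrable _ _
  refine (intervalIntegral.integral_mono_on (by linarith [Real.pi_pos]) (hii (by fun_prop))
    (hii (by fun_prop)) fun θ _ =>
      le_rpow_mul_sq_add β ht hr (g (polarPoint a (t, θ)))).trans_eq ?_
  rw [intervalIntegral.integral_add (hii (by fun_prop)) (hii (by fun_prop)),
    intervalIntegral.integral_const_mul, intervalIntegral.integral_const_mul,
    intervalIntegral.integral_const, smul_eq_mul]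
  ring

theorem integral_rpow_sub_one_le (hβ : 0 < β) (hδ : 0 ≤ δ) :
    ∫ t in δ..r, t ^ (2 * β - 1) ≤ r ^ (2 * β) / (2 * β) := by
  rw [integral_rpow (Or.inl (by linarith)), sub_add_cancel]
  gcongr
  exact sub_le_self _ (Real.rpow_nonneg hδ _)

theorem integral_annulus_radialWeight_mul_le (hg : Continuous g) (hg0 : ∀ z, 0 ≤ g z) (a : ℂ)
    (β : ℝ) (hδ : 0 < δ) (hδr : δ ≤ r) :
    ∫ t in δ..r, radialWeight β δ t * ∫ θ in (-Real.pi)..Real.pi, t * g (polarPoint a (t, θ)) ≤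
      ∫ z in Metric.ball a r, radialWeight β δ ‖z - a‖ * g z := by
  have hint (x y : ℝ) : IntervalIntegrable (fun t => radialWeight β δ t *
      ∫ θ in (-Real.pi)..Real.pi, t * g (polarPoint a (t, θ))) volume x y :=
    ((continuous_radialWeight β hδ).mul (continuous_integral_circle hg a)).intervalIntegrable _ _
  rw [setIntegral_ball_radialWeight_mul_eq_polar hg a β hδ (hδ.le.trans hδr),
    ← intervalIntegral.integral_add_adjacent_intervals (hint 0 δ) (hint δ r)]
  refine le_add_of_nonneg_left (intervalIntegral.integral_nonneg hδ.le fun t ht => ?_)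
  exact mul_nonneg (radialWeight_nonneg β hδ t) (intervalIntegral.integral_nonneg
    (by linarith [Real.pi_pos]) fun θ _ => mul_nonneg ht.1 (hg0 _))

theorem integral_annulus_le (hg : Continuous g) (a : ℂ) {E : ℝ} (hβ : 0 < β) (hδ : 0 < δ)
    (hδr : δ ≤ r) (hE : ∫ z in Metric.ball a r, radialWeight β δ ‖z - a‖ * g z ^ 2 ≤ E) :
    ∫ t in δ..r, ∫ θ in (-Real.pi)..Real.pi, g (polarPoint a (t, θ)) ≤
      (E / 2 + Real.pi / (2 * β)) * r ^ β := by
  have hr : 0 < r := hδ.trans_le hδr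
  have hw := continuous_radialWeight β hδ
  have hpolar := continuous_polarPoint a
  set P : ℝ → ℝ := fun t => ∫ θ in (-Real.pi)..Real.pi, t * g (polarPoint a (t, θ)) ^ 2
  have hP : Continuous P := continuous_integral_circle (hg.pow 2) a
  have hwP (x y : ℝ) : IntervalIntegrable (fun t => radialWeight β δ t * P t) volume x y :=
    (hw.mul hP).intervalIntegrable _ _
  have hannulus : ∫ t in δ..r, radialWeight β δ t * P t ≤ E :=
    (integral_annulus_radialWeight_mul_le (hg.pow 2) (fun z => sq_nonneg (g z)) a β hδ hδr).trans hE
  have hrpow : IntervalIntegrable (fun t : ℝ => t ^ (2 * β - 1)) volume δ r :=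
    intervalIntegral.intervalIntegrable_rpow' (by linarith)
  have hmean : Continuous fun t : ℝ => ∫ θ in (-Real.pi)..Real.pi, g (polarPoint a (t, θ)) := by
    refine intervalIntegral.continuous_parametric_intervalIntegral_of_continuous' ?_ _ _
    fun_prop
  calc ∫ t in δ..r, ∫ θ in (-Real.pi)..Real.pi, g (polarPoint a (t, θ))
      ≤ ∫ t in δ..r, (r ^ β / 2 * (radialWeight β δ t * P t) +
          Real.pi * (r ^ β)⁻¹ * t ^ (2 * β - 1)) :=
        intervalIntegral.integral_mono_on hδr (hmean.intervalIntegrable _ _)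
          (((hwP _ _).const_mul _).add (hrpow.const_mul _)) fun t ht => by
            rw [radialWeight_of_le β ht.1]
            exact integral_circle_le_weighted_sq_add hg a (hδ.trans_le ht.1) hr β
    _ = r ^ β / 2 * (∫ t in δ..r, radialWeight β δ t * P t) +
          Real.pi * (r ^ β)⁻¹ * ∫ t in δ..r, t ^ (2 * β - 1) := by
        rw [intervalIntegral.integral_add ((hwP _ _).const_mul _) (hrpow.const_mul _),
          intervalIntegral.integral_const_mul, intervalIntegral.integral_const_mul]
    _ ≤ r ^ β / 2 * E + Real.pi * (r ^ β)⁻¹ * (r ^ (2 * β) / (2 * β)) := by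
        gcongr
        exact integral_rpow_sub_one_le hβ hδ.le
    _ = _ := by
        rw [two_mul, Real.rpow_add hr]
        field_simp

theorem integral_le_of_weighted_sq_le (hg : Continuous g) (a : ℂ) {E : ℝ} (hβ : 0 < β)
    (hr : 0 < r)
    (hE : ∀ δ, 0 < δ → δ ≤ r →
      ∫ z in Metric.ball a r, radialWeight β δ ‖z - a‖ * g z ^ 2 ≤ E) :
    ∫ t in (0 : ℝ)..r, ∫ θ in (-Real.pi)..Real.pi, g (polarPoint a (t, θ)) ≤
      (E / 2 + Real.pi / (2 * β)) * r ^ β := by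
  have hpolar := continuous_polarPoint a
  set k : ℝ → ℝ := fun t => ∫ θ in (-Real.pi)..Real.pi, g (polarPoint a (t, θ))
  have hk : Continuous k := by
    refine intervalIntegral.continuous_parametric_intervalIntegral_of_continuous' ?_ _ _
    fun_prop
  have hprimitive : Continuous fun δ => ∫ t in δ..r, k t := by
    simp only [intervalIntegral.integral_symm r]
    exact (intervalIntegral.continuous_primitive (fun x y => hk.intervalIntegrable x y) r).neg
  refine le_of_tendsto (x := 𝓝[>] 0) ((hprimitive.tendsto 0).mono_left nhdsWithin_le_nhds) ?_
  filter_upwards [Ioc_mem_nhdsGT hr] with δ hδ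
  exact integral_annulus_le hg a hβ hδ.1 hδ.2 (hE δ hδ.1 hδ.2)

end WeightedCauchySchwarz

/-! ### Mollification -/

/-- The convolution of `g` with a normalized bump function. -/
def mollify (ρ : ContDiffBump (0 : ℂ)) (g : ℂ → ℂ) : ℂ → ℂ :=
  convolution (ρ.normed volume) g (ContinuousLinearMap.lsmul ℝ ℝ) volume

theorem mollify_apply (ρ : ContDiffBump (0 : ℂ)) (g : ℂ → ℂ) (y : ℂ) :
    mollify ρ g y = ∫ t, ρ.normed volume t • g (y - t) := rfl

theorem mollify_apply' (ρ : ContDiffBump (0 : ℂ)) (g : ℂ → ℂ) (y : ℂ) :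
    mollify ρ g y = ∫ s, ρ.normed volume (y - s) • g s := convolution_lsmul_swap

theorem contDiff_mollify (ρ : ContDiffBump (0 : ℂ)) {g : ℂ → ℂ} (hg : LocallyIntegrable g)
    {n : ℕ∞} : ContDiff ℝ n (mollify ρ g) :=
  ρ.hasCompactSupport_normed.contDiff_convolution_left _ ρ.contDiff_normed hg

theorem integrable_normed_sub_smul (ρ : ContDiffBump (0 : ℂ)) {g : ℂ → ℂ} (hg : LocallyIntegrable g)
    (y : ℂ) : Integrable fun s => ρ.normed volume (y - s) • g s :=
  (ρ.hasCompactSupport_normed.convolutionExists_left (ContinuousLinearMap.lsmul ℝ ℝ)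
    ρ.continuous_normed hg y).integrable_swap

theorem fderiv_mollify_apply (ρ : ContDiffBump (0 : ℂ)) {φ : ℂ → ℂ} (hφ : LocallyIntegrable φ)
    (y v : ℂ) :
    fderiv ℝ (mollify ρ φ) y v = ∫ s, fderiv ℝ (ρ.normed volume) (y - s) v • φ s := by
  have hderiv : fderiv ℝ (mollify ρ φ) y = _ :=
    (ρ.hasCompactSupport_normed.hasFDerivAt_convolution_left (μ := volume)
      (ContinuousLinearMap.lsmul ℝ ℝ) (ρ.contDiff_normed (n := 1)) hφ y).fderiv
  have hint : Integrable fun s => (ContinuousLinearMap.lsmul ℝ ℝ).precompL ℂ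
      (fderiv ℝ (ρ.normed volume) (y - s)) (φ s) :=
    (((ρ.hasCompactSupport_normed (μ := volume)).fderiv ℝ).convolutionExists_left
      (ContinuousLinearMap.precompL ℂ (ContinuousLinearMap.lsmul ℝ ℝ : ℝ →L[ℝ] ℂ →L[ℝ] ℂ))
      ((ρ.contDiff_normed (n := 1)).continuous_fderiv one_ne_zero) hφ y).integrable_swap
  rw [hderiv, convolution_eq_swap, ContinuousLinearMap.integral_apply hint]
  rfl

theorem tsupport_normed_sub_subset (ρ : ContDiffBump (0 : ℂ)) (y : ℂ) :
    tsupport (fun s => ρ.normed volume (y - s)) ⊆ Metric.closedBall y ρ.rOut := by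
  refine closure_minimal (fun s hs => ?_) Metric.isClosed_closedBall
  have hmem : y - s ∈ Function.support (ρ.normed volume) := hs
  rw [ρ.support_normed_eq, mem_ball_zero_iff] at hmem
  rw [Metric.mem_closedBall, dist_comm, dist_eq_norm]
  exact hmem.le

theorem fderiv_mollify_apply_of_hasWeakDeriv (ρ : ContDiffBump (0 : ℂ)) {φ g : ℂ → ℂ} {O : Set ℂ}
    {v : ℂ} (hφ : LocallyIntegrable φ) (hw : HasWeakDeriv φ O v g) {y : ℂ}
    (hy : Metric.closedBall y ρ.rOut ⊆ O) :
    fderiv ℝ (mollify ρ φ) y v = mollify ρ g y := by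
  have hρ : ContDiff ℝ ∞ (ρ.normed (volume : Measure ℂ)) := ρ.contDiff_normed (n := ⊤)
  have hsupp := tsupport_normed_sub_subset ρ y
  have hweak := hw (fun s => ρ.normed volume (y - s)) (hρ.comp (contDiff_const.sub contDiff_id))
    ((isCompact_closedBall y ρ.rOut).of_isClosed_subset (isClosed_tsupport _) hsupp)
    (hsupp.trans hy)
  have hfderiv (s : ℂ) : fderiv ℝ (fun s => ρ.normed volume (y - s)) s v =
      -fderiv ℝ (ρ.normed volume) (y - s) v := by
    have hcomp : HasFDerivAt (fun s => ρ.normed volume (y - s)) _ s :=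
      (hρ.differentiable (by simp) (y - s)).hasFDerivAt.comp s ((hasFDerivAt_id s).const_sub y)
    rw [hcomp.fderiv]
    simp
  simp only [hfderiv, neg_smul, integral_neg, neg_inj] at hweak
  rw [fderiv_mollify_apply ρ hφ, hweak, mollify_apply']

/-- The complex derivative `∂_z` from the derivatives in the coordinate directions. -/
def coordDz (gx gy : ℂ → ℂ) (z : ℂ) : ℂ := (gx z - Complex.I * gy z) / 2

/-- The complex derivative `∂_{z̄}` from the derivatives in the coordinate directions. -/
def coordDbar (gx gy : ℂ → ℂ) (z : ℂ) : ℂ := (gx z + Complex.I * gy z) / 2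

theorem mollify_coordDz (ρ : ContDiffBump (0 : ℂ)) {gx gy : ℂ → ℂ} (hgx : LocallyIntegrable gx)
    (hgy : LocallyIntegrable gy) (y : ℂ) :
    mollify ρ (coordDz gx gy) y = coordDz (mollify ρ gx) (mollify ρ gy) y := by
  simp only [coordDz, mollify_apply']
  rw [← integral_const_mul, ← integral_sub (integrable_normed_sub_smul ρ hgx y)
    ((integrable_normed_sub_smul ρ hgy y).const_mul _), ← integral_div]
  congr 1; funext s
  simp only [Complex.real_smul]
  ring

theorem mollify_coordDbar (ρ : ContDiffBump (0 : ℂ)) {gx gy : ℂ → ℂ} (hgx : LocallyIntegrable gx)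
    (hgy : LocallyIntegrable gy) (y : ℂ) :
    mollify ρ (coordDbar gx gy) y = coordDbar (mollify ρ gx) (mollify ρ gy) y := by
  simp only [coordDbar, mollify_apply']
  rw [← integral_const_mul, ← integral_add (integrable_normed_sub_smul ρ hgx y)
    ((integrable_normed_sub_smul ρ hgy y).const_mul _), ← integral_div]
  congr 1; funext s
  simp only [Complex.real_smul]
  ring

theorem measurable_ofReal_normed (ρ : ContDiffBump (0 : ℂ)) :
    Measurable fun t => ENNReal.ofReal (ρ.normed volume t) :=
  ENNReal.measurable_ofReal.comp ρ.continuous_normed.measurable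

theorem lintegral_ofReal_normed (ρ : ContDiffBump (0 : ℂ)) :
    ∫⁻ t, ENNReal.ofReal (ρ.normed volume t) = 1 := by
  rw [← ofReal_integral_eq_lintegral_ofReal ρ.integrable_normed
    (Eventually.of_forall ρ.nonneg_normed), ρ.integral_normed, ENNReal.ofReal_one]

theorem lintegral_enorm_sq_eq_eLpNorm_sq {α E : Type*} [MeasurableSpace α] [NormedAddCommGroup E]
    (μ : Measure α) (f : α → E) : ∫⁻ x, ‖f x‖ₑ ^ 2 ∂μ = eLpNorm f 2 μ ^ 2 := by
  simpa using (eLpNorm_nnreal_pow_eq_lintegral (μ := μ) (p := 2) (f := f) two_ne_zero).symm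

theorem lintegral_enorm_sq_le {α E : Type*} [MeasurableSpace α] [NormedAddCommGroup E]
    (μ : Measure α) [IsProbabilityMeasure μ] {f : α → E} (hf : AEStronglyMeasurable f μ) :
    (∫⁻ x, ‖f x‖ₑ ∂μ) ^ 2 ≤ ∫⁻ x, ‖f x‖ₑ ^ 2 ∂μ := by
  rw [lintegral_enorm_sq_eq_eLpNorm_sq, ← eLpNorm_one_eq_lintegral_enorm]
  exact pow_le_pow_left' (eLpNorm_le_eLpNorm_of_exponent_le one_le_two hf) 2

theorem enorm_mollify_sq_le (ρ : ContDiffBump (0 : ℂ)) {g : ℂ → ℂ} (hg : Measurable g) (y : ℂ) :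
    ‖mollify ρ g y‖ₑ ^ 2 ≤ ∫⁻ t, ENNReal.ofReal (ρ.normed volume t) * ‖g (y - t)‖ₑ ^ 2 := by
  set η : ℂ → ℝ≥0∞ := fun t => ENNReal.ofReal (ρ.normed volume t)
  have hη : Measurable η := measurable_ofReal_normed ρ
  have hgy : Measurable fun t => g (y - t) := hg.comp (measurable_const.sub measurable_id)
  have : IsProbabilityMeasure (volume.withDensity η) := ⟨by
    rw [withDensity_apply _ MeasurableSet.univ, Measure.restrict_univ, lintegral_ofReal_normed]⟩
  calc ‖mollify ρ g y‖ₑ ^ 2 ≤ (∫⁻ t, η t * ‖g (y - t)‖ₑ) ^ 2 := by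
        gcongr
        rw [mollify_apply]
        refine (enorm_integral_le_lintegral_enorm _).trans_eq (lintegral_congr fun t => ?_)
        rw [enorm_smul, Real.enorm_eq_ofReal (ρ.nonneg_normed t)]
    _ = (∫⁻ t, ‖g (y - t)‖ₑ ∂volume.withDensity η) ^ 2 := by
        rw [lintegral_withDensity_eq_lintegral_mul _ hη hgy.enorm]
        rfl
    _ ≤ ∫⁻ t, ‖g (y - t)‖ₑ ^ 2 ∂volume.withDensity η :=
        lintegral_enorm_sq_le _ hgy.aestronglyMeasurable
    _ = ∫⁻ t, η t * ‖g (y - t)‖ₑ ^ 2 := by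
        rw [lintegral_withDensity_eq_lintegral_mul _ hη (hgy.enorm.pow_const 2)]
        rfl

theorem lintegral_mul_enorm_mollify_sq_le (ρ : ContDiffBump (0 : ℂ)) {g : ℂ → ℂ} (hg : Measurable g)
    {V : ℂ → ℝ≥0∞} (hV : Measurable V) {M : ℝ≥0∞}
    (h : ∀ t : ℂ, ‖t‖ < ρ.rOut → ∫⁻ y, V (y + t) * ‖g y‖ₑ ^ 2 ≤ M) :
    ∫⁻ y, V y * ‖mollify ρ g y‖ₑ ^ 2 ≤ M := by
  have hη := measurable_ofReal_normed ρ
  calc ∫⁻ y, V y * ‖mollify ρ g y‖ₑ ^ 2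
      ≤ ∫⁻ y, ∫⁻ t, V y * (ENNReal.ofReal (ρ.normed volume t) * ‖g (y - t)‖ₑ ^ 2) := by
        refine lintegral_mono fun y => ?_
        rw [lintegral_const_mul _ (by fun_prop)]
        exact mul_le_mul_right (enorm_mollify_sq_le ρ hg y) _
    _ = ∫⁻ t, ∫⁻ y, V y * (ENNReal.ofReal (ρ.normed volume t) * ‖g (y - t)‖ₑ ^ 2) := by
        refine lintegral_lintegral_swap (Measurable.aemeasurable ?_)
        exact (hV.comp measurable_fst).mul ((hη.comp measurable_snd).mul
          ((hg.comp (measurable_fst.sub measurable_snd)).enorm.pow_const 2))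
    _ ≤ ∫⁻ t, ENNReal.ofReal (ρ.normed volume t) * M := by
        refine lintegral_mono fun t => ?_
        rcases lt_or_ge ‖t‖ ρ.rOut with ht | ht
        · have hcomm : ∀ y, V y * (ENNReal.ofReal (ρ.normed volume t) * ‖g (y - t)‖ₑ ^ 2) =
              ENNReal.ofReal (ρ.normed volume t) * (V y * ‖g (y - t)‖ₑ ^ 2) := fun y => by ring
          simp only [hcomm]
          rw [lintegral_const_mul _ (by fun_prop)]
          refine mul_le_mul_right ?_ _
          rw [← lintegral_add_right_eq_self _ t]
          simpa only [add_sub_cancel_right] using h t ht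
        · have hzero : ρ.normed volume t = 0 := by
            rw [← Function.notMem_support, ρ.support_normed_eq, mem_ball_zero_iff]
            exact not_lt.2 ht
          simp [hzero]
    _ = M := by rw [lintegral_mul_const _ hη, lintegral_ofReal_normed, one_mul]

/-! ### Weighted energy and Hölder estimate for Sobolev functions of small dilatation -/

/-- The truncated power weight on the plane, with values in `ℝ≥0∞`. -/
def diskWeight (β δ : ℝ) (z : ℂ) : ℝ≥0∞ := ENNReal.ofReal (radialWeight β δ ‖z‖)

theorem measurable_diskWeight_sub (β : ℝ) {δ : ℝ} (hδ : 0 < δ) (a : ℂ) :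
    Measurable fun z => diskWeight β δ (z - a) :=
  ENNReal.measurable_ofReal.comp
    ((continuous_radialWeight β hδ).comp (by fun_prop : Continuous fun z => ‖z - a‖)).measurable

theorem diskWeight_le_of_le {β δ s : ℝ} (hβ : 0 < β) (hs : 0 < s) {z : ℂ} (h : s ≤ max ‖z‖ δ) :
    diskWeight β δ z ≤ ENNReal.ofReal (s ^ (-2 * β)) :=
  ENNReal.ofReal_le_ofReal (Real.rpow_le_rpow_of_nonpos hs h (by linarith))

theorem diskWeight_add_le {β δ : ℝ} (hβ0 : 0 < β) (hβ1 : β < 1) (hδ : 0 < δ) (z : ℂ) {t : ℂ}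
    (ht : ‖t‖ ≤ δ) : diskWeight β δ (z + t) ≤ 4 * diskWeight β δ z := by
  have hpos : 0 < max ‖z‖ δ := lt_max_of_lt_right hδ
  have hhalf : max ‖z‖ δ / 2 ≤ max ‖z + t‖ δ := by
    have hz : ‖z‖ ≤ ‖z + t‖ + ‖t‖ := by
      simpa only [add_sub_cancel_right] using norm_sub_le (z + t) t
    have hnorm := le_max_left ‖z + t‖ δ
    have hδ' := le_max_right ‖z + t‖ δ
    rw [div_le_iff₀ two_pos]
    exact max_le (by linarith) (by linarith)
  calc diskWeight β δ (z + t) ≤ ENNReal.ofReal ((max ‖z‖ δ / 2) ^ (-2 * β)) :=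
        diskWeight_le_of_le hβ0 (by positivity) hhalf
    _ ≤ ENNReal.ofReal (4 * max ‖z‖ δ ^ (-2 * β)) := by
        refine ENNReal.ofReal_le_ofReal ?_
        rw [Real.div_rpow hpos.le two_pos.le, div_eq_mul_inv, mul_comm,
          ← Real.rpow_neg two_pos.le]
        gcongr
        calc (2 : ℝ) ^ (-(-2 * β)) ≤ 2 ^ (2 : ℝ) :=
              Real.rpow_le_rpow_of_exponent_le one_le_two (by linarith)
          _ = 4 := by norm_num
    _ = 4 * diskWeight β δ z := by
        rw [ENNReal.ofReal_mul (by norm_num), ENNReal.ofReal_ofNat, diskWeight, radialWeight]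

theorem lintegral_diskWeight_mul_ne_top {β δ : ℝ} (hβ : 0 < β) (hδ : 0 < δ) (a : ℂ)
    {f : ℂ → ℝ≥0∞} (hf : ∫⁻ z, f z ≠ ⊤) : ∫⁻ z, diskWeight β δ (z - a) * f z ≠ ⊤ := by
  refine ne_top_of_le_ne_top
    (ENNReal.mul_ne_top (ENNReal.ofReal_ne_top (r := δ ^ (-2 * β))) hf) ?_
  rw [← lintegral_const_mul' _ _ ENNReal.ofReal_ne_top]
  exact lintegral_mono fun z => mul_le_mul_left (diskWeight_le_of_le hβ hδ (le_max_right _ _)) _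

theorem lintegral_diskWeight_mul_le_add {β δ R : ℝ} (hβ : 0 < β) (hR : 0 < R) (a : ℂ)
    (f : ℂ → ℝ≥0∞) :
    ∫⁻ z, diskWeight β δ (z - a) * f z ≤
      (∫⁻ z in Metric.ball a R, diskWeight β δ (z - a) * f z) +
        ENNReal.ofReal (R ^ (-2 * β)) * ∫⁻ z, f z := by
  rw [← lintegral_add_compl _ (measurableSet_ball (x := a) (ε := R))]
  gcongr
  calc ∫⁻ z in (Metric.ball a R)ᶜ, diskWeight β δ (z - a) * f z
      ≤ ∫⁻ z in (Metric.ball a R)ᶜ, ENNReal.ofReal (R ^ (-2 * β)) * f z := by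
        refine setLIntegral_mono' measurableSet_ball.compl fun z hz => mul_le_mul_left ?_ _
        refine diskWeight_le_of_le hβ hR (le_max_of_le_left ?_)
        rwa [mem_compl_iff, mem_ball_iff_norm, not_lt] at hz
    _ ≤ ∫⁻ z, ENNReal.ofReal (R ^ (-2 * β)) * f z := setLIntegral_le_lintegral _ _
    _ = ENNReal.ofReal (R ^ (-2 * β)) * ∫⁻ z, f z :=
        lintegral_const_mul' _ _ ENNReal.ofReal_ne_top

theorem lintegral_diskWeight_mul_enorm_mollify_sq_le (β : ℝ) {δ : ℝ} (hδ : 0 < δ) {a : ℂ}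
    (ρ : ContDiffBump (0 : ℂ)) {g : ℂ → ℂ} (hg : Measurable g) {M : ℝ≥0∞}
    (hM : ∀ b ∈ Metric.ball a ρ.rOut, ∫⁻ z, diskWeight β δ (z - b) * ‖g z‖ₑ ^ 2 ≤ M) :
    ∫⁻ z, diskWeight β δ (z - a) * ‖mollify ρ g z‖ₑ ^ 2 ≤ M := by
  refine lintegral_mul_enorm_mollify_sq_le ρ hg (measurable_diskWeight_sub β hδ a) fun t ht => ?_
  have hmem : a - t ∈ Metric.ball a ρ.rOut := by
    rwa [mem_ball_iff_norm, sub_sub_cancel_left, norm_neg]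
  simpa only [sub_sub_eq_add_sub] using hM (a - t) hmem

theorem lintegral_enorm_mollify_sq_le (ρ : ContDiffBump (0 : ℂ)) {g : ℂ → ℂ} (hg : Measurable g) :
    ∫⁻ z, ‖mollify ρ g z‖ₑ ^ 2 ≤ ∫⁻ z, ‖g z‖ₑ ^ 2 := by
  simpa only [one_mul] using
    lintegral_mul_enorm_mollify_sq_le ρ hg (V := fun _ => 1) measurable_const
      fun _ _ => (lintegral_congr fun _ => one_mul _).le

/-- Mollifiers with supports in the disk of radius `r`, shrinking to the origin. -/
def shrinkingBump {r : ℝ} (hr : 0 < r) (n : ℕ) : ContDiffBump (0 : ℂ) :=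
  ⟨r / (n + 1) / 2, r / (n + 1), by positivity, half_lt_self (by positivity)⟩

theorem shrinkingBump_rOut_le {r : ℝ} (hr : 0 < r) (n : ℕ) : (shrinkingBump hr n).rOut ≤ r :=
  div_le_self hr.le (by simp)

theorem tendsto_shrinkingBump_rOut {r : ℝ} (hr : 0 < r) :
    Tendsto (fun n => (shrinkingBump hr n).rOut) atTop (𝓝 0) := by
  have := (tendsto_one_div_add_atTop_nhds_zero_nat (𝕜 := ℝ)).const_mul r
  simp only [mul_one_div, mul_zero] at this
  exact this

theorem tendsto_mollify_shrinkingBump {r : ℝ} (hr : 0 < r) {g : ℂ → ℂ} (hg : LocallyIntegrable g)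
    {x : ℂ} (hx : ContinuousAt g x) :
    Tendsto (fun n => mollify (shrinkingBump hr n) g x) atTop (𝓝 (g x)) :=
  ContDiffBump.convolution_tendsto_right (tendsto_shrinkingBump_rOut hr)
    (Eventually.of_forall fun _ => hg.aestronglyMeasurable) (hx.tendsto.comp tendsto_snd)
    tendsto_const_nhds

theorem ae_tendsto_mollify_shrinkingBump {r : ℝ} (hr : 0 < r) {g : ℂ → ℂ}
    (hg : LocallyIntegrable g) :
    ∀ᵐ z, Tendsto (fun n => mollify (shrinkingBump hr n) g z) atTop (𝓝 (g z)) :=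
  ContDiffBump.ae_convolution_tendsto_right_of_locallyIntegrable (K := 2)
    (tendsto_shrinkingBump_rOut hr)
    (Eventually.of_forall fun _ => (mul_div_cancel₀ _ two_ne_zero).ge) hg

theorem setLIntegral_mul_enorm_sq_le_of_mollify {r : ℝ} (hr : 0 < r) {g : ℂ → ℂ}
    (hg : LocallyIntegrable g) {V : ℂ → ℝ≥0∞} (hV : Measurable V) (hVtop : ∀ z, V z ≠ ⊤)
    {s : Set ℂ} {B : ℝ≥0∞}
    (hB : ∀ n, ∫⁻ z in s, V z * ‖mollify (shrinkingBump hr n) g z‖ₑ ^ 2 ≤ B) :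
    ∫⁻ z in s, V z * ‖g z‖ₑ ^ 2 ≤ B := by
  have hmeas (n : ℕ) : Measurable (mollify (shrinkingBump hr n) g) :=
    (contDiff_mollify (shrinkingBump hr n) hg (n := 0)).continuous.measurable
  calc ∫⁻ z in s, V z * ‖g z‖ₑ ^ 2
      = ∫⁻ z in s, liminf (fun n => V z * ‖mollify (shrinkingBump hr n) g z‖ₑ ^ 2) atTop := by
        refine lintegral_congr_ae
          ((ae_restrict_of_ae (ae_tendsto_mollify_shrinkingBump hr hg)).mono fun z hz => ?_)
        exact (ENNReal.Tendsto.const_mul (((ENNReal.continuous_pow 2).tendsto _).comp hz.enorm)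
          (Or.inr (hVtop z))).liminf_eq.symm
    _ ≤ liminf (fun n => ∫⁻ z in s, V z * ‖mollify (shrinkingBump hr n) g z‖ₑ ^ 2) atTop :=
        lintegral_liminf_le fun n => hV.mul ((hmeas n).enorm.pow_const 2)
    _ ≤ liminf (fun _ : ℕ => B) atTop := liminf_le_liminf (Eventually.of_forall hB)
    _ = B := liminf_const _

theorem ofReal_setIntegral_ball {f : ℂ → ℝ} (hf : Continuous f) (hnonneg : ∀ z, 0 ≤ f z) (a : ℂ)
    (r : ℝ) :
    ENNReal.ofReal (∫ z in Metric.ball a r, f z) =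
      ∫⁻ z in Metric.ball a r, ENNReal.ofReal (f z) := by
  have hint : IntegrableOn f (Metric.closedBall a r) volume :=
    hf.continuousOn.integrableOn_compact (isCompact_closedBall a r)
  exact ofReal_integral_eq_lintegral_ofReal (hint.mono_set Metric.ball_subset_closedBall)
    (Eventually.of_forall hnonneg)

theorem ofReal_radialWeight_mul (β : ℝ) {δ : ℝ} (hδ : 0 < δ) (z w : ℂ) :
    ENNReal.ofReal (radialWeight β δ ‖z‖ * ‖w‖ ^ 2) = diskWeight β δ z * ‖w‖ₑ ^ 2 := by
  rw [ENNReal.ofReal_mul (radialWeight_nonneg β hδ _), ENNReal.ofReal_pow (norm_nonneg _),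
    ofReal_norm, diskWeight]

theorem ofReal_radialWeight_mul_add_sq_le (β : ℝ) {δ : ℝ} (hδ : 0 < δ) (z v w : ℂ) :
    ENNReal.ofReal (radialWeight β δ ‖z‖ * (‖v‖ + ‖w‖) ^ 2) ≤
      2 * (diskWeight β δ z * ‖v‖ₑ ^ 2) + 2 * (diskWeight β δ z * ‖w‖ₑ ^ 2) := by
  have hweight := radialWeight_nonneg β hδ ‖z‖
  rw [← ofReal_radialWeight_mul β hδ, ← ofReal_radialWeight_mul β hδ, ← ENNReal.ofReal_ofNat 2,
    ← ENNReal.ofReal_mul two_pos.le, ← ENNReal.ofReal_mul two_pos.le,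
    ← ENNReal.ofReal_add (by positivity) (by positivity)]
  refine ENNReal.ofReal_le_ofReal ?_
  calc radialWeight β δ ‖z‖ * (‖v‖ + ‖w‖) ^ 2
      ≤ radialWeight β δ ‖z‖ * (2 * (‖v‖ ^ 2 + ‖w‖ ^ 2)) := by gcongr; exact add_sq_le
    _ = 2 * (radialWeight β δ ‖z‖ * ‖v‖ ^ 2) + 2 * (radialWeight β δ ‖z‖ * ‖w‖ ^ 2) := by ring

/-- The weighted energy inequality for `C²` functions with constants `c` and `C`: up to the energy
on the disk, the weighted energy of `∂_z ψ` is controlled by that of `∂_{z̄} ψ`. -/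
def WeightedEnergyBound (β c C : ℝ) : Prop :=
  ∀ ψ : ℂ → ℂ, ContDiff ℝ 2 ψ → ∀ (a : ℂ) (δ R : ℝ), 0 < δ → δ ≤ R →
    ENNReal.ofReal c * ∫⁻ z in Metric.ball a R, diskWeight β δ (z - a) * ‖wirtingerDz ψ z‖ₑ ^ 2 ≤
      ENNReal.ofReal (R ^ (-2 * β)) * (∫⁻ z in Metric.ball a R, ‖wirtingerDz ψ z‖ₑ ^ 2) +
      ENNReal.ofReal C *
        ∫⁻ z in Metric.ball a R, diskWeight β δ (z - a) * ‖wirtingerDbar ψ z‖ₑ ^ 2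

theorem exists_weightedEnergyBound {β : ℝ} (hβ0 : 0 < β) (hβ1 : β < 1) :
    ∃ c C : ℝ, 0 < c ∧ 0 < C ∧ WeightedEnergyBound β c C := by
  obtain ⟨c, C, hc, hC, h⟩ := exists_weighted_energy_le hβ0 hβ1
  refine ⟨c, C, hc, hC, fun ψ hψ a δ R hδ hδR => ?_⟩
  have hdz := continuous_wirtingerDz (hψ.of_le one_le_two)
  have hdbar := continuous_wirtingerDbar (hψ.of_le one_le_two)
  have hweight := continuous_radialWeight β hδ
  have hnonneg (f : ℂ → ℂ) (z : ℂ) : 0 ≤ radialWeight β δ ‖z - a‖ * ‖f z‖ ^ 2 :=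
    mul_nonneg (radialWeight_nonneg β hδ _) (sq_nonneg _)
  have hR : 0 ≤ R ^ (-2 * β) := Real.rpow_nonneg (hδ.le.trans hδR) _
  have henergy := ENNReal.ofReal_le_ofReal (h ψ hψ a δ R hδ hδR)
  rw [ENNReal.ofReal_mul hc.le, ENNReal.ofReal_add
    (mul_nonneg hR (integral_nonneg fun z => sq_nonneg _))
    (mul_nonneg hC.le (integral_nonneg (hnonneg _))), ENNReal.ofReal_mul hR,
    ENNReal.ofReal_mul hC.le, ofReal_setIntegral_ball (by fun_prop) (hnonneg _),
    ofReal_setIntegral_ball (by fun_prop) (hnonneg _),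
    ofReal_setIntegral_ball (by fun_prop) fun z => sq_nonneg _] at henergy
  simpa only [ofReal_radialWeight_mul β hδ, ENNReal.ofReal_pow (norm_nonneg _), ofReal_norm]
    using henergy

theorem le_of_le_add_of_mul_le {c q : ℝ} (hc : 0 < c) (hq : 0 ≤ q) {E X Y : ℝ≥0∞} (hE : E ≠ ⊤)
    (hY : Y ≠ ⊤) (hYX : Y ≤ X + ENNReal.ofReal q * E)
    (hX : ENNReal.ofReal c * X ≤ ENNReal.ofReal q * E + ENNReal.ofReal (c / 2) * Y) :
    Y ≤ ENNReal.ofReal (2 * (1 + c) / c * q) * E := by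
  have hcY : ENNReal.ofReal c * Y ≤ ENNReal.ofReal c * (ENNReal.ofReal q * E) +
      (ENNReal.ofReal q * E + ENNReal.ofReal (c / 2) * Y) := by
    refine (mul_le_mul_right hYX _).trans ?_
    rw [mul_add, add_comm]
    gcongr
  lift E to ℝ≥0 using hE
  lift Y to ℝ≥0 using hY
  lift c to ℝ≥0 using hc.le
  lift q to ℝ≥0 using hq
  rw [← ENNReal.ofReal_coe_nnreal (p := E), ← ENNReal.ofReal_coe_nnreal (p := Y)] at hcY ⊢
  rw [← ENNReal.ofReal_mul (by positivity)]
  repeat rw [← ENNReal.ofReal_mul (by positivity)] at hcY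
  repeat rw [← ENNReal.ofReal_add (by positivity) (by positivity)] at hcY
  rw [ENNReal.ofReal_le_ofReal_iff (by positivity)] at hcY
  refine ENNReal.ofReal_le_ofReal ?_
  rw [div_mul_eq_mul_div, div_mul_eq_mul_div, le_div_iff₀ hc]
  linarith

/-- A globally defined locally integrable function with square integrable weak derivatives and small
complex dilatation on an open set. -/
structure SobolevData (φ gx gy : ℂ → ℂ) (O : Set ℂ) (k : ℝ) : Prop where
  locallyIntegrable : LocallyIntegrable φ
  measurable_x : Measurable gx
  measurable_y : Measurable gy
  memLp_x : MemLp gx 2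
  memLp_y : MemLp gy 2
  weak_x : HasWeakDeriv φ O 1 gx
  weak_y : HasWeakDeriv φ O Complex.I gy
  nonneg : 0 ≤ k
  dilatation : ∀ᵐ z, ‖coordDbar gx gy z‖ ≤ k * ‖coordDz gx gy z‖

namespace SobolevData

variable {φ gx gy : ℂ → ℂ} {O : Set ℂ} {k : ℝ}

theorem measurable_dz (h : SobolevData φ gx gy O k) : Measurable (coordDz gx gy) := by
  have := h.measurable_x
  have := h.measurable_y
  unfold coordDz
  fun_prop

theorem measurable_dbar (h : SobolevData φ gx gy O k) : Measurable (coordDbar gx gy) := by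
  have := h.measurable_x
  have := h.measurable_y
  unfold coordDbar
  fun_prop

theorem memLp_dz (h : SobolevData φ gx gy O k) : MemLp (coordDz gx gy) 2 := by
  have h1 := (h.memLp_x.sub (h.memLp_y.const_mul Complex.I)).const_mul (1 / 2 : ℂ)
  refine h1.ae_eq (Eventually.of_forall fun z => ?_)
  simp only [coordDz, Pi.sub_apply]
  ring

theorem energy_ne_top (h : SobolevData φ gx gy O k) : ∫⁻ z, ‖coordDz gx gy z‖ₑ ^ 2 ≠ ⊤ := by
  rw [lintegral_enorm_sq_eq_eLpNorm_sq]
  exact ENNReal.pow_ne_top h.memLp_dz.eLpNorm_ne_top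

theorem lintegral_mul_dbar_le (h : SobolevData φ gx gy O k) (V : ℂ → ℝ≥0∞) :
    ∫⁻ z, V z * ‖coordDbar gx gy z‖ₑ ^ 2 ≤
      ENNReal.ofReal (k ^ 2) * ∫⁻ z, V z * ‖coordDz gx gy z‖ₑ ^ 2 := by
  rw [← lintegral_const_mul' _ _ ENNReal.ofReal_ne_top]
  refine lintegral_mono_ae (h.dilatation.mono fun z hz => ?_)
  have hle : ‖coordDbar gx gy z‖ₑ ≤ ENNReal.ofReal k * ‖coordDz gx gy z‖ₑ := by
    rw [← ofReal_norm, ← ofReal_norm, ← ENNReal.ofReal_mul h.nonneg]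
    exact ENNReal.ofReal_le_ofReal hz
  calc V z * ‖coordDbar gx gy z‖ₑ ^ 2
      ≤ V z * (ENNReal.ofReal k * ‖coordDz gx gy z‖ₑ) ^ 2 := by gcongr
    _ = ENNReal.ofReal (k ^ 2) * (V z * ‖coordDz gx gy z‖ₑ ^ 2) := by
        rw [ENNReal.ofReal_pow h.nonneg]; ring

theorem wirtingerDz_mollify (h : SobolevData φ gx gy O k) (ρ : ContDiffBump (0 : ℂ)) {y : ℂ}
    (hy : Metric.closedBall y ρ.rOut ⊆ O) :
    wirtingerDz (mollify ρ φ) y = mollify ρ (coordDz gx gy) y := by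
  rw [mollify_coordDz ρ (h.memLp_x.locallyIntegrable one_le_two)
    (h.memLp_y.locallyIntegrable one_le_two), wirtingerDz, linearCoeff, coordDz,
    fderiv_mollify_apply_of_hasWeakDeriv ρ h.locallyIntegrable h.weak_x hy,
    fderiv_mollify_apply_of_hasWeakDeriv ρ h.locallyIntegrable h.weak_y hy]

theorem wirtingerDbar_mollify (h : SobolevData φ gx gy O k) (ρ : ContDiffBump (0 : ℂ)) {y : ℂ}
    (hy : Metric.closedBall y ρ.rOut ⊆ O) :
    wirtingerDbar (mollify ρ φ) y = mollify ρ (coordDbar gx gy) y := by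
  rw [mollify_coordDbar ρ (h.memLp_x.locallyIntegrable one_le_two)
    (h.memLp_y.locallyIntegrable one_le_two), wirtingerDbar, antilinearCoeff, coordDbar,
    fderiv_mollify_apply_of_hasWeakDeriv ρ h.locallyIntegrable h.weak_x hy,
    fderiv_mollify_apply_of_hasWeakDeriv ρ h.locallyIntegrable h.weak_y hy]

theorem lintegral_diskWeight_mul_mollify_dbar_le (h : SobolevData φ gx gy O k) {β : ℝ}
    (hβ0 : 0 < β) (hβ1 : β < 1) {δ : ℝ} (hδ : 0 < δ) (a : ℂ) {ρ : ContDiffBump (0 : ℂ)}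
    (hρ : ρ.rOut ≤ δ) :
    ∫⁻ z, diskWeight β δ (z - a) * ‖mollify ρ (coordDbar gx gy) z‖ₑ ^ 2 ≤
      ENNReal.ofReal (4 * k ^ 2) * ∫⁻ z, diskWeight β δ (z - a) * ‖coordDz gx gy z‖ₑ ^ 2 := by
  refine lintegral_diskWeight_mul_enorm_mollify_sq_le β hδ ρ h.measurable_dbar fun b hb => ?_
  have hweight (z : ℂ) : diskWeight β δ (z - b) ≤ 4 * diskWeight β δ (z - a) := by
    rw [← sub_add_sub_cancel z a b]
    refine diskWeight_add_le hβ0 hβ1 hδ _ ?_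
    rw [← dist_eq_norm, dist_comm]
    exact (Metric.mem_ball.1 hb).le.trans hρ
  calc ∫⁻ z, diskWeight β δ (z - b) * ‖coordDbar gx gy z‖ₑ ^ 2
      ≤ ∫⁻ z, 4 * (diskWeight β δ (z - a) * ‖coordDbar gx gy z‖ₑ ^ 2) := by
        refine lintegral_mono fun z => ?_
        rw [← mul_assoc]
        exact mul_le_mul_left (hweight z) _
    _ = 4 * ∫⁻ z, diskWeight β δ (z - a) * ‖coordDbar gx gy z‖ₑ ^ 2 :=
        lintegral_const_mul' _ _ (by norm_num)
    _ ≤ 4 * (ENNReal.ofReal (k ^ 2) *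
          ∫⁻ z, diskWeight β δ (z - a) * ‖coordDz gx gy z‖ₑ ^ 2) := by
        gcongr
        exact h.lintegral_mul_dbar_le _
    _ = ENNReal.ofReal (4 * k ^ 2) * ∫⁻ z, diskWeight β δ (z - a) * ‖coordDz gx gy z‖ₑ ^ 2 := by
        rw [ENNReal.ofReal_mul (by norm_num), ENNReal.ofReal_ofNat, mul_assoc]

theorem weighted_energy_mollify_le (h : SobolevData φ gx gy O k) {β c C : ℝ} (hβ0 : 0 < β)
    (hβ1 : β < 1) (hC : 0 < C) (hcC : WeightedEnergyBound β c C)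
    (hk : C * (4 * k ^ 2) ≤ c / 2) {a : ℂ} {δ R : ℝ} (hδ : 0 < δ) (hδR : δ ≤ R)
    (ha : Metric.closedBall a (2 * R) ⊆ O) {ρ : ContDiffBump (0 : ℂ)} (hρ : ρ.rOut ≤ δ) :
    ENNReal.ofReal c * ∫⁻ z in Metric.ball a R,
        diskWeight β δ (z - a) * ‖mollify ρ (coordDz gx gy) z‖ₑ ^ 2 ≤
      ENNReal.ofReal (R ^ (-2 * β)) * (∫⁻ z, ‖coordDz gx gy z‖ₑ ^ 2) +
        ENNReal.ofReal (c / 2) * ∫⁻ z, diskWeight β δ (z - a) * ‖coordDz gx gy z‖ₑ ^ 2 := by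
  have hsub (z : ℂ) (hz : z ∈ Metric.ball a R) : Metric.closedBall z ρ.rOut ⊆ O := by
    refine (Metric.closedBall_subset_closedBall' ?_).trans ha
    rw [Metric.mem_ball] at hz
    linarith
  have hdz (V : ℂ → ℝ≥0∞) : ∫⁻ z in Metric.ball a R, V z * ‖wirtingerDz (mollify ρ φ) z‖ₑ ^ 2 =
      ∫⁻ z in Metric.ball a R, V z * ‖mollify ρ (coordDz gx gy) z‖ₑ ^ 2 :=
    setLIntegral_congr_fun measurableSet_ball fun z hz => by
      simp only [h.wirtingerDz_mollify ρ (hsub z hz)]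
  have hdbar (V : ℂ → ℝ≥0∞) :
      ∫⁻ z in Metric.ball a R, V z * ‖wirtingerDbar (mollify ρ φ) z‖ₑ ^ 2 =
        ∫⁻ z in Metric.ball a R, V z * ‖mollify ρ (coordDbar gx gy) z‖ₑ ^ 2 :=
    setLIntegral_congr_fun measurableSet_ball fun z hz => by
      simp only [h.wirtingerDbar_mollify ρ (hsub z hz)]
  have henergy := hcC (mollify ρ φ) (contDiff_mollify ρ h.locallyIntegrable (n := 2)) a δ R hδ hδR
  have hdz_one := hdz fun _ => 1
  simp only [one_mul] at hdz_one
  rw [hdz, hdbar, hdz_one] at henergy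
  refine henergy.trans (add_le_add (mul_le_mul_right ?_ _) ?_)
  · exact (setLIntegral_le_lintegral _ _).trans (lintegral_enorm_mollify_sq_le ρ h.measurable_dz)
  · refine (mul_le_mul_right ((setLIntegral_le_lintegral _ _).trans
      (h.lintegral_diskWeight_mul_mollify_dbar_le hβ0 hβ1 hδ a hρ)) _).trans ?_
    rw [← mul_assoc, ← ENNReal.ofReal_mul hC.le]
    exact mul_le_mul_left (ENNReal.ofReal_le_ofReal hk) _

theorem weighted_energy_le (h : SobolevData φ gx gy O k) {β c C : ℝ} (hβ0 : 0 < β) (hβ1 : β < 1)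
    (hc : 0 < c) (hC : 0 < C) (hcC : WeightedEnergyBound β c C)
    (hk : C * (4 * k ^ 2) ≤ c / 2) {a : ℂ} {δ R : ℝ} (hδ : 0 < δ) (hδR : δ ≤ R)
    (ha : Metric.closedBall a (2 * R) ⊆ O) :
    ∫⁻ z, diskWeight β δ (z - a) * ‖coordDz gx gy z‖ₑ ^ 2 ≤
      ENNReal.ofReal (2 * (1 + c) / c * R ^ (-2 * β)) * ∫⁻ z, ‖coordDz gx gy z‖ₑ ^ 2 := by
  have hR : 0 < R := hδ.trans_le hδR
  have hc0 : ENNReal.ofReal c ≠ 0 := (ENNReal.ofReal_pos.2 hc).ne'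
  refine le_of_le_add_of_mul_le hc (Real.rpow_nonneg hR.le _) h.energy_ne_top
    (lintegral_diskWeight_mul_ne_top hβ0 hδ a h.energy_ne_top)
    (lintegral_diskWeight_mul_le_add hβ0 hR a _) ?_
  rw [mul_comm, ← ENNReal.le_div_iff_mul_le (Or.inl hc0) (Or.inl ENNReal.ofReal_ne_top)]
  refine setLIntegral_mul_enorm_sq_le_of_mollify hδ (h.memLp_dz.locallyIntegrable one_le_two)
    (measurable_diskWeight_sub β hδ a) (fun _ => ENNReal.ofReal_ne_top) fun n => ?_
  rw [ENNReal.le_div_iff_mul_le (Or.inl hc0) (Or.inl ENNReal.ofReal_ne_top), mul_comm]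
  exact h.weighted_energy_mollify_le hβ0 hβ1 hC hcC hk hδ hδR ha (shrinkingBump_rOut_le hδ n)

theorem integral_gradNorm_mollify_le (h : SobolevData φ gx gy O k) (hk1 : k ≤ 1) (β : ℝ) {δ : ℝ}
    (hδ : 0 < δ) {ρ : ContDiffBump (0 : ℂ)} {a : ℂ} {M : ℝ≥0∞} (hM : M ≠ ⊤)
    (hMle : ∀ b ∈ Metric.ball a ρ.rOut,
      ∫⁻ z, diskWeight β δ (z - b) * ‖coordDz gx gy z‖ₑ ^ 2 ≤ M)
    {r : ℝ} (hsub : ∀ z ∈ Metric.ball a r, Metric.closedBall z ρ.rOut ⊆ O) :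
    ∫ z in Metric.ball a r, radialWeight β δ ‖z - a‖ * gradNorm (mollify ρ φ) z ^ 2 ≤
      4 * M.toReal := by
  have hgrad := continuous_gradNorm (contDiff_mollify ρ h.locallyIntegrable (n := 1))
  have hweight := continuous_radialWeight β hδ
  have hdz := lintegral_diskWeight_mul_enorm_mollify_sq_le β hδ ρ h.measurable_dz hMle
  have hdbar := lintegral_diskWeight_mul_enorm_mollify_sq_le β hδ ρ h.measurable_dbar
    fun b hb => (h.lintegral_mul_dbar_le _).trans (mul_le_of_le_one_of_le
      (ENNReal.ofReal_le_one.2 (pow_le_one₀ h.nonneg hk1)) (hMle b hb))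
  have hmeas : Measurable fun z =>
      2 * (diskWeight β δ (z - a) * ‖mollify ρ (coordDz gx gy) z‖ₑ ^ 2) :=
    ((measurable_diskWeight_sub β hδ a).mul
      ((contDiff_mollify ρ (h.memLp_dz.locallyIntegrable one_le_two)
        (n := 0)).continuous.measurable.enorm.pow_const 2)).const_mul 2
  rw [← ENNReal.ofReal_le_ofReal_iff (by positivity), ofReal_setIntegral_ball (by fun_prop)
    fun z => mul_nonneg (radialWeight_nonneg β hδ _) (sq_nonneg _)]
  calc ∫⁻ z in Metric.ball a r,
        ENNReal.ofReal (radialWeight β δ ‖z - a‖ * gradNorm (mollify ρ φ) z ^ 2)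
      ≤ ∫⁻ z in Metric.ball a r,
          (2 * (diskWeight β δ (z - a) * ‖mollify ρ (coordDz gx gy) z‖ₑ ^ 2) +
            2 * (diskWeight β δ (z - a) * ‖mollify ρ (coordDbar gx gy) z‖ₑ ^ 2)) := by
        refine setLIntegral_mono' measurableSet_ball fun z hz => ?_
        rw [gradNorm, h.wirtingerDz_mollify ρ (hsub z hz), h.wirtingerDbar_mollify ρ (hsub z hz)]
        exact ofReal_radialWeight_mul_add_sq_le β hδ _ _ _
    _ ≤ ∫⁻ z, (2 * (diskWeight β δ (z - a) * ‖mollify ρ (coordDz gx gy) z‖ₑ ^ 2) +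
          2 * (diskWeight β δ (z - a) * ‖mollify ρ (coordDbar gx gy) z‖ₑ ^ 2)) :=
        setLIntegral_le_lintegral _ _
    _ ≤ 2 * M + 2 * M := by
        rw [lintegral_add_left hmeas,
          lintegral_const_mul' _ _ (by norm_num), lintegral_const_mul' _ _ (by norm_num)]
        gcongr
    _ = ENNReal.ofReal (4 * M.toReal) := by
        rw [ENNReal.ofReal_mul (by norm_num), ENNReal.ofReal_toReal hM, ENNReal.ofReal_ofNat]
        ring

theorem exists_norm_sub_le_of_weightedEnergyBound (h : SobolevData φ gx gy O k) (hk1 : k ≤ 1)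
    {β c C : ℝ} (hβ0 : 0 < β) (hβ1 : β < 1) (hc : 0 < c) (hC : 0 < C)
    (hcC : WeightedEnergyBound β c C) (hk : C * (4 * k ^ 2) ≤ c / 2) {R : ℝ} (hR : 0 < R) :
    ∃ K : ℝ, ∀ a b : ℂ, ContinuousAt φ a → ContinuousAt φ b → ‖a - b‖ ≤ R →
      Metric.closedBall a (3 * R) ⊆ O → Metric.closedBall b (3 * R) ⊆ O →
      ‖φ a - φ b‖ ≤ K * ‖a - b‖ ^ β := by
  set M : ℝ≥0∞ := ENNReal.ofReal (2 * (1 + c) / c * R ^ (-2 * β)) * ∫⁻ z, ‖coordDz gx gy z‖ₑ ^ 2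
  have hM : M ≠ ⊤ := ENNReal.mul_ne_top ENNReal.ofReal_ne_top h.energy_ne_top
  refine ⟨4 / Real.pi * (4 * M.toReal / 2 + Real.pi / (2 * β)), fun a b hφa hφb hab ha hb => ?_⟩
  rcases eq_or_ne a b with rfl | hne
  · simp [Real.zero_rpow hβ0.ne']
  have hr : 0 < ‖a - b‖ := norm_pos_iff.2 (sub_ne_zero.2 hne)
  refine le_of_tendsto ((tendsto_mollify_shrinkingBump hR h.locallyIntegrable hφa).sub
    (tendsto_mollify_shrinkingBump hR h.locallyIntegrable hφb)).norm
    (Eventually.of_forall fun n => ?_)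
  set ρ := shrinkingBump hR n
  have hρR : ρ.rOut ≤ R := shrinkingBump_rOut_le hR n
  have hψ : ContDiff ℝ 1 (mollify ρ φ) := contDiff_mollify ρ h.locallyIntegrable (n := 1)
  have henergy (x : ℂ) (hx : Metric.closedBall x (3 * R) ⊆ O) (δ : ℝ) (hδ : 0 < δ)
      (hδr : δ ≤ ‖a - b‖) :
      ∫ z in Metric.ball x ‖a - b‖, radialWeight β δ ‖z - x‖ * gradNorm (mollify ρ φ) z ^ 2 ≤
        4 * M.toReal := by
    refine h.integral_gradNorm_mollify_le hk1 β hδ hM (fun y hy => ?_) fun z hz => ?_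
    · refine h.weighted_energy_le hβ0 hβ1 hc hC hcC hk hδ (hδr.trans hab)
        ((Metric.closedBall_subset_closedBall' ?_).trans hx)
      linarith [Metric.mem_ball.1 hy]
    · refine (Metric.closedBall_subset_closedBall' ?_).trans hx
      linarith [Metric.mem_ball.1 hz]
  have hintegral (x : ℂ) (hx : Metric.closedBall x (3 * R) ⊆ O) :=
    integral_le_of_weighted_sq_le (continuous_gradNorm hψ) x hβ0 hr (henergy x hx)
  refine (norm_sub_le_of_gradNorm hψ hr rfl (hintegral a ha) (hintegral b hb)).trans_eq ?_
  ring

theorem exists_norm_sub_le {β : ℝ} (hβ0 : 0 < β) (hβ1 : β < 1) : ∃ k₀ : ℝ, 0 < k₀ ∧ k₀ < 1 ∧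
    ∀ {φ gx gy : ℂ → ℂ} {O : Set ℂ} {k : ℝ}, SobolevData φ gx gy O k → k < k₀ →
    ∀ R : ℝ, 0 < R → ∃ K : ℝ, ∀ a b : ℂ, ContinuousAt φ a → ContinuousAt φ b → ‖a - b‖ ≤ R →
      Metric.closedBall a (3 * R) ⊆ O → Metric.closedBall b (3 * R) ⊆ O →
      ‖φ a - φ b‖ ≤ K * ‖a - b‖ ^ β := by
  obtain ⟨c, C, hc, hC, hcC⟩ := exists_weightedEnergyBound hβ0 hβ1
  have : 0 < c / (8 * C) := by positivity
  refine ⟨min (1 / 2) (c / (8 * C)), by positivity, (min_le_left _ _).trans_lt (by norm_num), ?_⟩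
  intro φ gx gy O k h hk R hR
  have hk_half : k < 1 / 2 := hk.trans_le (min_le_left _ _)
  have hk_small : k < c / (8 * C) := hk.trans_le (min_le_right _ _)
  refine h.exists_norm_sub_le_of_weightedEnergyBound (by linarith) hβ0 hβ1 hc hC hcC ?_ hR
  rw [lt_div_iff₀ (by positivity)] at hk_small
  have hk_sq : k ^ 2 ≤ k := pow_le_of_le_one h.nonneg (by linarith) two_ne_zero
  have hCk : C * k ^ 2 ≤ C * k := by gcongr
  linarith

end SobolevData

/-! ### Boundary dilatation one implies Hölder continuity -/

theorem HasWeakDeriv.indicator {φ f g : ℂ → ℂ} {U N : Set ℂ} {v : ℂ} (hw : HasWeakDeriv φ U v f)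
    (hN : MeasurableSet N) (hNU : N ⊆ U) (hfg : f =ᵐ[volume.restrict N] g) :
    HasWeakDeriv (N.indicator φ) (interior N) v (N.indicator g) := by
  intro χ hχ hχc hχN
  have hχ_zero (z : ℂ) (hz : z ∉ N) : χ z = 0 := by
    by_contra hne
    exact hz (interior_subset (hχN (subset_tsupport χ hne)))
  have hfderiv_zero (z : ℂ) (hz : z ∉ N) : fderiv ℝ χ z = 0 := by
    by_contra hne
    exact hz (interior_subset (hχN (support_fderiv_subset ℝ hne)))
  calc ∫ z, fderiv ℝ χ z v • N.indicator φ z = ∫ z, fderiv ℝ χ z v • φ z := by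
        congr 1; funext z
        by_cases hz : z ∈ N
        · rw [indicator_of_mem hz]
        · rw [hfderiv_zero z hz, zero_apply, zero_smul, zero_smul]
    _ = -∫ z, χ z • f z := hw χ hχ hχc (hχN.trans (interior_subset.trans hNU))
    _ = -∫ z, χ z • N.indicator g z := by
        congr 1
        refine integral_congr_ae ?_
        filter_upwards [(ae_restrict_iff' hN).1 hfg] with z hz
        by_cases hzN : z ∈ N
        · rw [indicator_of_mem hzN, hz hzN]
        · rw [hχ_zero z hzN, zero_smul, zero_smul]

theorem IsQuasiconformalOn.exists_sobolevData {φ : ℂ → ℂ} {U : Set ℂ} {k : ℝ}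
    (h : IsQuasiconformalOn φ U k) {N : Set ℂ} (hN : IsCompact N) (hNU : N ⊆ U) :
    ∃ gx gy : ℂ → ℂ, SobolevData (N.indicator φ) gx gy (interior N) k := by
  obtain ⟨φx, φy, hL, hx, hy, hdil⟩ := h.dilatation
  obtain ⟨hLx, hLy⟩ := hL N hNU hN
  have hNm : MeasurableSet N := hN.measurableSet
  have hφ : ContinuousOn φ N :=
    (continuousOn_iff_continuous_domRestrict.2 h.embedding.continuous).mono hNU
  have hmem (f : ℂ → ℂ) (hf : MemLp f 2 (volume.restrict N)) : MemLp (N.indicator (hf.1.mk f)) 2 :=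
    (memLp_indicator_iff_restrict hNm).2 (hf.ae_eq hf.1.ae_eq_mk)
  refine ⟨N.indicator (hLx.1.mk φx), N.indicator (hLy.1.mk φy),
    ((integrable_indicator_iff hNm).2 (hφ.integrableOn_compact hN)).locallyIntegrable,
    hLx.1.stronglyMeasurable_mk.measurable.indicator hNm,
    hLy.1.stronglyMeasurable_mk.measurable.indicator hNm, hmem φx hLx, hmem φy hLy,
    hx.indicator hNm hNU hLx.1.ae_eq_mk, hy.indicator hNm hNU hLy.1.ae_eq_mk, h.nonneg, ?_⟩
  filter_upwards [(ae_restrict_iff' hNm).1 hLx.1.ae_eq_mk, (ae_restrict_iff' hNm).1 hLy.1.ae_eq_mk,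
    (ae_restrict_iff' h.isOpen.measurableSet).1 hdil] with z hzx hzy hz_dil
  by_cases hz : z ∈ N
  · simp only [coordDz, coordDbar, indicator_of_mem hz, ← hzx hz, ← hzy hz]
    exact hz_dil (hNU hz)
  · simp [coordDz, coordDbar, indicator_of_notMem hz]

theorem norm_circleCover (x : ℝ) : ‖circleCover x‖ = 1 := by
  rw [circleCover, Complex.norm_exp]
  simp

theorem norm_circleCover_sub (x y : ℝ) :
    ‖circleCover x - circleCover y‖ = 2 * |Real.sin (Real.pi * (x - y))| := by
  have hfactor : circleCover x - circleCover y =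
      circleCover y * (Complex.exp (Complex.I * ((2 * Real.pi * (x - y) : ℝ) : ℂ)) - 1) := by
    rw [circleCover, circleCover, mul_sub, ← Complex.exp_add, mul_one]
    congr 2
    push_cast
    ring
  rw [hfactor, norm_mul, norm_circleCover, one_mul, Complex.norm_exp_I_mul_ofReal_sub_one, norm_mul,
    Real.norm_eq_abs, Real.norm_eq_abs, abs_two]
  congr 3
  ring

theorem norm_circleCover_sub_le (x y : ℝ) :
    ‖circleCover x - circleCover y‖ ≤ 2 * Real.pi * |x - y| := by
  rw [norm_circleCover_sub, mul_assoc]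
  refine mul_le_mul_of_nonneg_left (Real.abs_sin_le_abs.trans_eq ?_) two_pos.le
  rw [abs_mul, abs_of_pos Real.pi_pos]

theorem le_norm_circleCover_sub {x y : ℝ} (h : |x - y| ≤ 1 / 2) :
    4 * |x - y| ≤ ‖circleCover x - circleCover y‖ := by
  have := Real.pi_pos
  have habs : |Real.sin (Real.pi * (x - y))| = |Real.sin (Real.pi * |x - y|)| := by
    rcases abs_choice (x - y) with hxy | hxy <;> rw [hxy]
    rw [mul_neg, Real.sin_neg, abs_neg]
  calc 4 * |x - y| = 2 * (2 / Real.pi * (Real.pi * |x - y|)) := by field_simp; ring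
    _ ≤ 2 * Real.sin (Real.pi * |x - y|) := by
        gcongr
        exact Real.mul_le_sin (by positivity) (by nlinarith)
    _ ≤ 2 * |Real.sin (Real.pi * |x - y|)| := by gcongr; exact le_abs_self _
    _ = ‖circleCover x - circleCover y‖ := by rw [norm_circleCover_sub, habs]

theorem IsQCExtension.exists_sobolevData {H : ℝ ≃o ℝ} {U : Set ℂ} {φ : ℂ → ℂ} {k : ℝ}
    (h : IsQCExtension H U φ k) :
    ∃ (ψ gx gy : ℂ → ℂ) (O : Set ℂ) (r : ℝ), SobolevData ψ gx gy O k ∧ 0 < r ∧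
      ∀ x, ContinuousAt ψ (circleCover x) ∧ Metric.closedBall (circleCover x) r ⊆ O ∧
        ψ (circleCover x) = circleCover (H x) := by
  obtain ⟨ε, hε, hεU⟩ := (isCompact_sphere (0 : ℂ) 1).exists_cthickening_subset_open
    h.quasiconformal.isOpen h.circle_subset
  set N := Metric.cthickening ε (Metric.sphere (0 : ℂ) 1)
  obtain ⟨gx, gy, hS⟩ :=
    h.quasiconformal.exists_sobolevData (isCompact_sphere (0 : ℂ) 1).cthickening hεU
  refine ⟨N.indicator φ, gx, gy, interior N, ε / 2, hS, by positivity, fun x => ?_⟩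
  have hcirc : circleCover x ∈ Metric.sphere (0 : ℂ) 1 := by
    rw [mem_sphere_zero_iff_norm, norm_circleCover]
  have hball : Metric.closedBall (circleCover x) (ε / 2) ⊆ interior N :=
    calc Metric.closedBall (circleCover x) (ε / 2) ⊆ Metric.ball (circleCover x) ε :=
          Metric.closedBall_subset_ball (half_lt_self hε)
      _ ⊆ Metric.thickening ε (Metric.sphere (0 : ℂ) 1) :=
          Metric.ball_subset_thickening hcirc ε
      _ ⊆ interior N := Metric.thickening_subset_interior_cthickening _ _
  have hmem : circleCover x ∈ interior N := hball (Metric.mem_closedBall_self (by positivity))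
  refine ⟨?_, hball, by rw [indicator_of_mem (interior_subset hmem), h.extends_map]⟩
  have hφ : ContinuousAt φ (circleCover x) :=
    (continuousOn_iff_continuous_domRestrict.2 h.quasiconformal.embedding.continuous).continuousAt
      (h.quasiconformal.isOpen.mem_nhds (h.circle_subset hcirc))
  refine hφ.congr ?_
  filter_upwards [isOpen_interior.mem_nhds hmem] with z hz
  rw [indicator_of_mem (interior_subset hz)]

theorem exists_norm_circleCover_comp_sub_le {H : ℝ ≃o ℝ} (h : boundaryDilatation H = 1) {β : ℝ}
    (hβ0 : 0 < β) (hβ1 : β < 1) :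
    ∃ K r : ℝ, 0 < r ∧ ∀ x y, ‖circleCover x - circleCover y‖ ≤ r →
      ‖circleCover (H x) - circleCover (H y)‖ ≤ K * ‖circleCover x - circleCover y‖ ^ β := by
  obtain ⟨k₀, hk₀, hk₁, hHolder⟩ := SobolevData.exists_norm_sub_le hβ0 hβ1
  obtain ⟨U, φ, k, hk, hφ⟩ := exists_isQCExtension_of_boundaryDilatation_eq_one h hk₀ hk₁
  obtain ⟨ψ, gx, gy, O, r, hS, hr, hψ⟩ := hφ.exists_sobolevData
  obtain ⟨K, hK⟩ := hHolder hS hk (r / 3) (by positivity)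
  refine ⟨K, r / 3, by positivity, fun x y hxy => ?_⟩
  obtain ⟨hx_cont, hx_ball, hx⟩ := hψ x
  obtain ⟨hy_cont, hy_ball, hy⟩ := hψ y
  rw [← mul_div_cancel₀ r three_ne_zero] at hx_ball hy_ball
  rw [← hx, ← hy]
  exact hK _ _ hx_cont hy_cont hxy hx_ball hy_ball

theorem dist_le_mul_rpow_of_dist_lt {α γ : Type*} [PseudoMetricSpace α] [PseudoMetricSpace γ]
    {f : α → γ} {K D η β : ℝ} (hK : 0 ≤ K) (hη : 0 < η) (hβ : 0 ≤ β) {x y : α}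
    (hD : dist (f x) (f y) ≤ D)
    (hnear : dist x y < η → dist (f x) (f y) ≤ K * dist x y ^ β) :
    dist (f x) (f y) ≤ (K + D * (η ^ β)⁻¹) * dist x y ^ β := by
  have hD0 : 0 ≤ D := dist_nonneg.trans hD
  have : 0 ≤ K * dist x y ^ β := by positivity
  have : 0 ≤ D * ((η ^ β)⁻¹ * dist x y ^ β) := by positivity
  rw [add_mul, mul_assoc D]
  rcases lt_or_ge (dist x y) η with hxy | hxy
  · linarith [hnear hxy]
  · have hone : 1 ≤ (η ^ β)⁻¹ * dist x y ^ β := by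
      rw [inv_mul_eq_div, one_le_div (Real.rpow_pos_of_pos hη _)]
      exact Real.rpow_le_rpow hη.le hxy hβ
    linarith [le_mul_of_one_le_right hD0 hone]

theorem exists_holder_of_boundaryDilatation_eq_one {H : ℝ ≃o ℝ} (h : boundaryDilatation H = 1)
    {β : ℝ} (hβ0 : 0 < β) (hβ1 : β < 1) :
    ∃ C, ∀ x ∈ Icc (0 : ℝ) 1, ∀ y ∈ Icc (0 : ℝ) 1, |H x - H y| ≤ C * |x - y| ^ β := by
  obtain ⟨K, r, hr, hK⟩ := exists_norm_circleCover_comp_sub_le h hβ0 hβ1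
  obtain ⟨δ, hδ, hδH⟩ := Metric.uniformContinuousOn_iff.1
    (isCompact_Icc.uniformContinuousOn_of_continuous (s := Icc (0 : ℝ) 1)
      H.continuous.continuousOn) (1 / 2) (by norm_num)
  have := Real.pi_pos
  refine ⟨|K| * (2 * Real.pi) ^ β + (H 1 - H 0) * (min δ (r / (2 * Real.pi)) ^ β)⁻¹,
    fun x hx y hy => ?_⟩
  simp only [← Real.dist_eq]
  refine dist_le_mul_rpow_of_dist_lt (by positivity) (by positivity) hβ0.le
    (Real.dist_le_of_mem_Icc ⟨H.monotone hx.1, H.monotone hx.2⟩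
      ⟨H.monotone hy.1, H.monotone hy.2⟩) fun hxy => ?_
  have hnear : ‖circleCover x - circleCover y‖ ≤ r := by
    refine (norm_circleCover_sub_le x y).trans ?_
    have hxy_r := hxy.le.trans (min_le_right _ _)
    rwa [le_div_iff₀ (by positivity), mul_comm] at hxy_r
  have hH : dist (H x) (H y) < 1 / 2 := hδH x hx y hy (hxy.trans_le (min_le_left _ _))
  calc dist (H x) (H y) ≤ 4 * dist (H x) (H y) := by linarith [dist_nonneg (x := H x) (y := H y)]
    _ ≤ ‖circleCover (H x) - circleCover (H y)‖ := le_norm_circleCover_sub hH.le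
    _ ≤ K * ‖circleCover x - circleCover y‖ ^ β := hK x y hnear
    _ ≤ |K| * (2 * Real.pi * dist x y) ^ β := by
        gcongr
        exacts [le_abs_self K, norm_circleCover_sub_le x y]
    _ = |K| * (2 * Real.pi) ^ β * dist x y ^ β := by
        rw [Real.mul_rpow (by positivity) dist_nonneg, mul_assoc]

/-! ### The Teichmüller space of marked circle endomorphisms -/

theorem teichEquiv_iff_dualDerivative_eq {d : ℕ} (hd : 2 ≤ d) (f g : MarkedMap d) :
    TeichEquiv f g ↔ dualDerivative f.map.1 = dualDerivative g.map.1 := by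
  obtain ⟨hf1, hf2⟩ := f.map.2
  obtain ⟨hg1, hg2⟩ := g.map.2
  have h := f.isConj g
  refine ⟨fun hT => h.dualDerivative_eq hf1 hf2 hg1 hg2 hT, fun hD => ?_⟩
  obtain ⟨C, hC⟩ := exists_markovLength_le_of_dualDerivative_eq hd hf1 hf2 hg1 hg2 hD
  exact h.isC1Diffeo_of_markovLength_le hd hf1 hf2 hg1 hg2 hC

theorem teichDist_eq_zero_iff_boundaryDilatation {d : ℕ} (f g : MarkedMap d) :
    teichDist f g = 0 ↔ boundaryDilatation (f.conjugacy g) = 1 := by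
  rw [teichDist, mul_eq_zero, ENNReal.log_eq_one_iff]
  refine or_iff_right ?_
  rw [EReal.coe_eq_zero]
  norm_num

theorem teichDist_eq_zero_iff {d : ℕ} (hd : 2 ≤ d) (f g : MarkedMap d) :
    teichDist f g = 0 ↔ TeichEquiv f g := by
  rw [teichDist_eq_zero_iff_boundaryDilatation]
  obtain ⟨hf1, hf2⟩ := f.map.2
  obtain ⟨hg1, hg2⟩ := g.map.2
  have h := f.isConj g
  refine ⟨fun hB => ?_, fun hT => boundaryDilatation_eq_one h.map_add_one hT⟩
  obtain ⟨C, hC⟩ := h.exists_markovLength_le_of_holder hf1 hf2 hg1 hg2 fun β hβ =>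
    exists_holder_of_boundaryDilatation_eq_one hB hβ.1 hβ.2
  exact h.isC1Diffeo_of_markovLength_le hd hf1 hf2 hg1 hg2 hC

/-- The dual derivative as a function on the Teichmüller space. -/
def teichDualDerivative {d : ℕ} (hd : 2 ≤ d) : TeichSpace d → HolderDualDerivatives d :=
  Quotient.lift (s := teichSetoid d)
    (fun f => ⟨dualDerivative f.map.1, isHolderDual_dualDerivative f.map.2.1 f.map.2.2, f.map,
      hasDualDerivative f.map.2.1 f.map.2.2, rfl⟩)
    fun f g h => Subtype.ext ((teichEquiv_iff_dualDerivative_eq hd f g).1 h)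

theorem bijective_teichDualDerivative {d : ℕ} (hd : 2 ≤ d) :
    Function.Bijective (teichDualDerivative hd) := by
  constructor
  · rintro ⟨f⟩ ⟨g⟩ h
    exact Quotient.sound (s := teichSetoid d)
      ((teichEquiv_iff_dualDerivative_eq hd f g).2 (congrArg Subtype.val h))
  · rintro ⟨D, hD, F, hF, rfl⟩
    obtain ⟨H, hH⟩ := F.2.2.exists_isMarking hd F.2.1.differentiable
    exact ⟨Quotient.mk (teichSetoid d) ⟨F, H, hH⟩, rfl⟩

end CircleDynamics

end

theorem mainTheorem3 (d : ℕ) (hd : 2 ≤ d) :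
    -- every map in the space has exactly one marking
    (∀ F : C1Plus d, ∃! H : ℝ ≃o ℝ, IsMarking F.1 H) ∧
    -- its dual derivative exists, is positive and Hölder continuous
    (∀ F : C1Plus d, HasDualDerivative F.1 ∧ IsHolderDual (dualDerivative F.1)) ∧
    -- Teichmüller equivalence is equality of the dual derivatives
    (∀ f g : MarkedMap d,
      TeichEquiv f g ↔ dualDerivative f.map.1 = dualDerivative g.map.1) ∧
    -- the Teichmüller distance separates points, whichever representatives are used
    (∀ (P P' : TeichSpace d) (f g : MarkedMap d),
      Quotient.mk (teichSetoid d) f = P → Quotient.mk (teichSetoid d) g = P' →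
        (teichDist f g = 0 ↔ P = P')) ∧
    -- the Teichmüller space is identified with the space of Hölder continuous dual derivatives
    (∃ e : TeichSpace d ≃ HolderDualDerivatives d, ∀ f : MarkedMap d,
      (e (Quotient.mk (teichSetoid d) f) : DualSpace d → ℝ) = dualDerivative f.map.1) := by
  refine ⟨fun F => ?_,
    fun F => ⟨hasDualDerivative F.2.1 F.2.2, isHolderDual_dualDerivative F.2.1 F.2.2⟩,
    teichEquiv_iff_dualDerivative_eq hd, ?_,
    Equiv.ofBijective _ (bijective_teichDualDerivative hd), fun f => rfl⟩
  · obtain ⟨H, hH⟩ := F.2.2.exists_isMarking hd F.2.1.differentiable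
    exact ⟨H, hH, fun H' hH' => IsMarking.unique hd hH' hH⟩
  · rintro P P' f g rfl rfl
    rw [teichDist_eq_zero_iff hd]
    exact (Quotient.eq (r := teichSetoid d)).symm
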